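/- Let $k$ be a field, let $C$ be an integral projective curve over $k$ with generic point $\eta$, let $P\in C$ be a smooth closed point, and let $\mathcal F$ be a torsion-free coherent sheaf on $C$. For a closed point $x\in C$ let $\hat{\mathcal O}_x$ be the completion of the local ring $\mathcal O_x$, let $K_x$ be the quotient ring (total ring of fractions) of $\hat{\mathcal O}_x$, and put $\hat{\mathcal F}_x=\mathcal F_x\otimes_{\mathcal O_x}\hat{\mathcal O}_x$. Let $\prod'_{x}(\hat{\mathcal F}_x\otimes_{\hat{\mathcal O}_x}K_x)$ be the adelic (restricted) product over all closed points $x$ of $C$, i.e. the set of families whose component at $x$ lies in the image of $\hat{\mathcal F}_x$ for all but finitely many $x$. Consider the following two complexes of $k$-vector spaces, placed in degrees $0$ and $1$, with differentials $(a,(f_x)_x)\mapsto (a-f_x)_x$ and $(w,f)\mapsto w-f$: i) the adelic complex $$\mathcal F_\eta\oplus\prod_{x}\hat{\mathcal F}_x\longrightarrow{\prod_{x}}'\bigl(\hat{\mathcal F}_x\otimes_{\hat{\mathcal O}_x}K_x\bigr);$$ ii) the complex $$\Gamma(C-P,\mathcal F)\oplus\hat{\mathcal F}_P\longrightarrow\hat{\mathcal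 F}_P\otimes_{\hat{\mathcal O}_P}K_P .$$ Here $\mathcal F_\eta$, the space of rational sections of $\mathcal F$, is mapped to $\hat{\mathcal F}_x\otimes K_x$ by the canonical map extending $\mathcal F_x\to\hat{\mathcal F}_x\otimes K_x$, and $\Gamma(C-P,\mathcal F)$ is mapped to $\hat{\mathcal F}_P\otimes K_P$ through $\mathcal F_\eta$. Then the two complexes are quasi-isomorphic. More precisely, the natural morphism from ii) to i), given in degree $0$ by sending $(w,f)$ to $w\in\mathcal F_\eta$ together with the family whose component at $P$ is $f$ and whose component at $x\ne P$ is the germ of $w$, and in degree $1$ by the inclusion of the factor at $P$, is a quasi-isomorphism. -/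

import Mathlib

universe u
open CategoryTheory AlgebraicGeometry TopologicalSpace

namespace AdelicCurve

section ProjectiveCurves

attribute [local instance] MvPolynomial.gradedAlgebra

open MvPolynomial

/-- Projective `n`-space over a field `k`, as `Proj k[X₀, …, Xₙ]`. -/
noncomputable def projectiveSpace (k : Type u) [Field k] (n : ℕ) : Scheme.{u} :=
  Proj (homogeneousSubmodule (Fin (n + 1)) k)

/-- The structure morphism of projective space over `k`. -/
noncomputable def projectiveSpaceHom (k : Type u) [Field k] (n : ℕ) :
    projectiveSpace k n ⟶ Spec (.of k) :=
  Proj.toSpecZero (homogeneousSubmodule (Fin (n + 1)) k) ≫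
    Spec.map (CommRingCat.ofHom (algebraMap k (homogeneousSubmodule (Fin (n + 1)) k 0)))

/-- A scheme `C` over the field `k` is a projective curve if it has dimension one and admits a
closed immersion over `k` into some projective space over `k`. -/
class IsProjectiveCurve (k : Type u) [Field k] (C : Scheme.{u}) [C.Over (Spec (.of k))] :
    Prop where
  krullDim_eq_one : topologicalKrullDim C = 1
  exists_isClosedImmersion : ∃ (n : ℕ) (i : C ⟶ projectiveSpace k n),
    IsClosedImmersion i ∧ i ≫ projectiveSpaceHom k n = C ↘ Spec (.of k)

theorem algebraMap_zero_surjective (k : Type u) [Field k] (n : ℕ) :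
    Function.Surjective (algebraMap k (homogeneousSubmodule (Fin (n + 1)) k 0)) := by
  rintro ⟨p, hp⟩
  rw [mem_homogeneousSubmodule, ← totalDegree_zero_iff_isHomogeneous,
    totalDegree_eq_zero_iff_eq_C] at hp
  exact ⟨_, Subtype.ext hp.symm⟩

theorem isProper_projectiveSpaceHom (k : Type u) [Field k] (n : ℕ) :
    IsProper (projectiveSpaceHom k n) := by
  have h1 := algebraMap_zero_surjective k n
  have h2 : Algebra.FiniteType (homogeneousSubmodule (Fin (n + 1)) k 0)
      (MvPolynomial (Fin (n + 1)) k) := by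
    have : IsScalarTower k (homogeneousSubmodule (Fin (n + 1)) k 0)
        (MvPolynomial (Fin (n + 1)) k) := ⟨fun a b c => smul_assoc a b.1 c⟩
    exact Algebra.FiniteType.of_restrictScalars_finiteType k _ _
  have h3 : IsProper (Proj.toSpecZero (homogeneousSubmodule (Fin (n + 1)) k)) := inferInstance
  have h4 : IsClosedImmersion (Spec.map (CommRingCat.ofHom
      (algebraMap k (homogeneousSubmodule (Fin (n + 1)) k 0)))) :=
    IsClosedImmersion.spec_of_surjective _ h1
  have h5 : IsProper (Spec.map (CommRingCat.ofHom
      (algebraMap k (homogeneousSubmodule (Fin (n + 1)) k 0)))) := inferInstance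
  exact MorphismProperty.comp_mem _ _ _ h3 h5

theorem IsProjectiveCurve.isNoetherian (k : Type u) [Field k] (C : Scheme.{u})
    [C.Over (Spec (.of k))] [h : IsProjectiveCurve k C] : IsNoetherian C := by
  obtain ⟨n, i, hi, h⟩ := h.exists_isClosedImmersion
  have := isProper_projectiveSpaceHom k n
  have : IsProper (C ↘ Spec (.of k)) := by
    rw [← h]; infer_instance
  have := LocallyOfFiniteType.isLocallyNoetherian (C ↘ Spec (.of k))
  have : CompactSpace C := QuasiCompact.compactSpace_of_compactSpace (C ↘ Spec (.of k))
  exact {}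

/-- A point of a `k`-scheme is smooth if it has an open neighbourhood which is smooth over `k`. -/
def IsSmoothPoint (k : Type u) [Field k] {C : Scheme.{u}} [C.Over (Spec (.of k))] (x : C) : Prop :=
  ∃ U : C.Opens, x ∈ U ∧ AlgebraicGeometry.Smooth (U.ι ≫ (C ↘ Spec (.of k)))

end ProjectiveCurves

section Dimension

variable {C : Scheme.{u}} [IsIntegral C]

theorem genericPoint_mem (U : C.Opens) {x : C} (hx : x ∈ U) : genericPoint C ∈ U :=
  ((genericPoint_spec C).mem_open_set_iff U.isOpen).mpr ⟨x, trivial, hx⟩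

theorem ne_genericPoint (h : topologicalKrullDim C = 1) {P : C} (hP : IsClosed ({P} : Set C)) :
    genericPoint C ≠ P := by
  rintro rfl
  have h1 : ∀ x : C, x = genericPoint C := fun x => by
    have := (genericPoint_spec C).specializes (Set.mem_univ x)
    rw [specializes_iff_mem_closure, hP.closure_eq] at this
    exact this
  have : Subsingleton (IrreducibleCloseds C) := by
    refine ⟨fun a b => ?_⟩
    have key : ∀ a : IrreducibleCloseds C, (a : Set C) = Set.univ := fun a => by
      obtain ⟨y, hy⟩ := a.isIrreducible.nonempty
      refine Set.eq_univ_of_forall fun x => ?_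
      rw [h1 x, ← h1 y]; exact hy
    exact SetLike.coe_injective ((key a).trans (key b).symm)
  have h2 : topologicalKrullDim C ≤ 0 := Order.krullDim_nonpos_of_subsingleton
  rw [h] at h2
  exact absurd h2 (by decide)

theorem finite_closedPoints_notMem [IsNoetherian C] (h : topologicalKrullDim C = 1)
    (U : C.Opens) (hU : genericPoint C ∈ U) : {x : closedPoints C | x.1 ∉ U}.Finite := by
  obtain ⟨S, hS, hcl, hirr, hU'⟩ := NoetherianSpace.exists_finite_set_isClosed_irreducible
    (s := (U : Set C)ᶜ) U.isOpen.isClosed_compl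
  have key : ∀ x : closedPoints C, x.1 ∉ U → ({x.1} : Set C) ∈ S := by
    intro x hx
    have hx' : x.1 ∈ ⋃₀ S := hU' ▸ hx
    obtain ⟨t, ht, hxt⟩ := hx'
    by_contra hne
    have htU : t ⊆ (U : Set C)ᶜ := hU' ▸ Set.subset_sUnion_of_mem ht
    let a : IrreducibleCloseds C := ⟨{x.1}, isIrreducible_singleton, x.2⟩
    let b : IrreducibleCloseds C := ⟨t, hirr t ht, hcl t ht⟩
    let c : IrreducibleCloseds C := ⟨Set.univ, IrreducibleSpace.isIrreducible_univ C, isClosed_univ⟩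
    have hab : a < b := by
      refine lt_of_le_of_ne (fun y (hy : y = x.1) => hy ▸ hxt) fun hab => hne ?_
      have : ({x.1} : Set C) = t := congrArg (fun z : IrreducibleCloseds C => (z : Set C)) hab
      exact this ▸ ht
    have hbc : b < c := by
      refine lt_of_le_of_ne (fun y _ => Set.mem_univ y) fun hbc => ?_
      have : t = Set.univ := congrArg (fun z : IrreducibleCloseds C => (z : Set C)) hbc
      exact htU (this ▸ Set.mem_univ (genericPoint C)) hU
    let p : LTSeries (IrreducibleCloseds C) :=
      { length := 2
        toFun := ![a, b, c]
        step := fun i => by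
          fin_cases i
          · exact hab
          · exact hbc }
    have hp : ((2 : ℕ) : WithBot ℕ∞) ≤ topologicalKrullDim C := Order.LTSeries.length_le_krullDim p
    rw [h] at hp
    exact absurd hp (by decide)
  refine Set.Finite.of_finite_image (f := fun x : closedPoints C => ({x.1} : Set C))
    (hS.subset ?_) ?_
  · rintro _ ⟨x, hx, rfl⟩
    exact key x hx
  · intro x _ y _ hxy
    exact Subtype.ext (Set.singleton_injective hxy)

end Dimension

section Stalks

open Scheme.Modules

variable {C : Scheme.{u}} (F : C.Modules)

/-- The stalk of a sheaf of modules is a module over the stalk of the structure sheaf. -/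
noncomputable instance stalkModule (x : C) :
    Module (C.presheaf.stalk x) (F.presheaf.stalk x) :=
  let F' : PresheafOfModules.{u} (C.presheaf ⋙ forget₂ CommRingCat RingCat) := F.val
  inferInstanceAs (Module (C.presheaf.stalk x)
    ↑(TopCat.Presheaf.stalk (C := Ab) F'.presheaf x))

theorem germ_smul {x : C} {U : C.Opens} (hx : x ∈ U) (r : Γ(C, U)) (m : Γ(F, U)) :
    F.presheaf.germ U x hx (r • m) = C.presheaf.germ U x hx r • F.presheaf.germ U x hx m :=
  let F' : PresheafOfModules.{u} (C.presheaf ⋙ forget₂ CommRingCat RingCat) := F.val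
  F'.germ_smul x U hx r m

/-- A sheaf of modules is torsion free if all its stalks `F_x` are torsion free over `𝒪_x`. -/
def IsTorsionFreeSheaf : Prop :=
  ∀ x : C, Module.IsTorsionFree (C.presheaf.stalk x) (F.presheaf.stalk x)

/-- The stalk `F_η` at the generic point `η`, i.e. the space of rational sections of `F`. -/
def GenericStalk [IrreducibleSpace C] : Type u := F.presheaf.stalk (genericPoint C)

variable [IrreducibleSpace C]

noncomputable instance : AddCommGroup (GenericStalk F) :=
  inferInstanceAs (AddCommGroup (F.presheaf.stalk (genericPoint C)))

noncomputable instance : Module C.functionField (GenericStalk F) :=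
  inferInstanceAs (Module (C.presheaf.stalk (genericPoint C)) (F.presheaf.stalk (genericPoint C)))

/-- `F_η` as a module over the local ring `𝒪_x`, along `𝒪_x → k(C)`. -/
noncomputable instance (x : C) : Module (C.presheaf.stalk x) (GenericStalk F) :=
  Module.compHom _ (algebraMap (C.presheaf.stalk x) C.functionField)

instance (x : C) : IsScalarTower (C.presheaf.stalk x) C.functionField (GenericStalk F) :=
  .of_algebraMap_smul fun _ _ => rfl

/-- The germ at the generic point of a section over a nonempty open set. -/
noncomputable def genericGerm (U : C.Opens) (hU : genericPoint C ∈ U) : Γ(F, U) →+ GenericStalk F :=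
  (F.presheaf.germ U (genericPoint C) hU).hom

theorem specializes_genericPoint (x : C) : genericPoint C ⤳ x :=
  (genericPoint_spec C).specializes trivial

theorem stalkSpecializes_smul (x : C) (r : C.presheaf.stalk x) (m : F.presheaf.stalk x) :
    F.presheaf.stalkSpecializes (specializes_genericPoint x) (r • m) =
      C.presheaf.stalkSpecializes (specializes_genericPoint x) r •
        F.presheaf.stalkSpecializes (specializes_genericPoint x) m := by
  obtain ⟨U, hxU, s, rfl⟩ := C.presheaf.exists_germ_eq r
  obtain ⟨V, hxV, t, rfl⟩ := F.presheaf.exists_germ_eq m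
  let W := U ⊓ V
  have hW : x ∈ W := ⟨hxU, hxV⟩
  rw [← C.presheaf.germ_res_apply (homOfLE (inf_le_left : W ≤ U)) x hW s,
    ← F.presheaf.germ_res_apply (homOfLE (inf_le_right : W ≤ V)) x hW t, ← germ_smul]
  simp only [TopCat.Presheaf.germ_stalkSpecializes_apply]
  rw [germ_smul]

/-- The canonical map `F_x → F_η`. -/
noncomputable def toGenericStalk (x : C) :
    F.presheaf.stalk x →ₗ[C.presheaf.stalk x] GenericStalk F where
  toFun := F.presheaf.stalkSpecializes (specializes_genericPoint x)
  map_add' := map_add (F.presheaf.stalkSpecializes (specializes_genericPoint x)).hom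
  map_smul' := stalkSpecializes_smul F x

theorem toGenericStalk_germ (x : C) (U : C.Opens) (hx : x ∈ U) (hU : genericPoint C ∈ U)
    (m : Γ(F, U)) : toGenericStalk F x (F.presheaf.germ U x hx m) = genericGerm F U hU m :=
  F.presheaf.germ_stalkSpecializes_apply _ _ _

theorem exists_genericGerm_eq (a : GenericStalk F) :
    ∃ (U : C.Opens) (hU : genericPoint C ∈ U) (m : Γ(F, U)), genericGerm F U hU m = a :=
  F.presheaf.exists_germ_eq a

end Stalks

section Localization

open Scheme.Modules

/-- On an affine open subscheme, sections over a basic open set of a quasi-coherent sheaf are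
fractions of sections over the whole subscheme. Here the affine open is the range of an open
immersion `j : Spec R ⟶ C`. -/
theorem exists_pow_smul_eq_germ {C : Scheme.{u}} (F : C.Modules) [F.IsQuasicoherent]
    {R : CommRingCat.{u}} (j : Spec R ⟶ C) [IsOpenImmersion j] (g : R)
    (t : Γ(F, j ''ᵁ PrimeSpectrum.basicOpen g)) :
    ∃ (n : ℕ) (m : Γ(F, j ''ᵁ ⊤)), ∀ y (hy : y ∈ j ''ᵁ PrimeSpectrum.basicOpen g)
      (hy' : y ∈ j ''ᵁ ⊤),
      C.presheaf.germ (j ''ᵁ ⊤) y hy' ((j.appIso ⊤).inv ((Scheme.ΓSpecIso R).inv (g ^ n))) •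
        F.presheaf.germ _ y hy t = F.presheaf.germ (j ''ᵁ ⊤) y hy' m := by
  have hL := (isIso_fromTildeΓ_iff_isLocalizing (F.restrict j)).mp inferInstance g
  obtain ⟨⟨m, ⟨_, n, rfl⟩⟩, h⟩ := hL.surj t
  refine ⟨n, m, fun y hy hy' => ?_⟩
  let s : Γ(C, j ''ᵁ ⊤) := (j.appIso ⊤).inv ((Scheme.ΓSpecIso R).inv (g ^ n))
  let i : PrimeSpectrum.basicOpen g ⟶ (⊤ : (Spec R).Opens) := homOfLE le_top
  let i' : j ''ᵁ PrimeSpectrum.basicOpen g ⟶ j ''ᵁ ⊤ := homOfLE (j.image_mono le_top)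
  have h1 : (j.appIso (PrimeSpectrum.basicOpen g)).inv ((Spec R).presheaf.map i.op
      ((Scheme.ΓSpecIso R).inv (g ^ n))) = C.presheaf.map i'.op s := by
    have := j.appIso_inv_naturality i.op
    exact congr($(this) ((Scheme.ΓSpecIso R).inv (g ^ n)))
  have h2 : C.presheaf.map i'.op s • t = F.presheaf.map i'.op m := by
    rw [← h1]
    exact h
  have h3 := (germ_smul F hy (C.presheaf.map i'.op s) t).symm.trans
    ((congrArg (F.presheaf.germ _ y hy) h2).trans
      (F.presheaf.germ_res_apply i' y hy (m : Γ(F, j ''ᵁ ⊤))))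
  have h4 := C.presheaf.germ_res_apply i' y hy s
  exact (congrArg (· • F.presheaf.germ _ y hy t) h4).symm.trans h3

theorem exists_pow_smul_germ_eq_zero {C : Scheme.{u}} (F : C.Modules) [F.IsQuasicoherent]
    {R : CommRingCat.{u}} (j : Spec R ⟶ C) [IsOpenImmersion j] (g : R)
    (m : Γ(F, j ''ᵁ ⊤))
    (h : F.presheaf.map (homOfLE (j.image_mono le_top : j ''ᵁ PrimeSpectrum.basicOpen g ≤ j ''ᵁ ⊤)).op m = 0) :
    ∃ n : ℕ, ((j.appIso ⊤).inv ((Scheme.ΓSpecIso R).inv (g ^ n)) : Γ(C, j ''ᵁ ⊤)) • m = 0 := by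
  have hL := (isIso_fromTildeΓ_iff_isLocalizing (F.restrict j)).mp inferInstance g
  let m' : ((modulesSpecToSheaf.obj (F.restrict j)).obj.obj (.op ⊤)) := m
  obtain ⟨⟨_, n, rfl⟩, h⟩ := hL.exists_of_eq (x₁ := m') (x₂ := 0) (by
    rw [map_zero]; exact h)
  refine ⟨n, ?_⟩
  rw [smul_zero] at h
  let s : Γ(C, j ''ᵁ ⊤) := (j.appIso ⊤).inv ((Scheme.ΓSpecIso R).inv (g ^ n))
  have h1 : ((j.appIso ⊤).inv ((Spec R).presheaf.map (𝟙 (Opposite.op ⊤))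
      ((Scheme.ΓSpecIso R).inv (g ^ n)))) • m = 0 := h
  rw [CategoryTheory.Functor.map_id] at h1
  exact h1

variable {C : Scheme.{u}} [IsIntegral C]

theorem exists_basicOpen_le {R : CommRingCat.{u}} (j : Spec R ⟶ C) [IsOpenImmersion j]
    (hη : genericPoint C ∈ j ''ᵁ ⊤) (V : C.Opens) (hV : genericPoint C ∈ V) :
    ∃ g : R, genericPoint C ∈ j ''ᵁ PrimeSpectrum.basicOpen g ∧
      j ''ᵁ PrimeSpectrum.basicOpen g ≤ V := by
  obtain ⟨y, -, hy⟩ := hη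
  have hyV : y ∈ j ⁻¹ᵁ V := by
    change j y ∈ V
    exact hy.symm ▸ hV
  obtain ⟨_, ⟨_, ⟨g, rfl⟩, rfl⟩, hyg, hgV⟩ :=
    PrimeSpectrum.isBasis_basic_opens.exists_subset_of_mem_open hyV (j ⁻¹ᵁ V).isOpen
  refine ⟨g, ⟨y, hyg, hy⟩, ?_⟩
  rintro _ ⟨z, hz, rfl⟩
  exact hgV hz

theorem germ_ne_zero {R : CommRingCat.{u}} (j : Spec R ⟶ C) [IsOpenImmersion j] (g : R)
    (hg : genericPoint C ∈ j ''ᵁ PrimeSpectrum.basicOpen g) (x : C) (hx : x ∈ j ''ᵁ ⊤) (n : ℕ) :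
    C.presheaf.germ (j ''ᵁ ⊤) x hx ((j.appIso ⊤).inv ((Scheme.ΓSpecIso R).inv (g ^ n))) ≠ 0 := by
  intro h0
  have h1 : (j.appIso ⊤).inv ((Scheme.ΓSpecIso R).inv (g ^ n)) = 0 :=
    germ_injective_of_isIntegral C x hx (h0.trans (map_zero (C.presheaf.germ _ x hx).hom).symm)
  have h2 : (Scheme.ΓSpecIso R).inv (g ^ n) = 0 :=
    (ConcreteCategory.bijective_of_isIso (j.appIso ⊤).inv).1 (h1.trans (map_zero (j.appIso ⊤).inv.hom).symm)
  have h3 : g ^ n = 0 :=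
    (ConcreteCategory.bijective_of_isIso (Scheme.ΓSpecIso R).inv).1
      (h2.trans (map_zero (Scheme.ΓSpecIso R).inv.hom).symm)
  obtain ⟨y, hy, -⟩ := hg
  have hy' : g ∉ y.asIdeal := hy
  exact hy' (y.2.mem_of_pow_mem n (h3 ▸ zero_mem _))

theorem exists_spec_le {C : Scheme.{u}} (x : C) (V : C.Opens) (hx : x ∈ V) :
    ∃ (R : CommRingCat.{u}) (j : Spec R ⟶ C) (_ : IsOpenImmersion j), x ∈ j ''ᵁ ⊤ ∧
      j ''ᵁ ⊤ ≤ V := by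
  obtain ⟨U, hU, hxU, hUV⟩ := exists_isAffineOpen_mem_and_subset hx
  refine ⟨_, hU.fromSpec, inferInstance, ?_⟩
  rw [Scheme.Hom.image_top_eq_opensRange, hU.opensRange_fromSpec]
  exact ⟨hxU, hUV⟩

/-- For a quasi-coherent sheaf `F` on an integral scheme, `F_η` is the localization of `F_x` at the
nonzero elements of `𝒪_x`. -/
instance isLocalizedModule_toGenericStalk (F : C.Modules) [F.IsQuasicoherent] (x : C) :
    IsLocalizedModule (nonZeroDivisors (C.presheaf.stalk x)) (toGenericStalk F x) := by
  refine ⟨fun s => ?_, fun a => ?_, fun {a b} hab => ?_⟩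
  · rw [Module.End.isUnit_iff]
    have hs : algebraMap (C.presheaf.stalk x) C.functionField s ≠ 0 :=
      IsFractionRing.to_map_ne_zero_of_mem_nonZeroDivisors s.2
    constructor
    · intro a b hab
      exact smul_right_injective (GenericStalk F) hs hab
    · intro a
      exact ⟨(algebraMap (C.presheaf.stalk x) C.functionField s)⁻¹ • a, smul_inv_smul₀ hs a⟩
  · obtain ⟨R, j, hj, hx, -⟩ := exists_spec_le x ⊤ trivial
    have hη := genericPoint_mem _ hx
    obtain ⟨V, hV, t, rfl⟩ := exists_genericGerm_eq F a
    obtain ⟨g, hg, hgV⟩ := exists_basicOpen_le j hη V hV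
    obtain ⟨n, m, h⟩ := exists_pow_smul_eq_germ F j g (F.presheaf.map (homOfLE hgV).op t)
    refine ⟨(F.presheaf.germ _ x hx m, ⟨_, mem_nonZeroDivisors_of_ne_zero
      (germ_ne_zero j g hg x hx n)⟩), ?_⟩
    rw [toGenericStalk_germ F x _ hx hη]
    refine Eq.trans ?_ (h _ hg hη)
    have h1 := F.presheaf.germ_res_apply (homOfLE hgV) _ hg t
    rw [h1]
    exact congrArg (· • F.presheaf.germ V _ hV t)
      (C.presheaf.germ_stalkSpecializes_apply hx (specializes_genericPoint x) _)
  · obtain ⟨V, hV, t, ht⟩ := F.presheaf.exists_germ_eq (a - b)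
    obtain ⟨R, j, hj, hx, hjV⟩ := exists_spec_le x V hV
    have hη := genericPoint_mem _ hx
    let t' := F.presheaf.map (homOfLE hjV).op t
    have ht' : F.presheaf.germ _ x hx t' = a - b := by
      rw [← ht]; exact F.presheaf.germ_res_apply (homOfLE hjV) _ hx t
    have h0 : F.presheaf.germ _ _ hη t' = F.presheaf.germ (j ''ᵁ ⊤) _ hη 0 := by
      have := toGenericStalk_germ F x _ hx hη t'
      rw [ht', map_sub, hab, sub_self] at this
      exact this.symm.trans (map_zero (F.presheaf.germ _ _ hη).hom).symm
    obtain ⟨W, hW, i₁, i₂, hi⟩ := F.presheaf.germ_eq _ hη hη _ _ h0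
    obtain ⟨g, hg, hgW⟩ := exists_basicOpen_le j hη W hW
    obtain ⟨n, hn⟩ := exists_pow_smul_germ_eq_zero F j g t' (by
      have h2 := congrArg (F.presheaf.map (homOfLE hgW).op) hi
      rw [← ConcreteCategory.comp_apply, ← CategoryTheory.Functor.map_comp] at h2
      refine h2.trans ?_
      rw [map_zero, map_zero])
    refine ⟨⟨_, mem_nonZeroDivisors_of_ne_zero (germ_ne_zero j g hg x hx n)⟩, ?_⟩
    rw [← sub_eq_zero, ← smul_sub, ← ht']
    refine (germ_smul F hx _ t').symm.trans ?_
    rw [hn, map_zero]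

end Localization

section Completions

open Scheme.Modules TensorProduct

/-- The completed local ring `Ô_x`. -/
noncomputable abbrev CompletedLocalRing (C : Scheme.{u}) (x : C) : Type u :=
  AdicCompletion (IsLocalRing.maximalIdeal (C.presheaf.stalk x)) (C.presheaf.stalk x)

/-- The quotient ring `K_x` of the completed local ring `Ô_x` (its total ring of fractions). -/
noncomputable abbrev LocalQuotientRing (C : Scheme.{u}) (x : C) : Type u :=
  FractionRing (CompletedLocalRing C x)

section Modules

variable {C : Scheme.{u}} (F : C.Modules) (x : C)

/-- The completed stalk `F̂_x = Ô_x ⊗ F_x`, the tensor product being over `𝒪_x`. -/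
def CompletedStalk : Type u :=
  CompletedLocalRing C x ⊗[C.presheaf.stalk x] F.presheaf.stalk x

noncomputable instance : AddCommGroup (CompletedStalk F x) :=
  inferInstanceAs (AddCommGroup (CompletedLocalRing C x ⊗[C.presheaf.stalk x] F.presheaf.stalk x))

noncomputable instance : Module (CompletedLocalRing C x) (CompletedStalk F x) :=
  inferInstanceAs (Module (CompletedLocalRing C x)
    (CompletedLocalRing C x ⊗[C.presheaf.stalk x] F.presheaf.stalk x))

noncomputable instance {S : Type u} [CommRing S] [Algebra S (C.presheaf.stalk x)] :
    Module S (CompletedStalk F x) :=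
  inferInstanceAs (Module S (CompletedLocalRing C x ⊗[C.presheaf.stalk x] F.presheaf.stalk x))

instance {S : Type u} [CommRing S] [Algebra S (C.presheaf.stalk x)] :
    IsScalarTower S (C.presheaf.stalk x) (CompletedStalk F x) :=
  inferInstanceAs (IsScalarTower S (C.presheaf.stalk x)
    (CompletedLocalRing C x ⊗[C.presheaf.stalk x] F.presheaf.stalk x))

instance {S : Type u} [CommRing S] [Algebra S (C.presheaf.stalk x)] :
    IsScalarTower S (CompletedLocalRing C x) (CompletedStalk F x) :=
  inferInstanceAs (IsScalarTower S (CompletedLocalRing C x)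
    (CompletedLocalRing C x ⊗[C.presheaf.stalk x] F.presheaf.stalk x))

/-- The module `F̂_x ⊗ K_x` over `K_x`, the tensor product being over `Ô_x`. -/
def LocalRationalStalk : Type u :=
  LocalQuotientRing C x ⊗[CompletedLocalRing C x] CompletedStalk F x

noncomputable instance : AddCommGroup (LocalRationalStalk F x) :=
  inferInstanceAs (AddCommGroup (LocalQuotientRing C x ⊗[CompletedLocalRing C x] CompletedStalk F x))

noncomputable instance : Module (LocalQuotientRing C x) (LocalRationalStalk F x) :=
  inferInstanceAs (Module (LocalQuotientRing C x)
    (LocalQuotientRing C x ⊗[CompletedLocalRing C x] CompletedStalk F x))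

noncomputable instance : Module (CompletedLocalRing C x) (LocalRationalStalk F x) :=
  inferInstanceAs (Module (CompletedLocalRing C x)
    (LocalQuotientRing C x ⊗[CompletedLocalRing C x] CompletedStalk F x))

noncomputable instance {S : Type u} [CommRing S] [Algebra S (C.presheaf.stalk x)] :
    Module S (LocalRationalStalk F x) :=
  inferInstanceAs (Module S (LocalQuotientRing C x ⊗[CompletedLocalRing C x] CompletedStalk F x))

instance : IsScalarTower (CompletedLocalRing C x) (LocalQuotientRing C x)
    (LocalRationalStalk F x) :=
  inferInstanceAs (IsScalarTower (CompletedLocalRing C x) (LocalQuotientRing C x)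
    (LocalQuotientRing C x ⊗[CompletedLocalRing C x] CompletedStalk F x))

instance {S : Type u} [CommRing S] [Algebra S (C.presheaf.stalk x)] :
    IsScalarTower S (LocalQuotientRing C x) (LocalRationalStalk F x) :=
  inferInstanceAs (IsScalarTower S (LocalQuotientRing C x)
    (LocalQuotientRing C x ⊗[CompletedLocalRing C x] CompletedStalk F x))

instance {S : Type u} [CommRing S] [Algebra S (C.presheaf.stalk x)] :
    IsScalarTower S (CompletedLocalRing C x) (LocalRationalStalk F x) :=
  inferInstanceAs (IsScalarTower S (CompletedLocalRing C x)
    (LocalQuotientRing C x ⊗[CompletedLocalRing C x] CompletedStalk F x))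

instance {S : Type u} [CommRing S] [Algebra S (C.presheaf.stalk x)] :
    IsScalarTower S (C.presheaf.stalk x) (LocalRationalStalk F x) :=
  inferInstanceAs (IsScalarTower S (C.presheaf.stalk x)
    (LocalQuotientRing C x ⊗[CompletedLocalRing C x] CompletedStalk F x))

/-- The canonical map `F_x → F̂_x`. -/
noncomputable def toCompletedStalk :
    F.presheaf.stalk x →ₗ[C.presheaf.stalk x] CompletedStalk F x :=
  TensorProduct.mk (C.presheaf.stalk x) (CompletedLocalRing C x) (F.presheaf.stalk x) 1

/-- The canonical map `F̂_x → F̂_x ⊗ K_x`. -/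
noncomputable def completedToRational :
    CompletedStalk F x →ₗ[CompletedLocalRing C x] LocalRationalStalk F x :=
  TensorProduct.mk (CompletedLocalRing C x) (LocalQuotientRing C x) (CompletedStalk F x) 1

end Modules

/-- The structure map `k → Γ(C, U)` of a scheme over `k`. -/
noncomputable def scalarsToSections (k : Type u) [Field k] (C : Scheme.{u}) [C.Over (Spec (.of k))]
    (U : C.Opens) : k →+* Γ(C, U) :=
  ((Scheme.ΓSpecIso (.of k)).inv ≫ (C ↘ Spec (.of k)).appTop ≫
    C.presheaf.map (homOfLE le_top : U ⟶ ⊤).op).hom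

variable {C : Scheme.{u}} (F : C.Modules) (x : C) (k : Type u) [Field k] [C.Over (Spec (.of k))]

noncomputable instance : Algebra k (C.presheaf.stalk x) :=
  ((C.presheaf.germ ⊤ x trivial).hom.comp (scalarsToSections k C ⊤)).toAlgebra

theorem algebraMap_stalk (c : k) : algebraMap k (C.presheaf.stalk x) c =
    C.presheaf.germ ⊤ x trivial (scalarsToSections k C ⊤ c) := rfl

theorem scalarsToSections_apply (U : C.Opens) (c : k) : scalarsToSections k C U c =
    C.presheaf.map (homOfLE le_top : U ⟶ ⊤).op (scalarsToSections k C ⊤ c) := by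
  simp [scalarsToSections]

theorem germ_scalarsToSections (U : C.Opens) (hx : x ∈ U) (c : k) :
    C.presheaf.germ U x hx (scalarsToSections k C U c) = algebraMap k (C.presheaf.stalk x) c := by
  rw [scalarsToSections_apply, algebraMap_stalk]
  exact C.presheaf.germ_res_apply _ _ _ _

noncomputable instance : Module k (F.presheaf.stalk x) :=
  Module.compHom _ (algebraMap k (C.presheaf.stalk x))

instance : IsScalarTower k (C.presheaf.stalk x) (F.presheaf.stalk x) :=
  .of_algebraMap_smul fun _ _ => rfl

noncomputable instance (U : C.Opens) : Module k Γ(F, U) :=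
  Module.compHom _ (scalarsToSections k C U)

/-- The germ of a section of `F` at `x`, as a `k`-linear map. -/
noncomputable def germLinear (U : C.Opens) (hx : x ∈ U) : Γ(F, U) →ₗ[k] F.presheaf.stalk x where
  toFun := F.presheaf.germ U x hx
  map_add' := map_add (F.presheaf.germ U x hx).hom
  map_smul' c m := (germ_smul F hx (scalarsToSections k C U c) m).trans
    (congrArg (· • F.presheaf.germ U x hx m) (germ_scalarsToSections x k U hx c))

noncomputable instance [IrreducibleSpace C] : Module k (GenericStalk F) :=
  Module.compHom _ (algebraMap k (C.presheaf.stalk (genericPoint C)))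

instance [IrreducibleSpace C] : IsScalarTower k (C.presheaf.stalk x) (GenericStalk F) :=
  .of_algebraMap_smul fun c m => by
    refine congrArg (fun r : C.functionField => r • m) (a₁ := algebraMap (C.presheaf.stalk x)
      C.functionField (algebraMap k (C.presheaf.stalk x) c)) ?_
    exact C.presheaf.germ_stalkSpecializes_apply _ (specializes_genericPoint x) _

/-- The inclusion of sections over a nonempty open set into rational sections. -/
noncomputable def toRationalSections [IrreducibleSpace C] (U : C.Opens) (hU : genericPoint C ∈ U) :
    Γ(F, U) →ₗ[k] GenericStalk F where
  toFun := genericGerm F U hU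
  map_add' := map_add (genericGerm F U hU)
  map_smul' := (germLinear F (genericPoint C) k U hU).map_smul

variable [IsLocallyNoetherian C]

theorem isUnit_algebraMap_localQuotientRing (s : nonZeroDivisors (C.presheaf.stalk x)) :
    IsUnit (algebraMap (C.presheaf.stalk x) (LocalQuotientRing C x) s) := by
  rw [IsScalarTower.algebraMap_apply (C.presheaf.stalk x) (CompletedLocalRing C x)]
  refine IsLocalization.map_units (M := nonZeroDivisors (CompletedLocalRing C x)) _ ⟨_, ?_⟩
  have h : IsSMulRegular (CompletedLocalRing C x) (s : C.presheaf.stalk x) :=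
    Module.Flat.isSMulRegular_of_nonZeroDivisors s.2
  rw [mem_nonZeroDivisors_iff_right]
  intro a ha
  refine h ?_
  change (s : C.presheaf.stalk x) • a = (s : C.presheaf.stalk x) • 0
  rw [smul_zero, Algebra.smul_def, mul_comm, ha]

theorem isUnit_localRationalStalk (s : nonZeroDivisors (C.presheaf.stalk x)) :
    IsUnit (algebraMap (C.presheaf.stalk x)
      (Module.End (C.presheaf.stalk x) (LocalRationalStalk F x)) s) := by
  have h := (isUnit_algebraMap_localQuotientRing x s).map
    (algebraMap (LocalQuotientRing C x) (Module.End (LocalQuotientRing C x) (LocalRationalStalk F x)))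
  rw [Module.End.isUnit_iff] at h ⊢
  refine (iff_of_eq (congrArg Function.Bijective (funext fun m => ?_))).mp h
  exact algebraMap_smul (LocalQuotientRing C x) (s : C.presheaf.stalk x) m

variable [IsIntegral C]

/-- The canonical map `F_η → F̂_x ⊗ K_x`: the unique `𝒪_x`-linear map through which the
canonical map `F_x → F̂_x → F̂_x ⊗ K_x` factors. -/
noncomputable def genericToLocalRational [F.IsQuasicoherent] :
    GenericStalk F →ₗ[C.presheaf.stalk x] LocalRationalStalk F x :=
  IsLocalizedModule.lift (nonZeroDivisors (C.presheaf.stalk x)) (toGenericStalk F x)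
    ((completedToRational F x).restrictScalars (C.presheaf.stalk x) ∘ₗ toCompletedStalk F x)
    (isUnit_localRationalStalk F x)

theorem genericToLocalRational_genericGerm [F.IsQuasicoherent] (U : C.Opens) (hx : x ∈ U)
    (m : Γ(F, U)) : genericToLocalRational F x (genericGerm F U (genericPoint_mem U hx) m) =
      completedToRational F x (toCompletedStalk F x (F.presheaf.germ U x hx m)) := by
  rw [← toGenericStalk_germ F x U hx]
  exact IsLocalizedModule.lift_apply _ _ _ _ _

end Completions

section Complexes

open Scheme.Modules HomologicalComplex Filter

theorem rel_zero_one : (ComplexShape.up ℕ).Rel 0 1 := rfl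

/-- A complex `X₀ ⟶ X₁` of `k`-vector spaces, in degrees `0` and `1`. -/
noncomputable abbrev twoTermComplex {k : Type u} [Field k] {X₀ X₁ : ModuleCat.{u} k} (d : X₀ ⟶ X₁) :
    CochainComplex (ModuleCat.{u} k) ℕ :=
  double d rel_zero_one

/-- The morphism of complexes in degrees `0` and `1` given by a commutative square. -/
noncomputable def twoTermMap {k : Type u} [Field k] {X₀ X₁ Y₀ Y₁ : ModuleCat.{u} k} {d : X₀ ⟶ X₁}
    {e : Y₀ ⟶ Y₁} (f₀ : X₀ ⟶ Y₀) (f₁ : X₁ ⟶ Y₁) (comm : f₀ ≫ e = d ≫ f₁) :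
    twoTermComplex d ⟶ twoTermComplex e :=
  mkHomFromDouble rel_zero_one zero_ne_one
    (f₀ ≫ (doubleXIso₀ e _).inv) (f₁ ≫ (doubleXIso₁ e _ zero_ne_one).inv)
    (by
      change _ ≫ (double e _).d 0 1 = _
      rw [double_d e _ zero_ne_one, Category.assoc, Iso.inv_hom_id_assoc, reassoc_of% comm])
    (fun i _ => by
      change _ ≫ (double e _).d 1 i = _
      rw [double_d_eq_zero₀ _ _ _ _ one_ne_zero, Limits.comp_zero])

variable (k : Type u) [Field k] {C : Scheme.{u}} [C.Over (Spec (.of k))]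

/-- The image of `F̂_x` in `F̂_x ⊗ K_x`. -/
noncomputable def integralSubmodule (F : C.Modules) (x : C) :
    Submodule k (LocalRationalStalk F x) :=
  LinearMap.range ((completedToRational F x).restrictScalars k)

/-- The product `∏ F̂_x` over all closed points `x` of `C`. -/
abbrev IntegralAdeles (F : C.Modules) : Type u := (x : closedPoints C) → CompletedStalk F x.1

/-- The adelic product `∏' (F̂_x ⊗ K_x)` over all closed points `x` of `C`: the families whose
component at `x` lies in the image of `F̂_x` for all but finitely many `x`. -/
def adeles (F : C.Modules) : Submodule k ((x : closedPoints C) → LocalRationalStalk F x.1) where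
  carrier := {a | ∀ᶠ x in cofinite, a x ∈ integralSubmodule k F x.1}
  zero_mem' := by
    rw [Set.mem_ofPred_eq]
    exact .of_forall fun _ => zero_mem _
  add_mem' ha hb := by
    rw [Set.mem_ofPred_eq] at ha hb ⊢
    exact (ha.and hb).mono fun _ h => add_mem h.1 h.2
  smul_mem' c _ ha := by
    rw [Set.mem_ofPred_eq] at ha ⊢
    exact ha.mono fun _ h => Submodule.smul_mem _ c h

theorem mem_adeles {F : C.Modules} {a : (x : closedPoints C) → LocalRationalStalk F x.1} :
    a ∈ adeles k F ↔ ∀ᶠ x in cofinite, a x ∈ integralSubmodule k F x.1 :=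
  Iff.rfl

/-- The map `∏ F̂_x → ∏' (F̂_x ⊗ K_x)`. -/
noncomputable def integralToAdeles (F : C.Modules) : IntegralAdeles F →ₗ[k] adeles k F :=
  LinearMap.codRestrict _
    (LinearMap.pi fun x => (completedToRational F x.1).restrictScalars k ∘ₗ LinearMap.proj x)
    fun f => (mem_adeles k).mpr (.of_forall fun x => ⟨f x, rfl⟩)

open scoped Classical in
/-- The inclusion of the factor at the closed point `P` into the adelic product. -/
noncomputable def singleAdele (F : C.Modules) (P : closedPoints C) :
    LocalRationalStalk F P.1 →ₗ[k] adeles k F :=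
  LinearMap.codRestrict _
    (LinearMap.single k (fun x : closedPoints C => LocalRationalStalk F x.1) P)
    fun a => by
      have h : ∀ x ≠ P, LinearMap.single k (fun x : closedPoints C => LocalRationalStalk F x.1)
          P a x ∈ integralSubmodule k F x.1 := fun x hx => by
        rw [LinearMap.single_apply, Pi.single_eq_of_ne hx]
        exact zero_mem _
      refine (mem_adeles k).mpr ?_
      exact (Set.finite_singleton P).subset fun x hx => by_contra fun hxP => hx (h x hxP)

/-- The open complement of a closed point. -/
def complement (P : closedPoints C) : C.Opens :=
  ⟨{P.1}ᶜ, (show IsClosed {P.1} from P.2).isOpen_compl⟩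

theorem mem_complement {P x : closedPoints C} (h : x ≠ P) : x.1 ∈ complement P :=
  fun h' => h (Subtype.ext h')

variable [IsIntegral C] [IsProjectiveCurve k C]

theorem genericPoint_mem_complement (k : Type u) [Field k] {C : Scheme.{u}} [C.Over (Spec (.of k))]
    [IsIntegral C] [IsProjectiveCurve k C] (P : closedPoints C) :
    genericPoint C ∈ complement P :=
  ne_genericPoint (IsProjectiveCurve.krullDim_eq_one k) P.2

variable (F : C.Modules) [F.IsQuasicoherent]

/-- The canonical map `F_η → F̂_x ⊗ K_x`, as a `k`-linear map. -/
noncomputable def rationalToLocal (x : C) : GenericStalk F →ₗ[k] LocalRationalStalk F x :=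
  have := IsProjectiveCurve.isNoetherian k C
  (genericToLocalRational F x).restrictScalars k

theorem rationalToLocal_genericGerm (x : C) (U : C.Opens) (hU : genericPoint C ∈ U) (hx : x ∈ U)
    (m : Γ(F, U)) : rationalToLocal k F x (toRationalSections F k U hU m) =
      completedToRational F x (toCompletedStalk F x (germLinear F x k U hx m)) :=
  have := IsProjectiveCurve.isNoetherian k C
  genericToLocalRational_genericGerm F x U hx m

theorem pi_rationalToLocal_mem_adeles (a : GenericStalk F) :
    LinearMap.pi (fun x : closedPoints C => rationalToLocal k F x.1) a ∈ adeles k F := by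
  have := IsProjectiveCurve.isNoetherian k C
  obtain ⟨U, hU, m, rfl⟩ := exists_genericGerm_eq F a
  refine (mem_adeles k).mpr ?_
  refine (finite_closedPoints_notMem (IsProjectiveCurve.krullDim_eq_one k) U hU).subset
    fun x hx hxU => hx ?_
  exact ⟨_, (rationalToLocal_genericGerm k F x.1 U hU hxU m).symm⟩

/-- The diagonal map `F_η → ∏' (F̂_x ⊗ K_x)`. -/
noncomputable def diagonal : GenericStalk F →ₗ[k] adeles k F :=
  LinearMap.codRestrict _ (LinearMap.pi fun x => rationalToLocal k F x.1)
    (pi_rationalToLocal_mem_adeles k F)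

/-- The differential `F_η ⊕ ∏ F̂_x → ∏' (F̂_x ⊗ K_x)`, `(a, f) ↦ a - f`. -/
noncomputable def adelicDifferential : GenericStalk F × IntegralAdeles F →ₗ[k] adeles k F :=
  diagonal k F ∘ₗ LinearMap.fst k (GenericStalk F) (IntegralAdeles F) -
    integralToAdeles k F ∘ₗ LinearMap.snd k (GenericStalk F) (IntegralAdeles F)

/-- The adelic complex `F_η ⊕ ∏ F̂_x → ∏' (F̂_x ⊗ K_x)` of `F`. -/
noncomputable def adelicComplex : CochainComplex (ModuleCat.{u} k) ℕ :=
  twoTermComplex (ModuleCat.ofHom (adelicDifferential k F))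

variable (P : closedPoints C)

/-- The differential `Γ(C - P, F) ⊕ F̂_P → F̂_P ⊗ K_P`, `(w, f) ↦ w - f`, where `Γ(C - P, F)` is
mapped to `F̂_P ⊗ K_P` through the space `F_η` of rational sections. -/
noncomputable def localDifferential :
    Γ(F, complement P) × CompletedStalk F P.1 →ₗ[k] LocalRationalStalk F P.1 :=
  (rationalToLocal k F P.1 ∘ₗ toRationalSections F k _ (genericPoint_mem_complement k P)) ∘ₗ
      LinearMap.fst k _ _ -
    (completedToRational F P.1).restrictScalars k ∘ₗ LinearMap.snd k _ _

/-- The complex `Γ(C - P, F) ⊕ F̂_P → F̂_P ⊗ K_P`. -/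
noncomputable def localComplex : CochainComplex (ModuleCat.{u} k) ℕ :=
  twoTermComplex (ModuleCat.ofHom (localDifferential k F P))

open scoped Classical in
/-- The map `Γ(C - P, F) → ∏ F̂_x` which sends a section to the family of its germs at the points
`x ≠ P`, extended by zero at `P`. -/
noncomputable def germsAwayFrom (F : C.Modules) (P : closedPoints C) :
    Γ(F, complement P) →ₗ[k] IntegralAdeles F :=
  LinearMap.pi fun x =>
    if h : x = P then 0
    else (toCompletedStalk F x.1).restrictScalars k ∘ₗ germLinear F x.1 k _ (mem_complement h)

open scoped Classical in
/-- The map `Γ(C - P, F) ⊕ F̂_P → F_η ⊕ ∏ F̂_x` sending `(w, f)` to `w` and the family whose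
component at `P` is `f` and whose component at `x ≠ P` is the germ of `w`. -/
noncomputable def comparisonZero :
    Γ(F, complement P) × CompletedStalk F P.1 →ₗ[k] GenericStalk F × IntegralAdeles F :=
  (toRationalSections F k _ (genericPoint_mem_complement k P) ∘ₗ LinearMap.fst k _ _).prod
    (germsAwayFrom k F P ∘ₗ LinearMap.fst k _ _ +
      LinearMap.single k (fun x : closedPoints C => CompletedStalk F x.1) P ∘ₗ
        LinearMap.snd k _ _)

theorem comparison_comm (y : Γ(F, complement P) × CompletedStalk F P.1) :
    adelicDifferential k F (comparisonZero k F P y) =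
      singleAdele k F P (localDifferential k F P y) := by
  classical
  obtain ⟨w, f⟩ := y
  refine Subtype.ext (funext fun x => ?_)
  change rationalToLocal k F x.1
      (toRationalSections F k _ (genericPoint_mem_complement k P) w) -
    completedToRational F x.1 (germsAwayFrom k F P w x +
      LinearMap.single k (fun x : closedPoints C => CompletedStalk F x.1) P f x) =
    LinearMap.single k (fun x : closedPoints C => LocalRationalStalk F x.1) P
      (localDifferential k F P (w, f)) x
  rw [LinearMap.single_apply, LinearMap.single_apply]
  by_cases h : x = P
  · subst h
    have : germsAwayFrom k F x w x = 0 := by simp [germsAwayFrom]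
    rw [this, zero_add, Pi.single_eq_same, Pi.single_eq_same]
    rfl
  · have : germsAwayFrom k F P w x =
        toCompletedStalk F x.1 (germLinear F x.1 k _ (mem_complement h) w) := by
      simp [germsAwayFrom, h]
    rw [this, Pi.single_eq_of_ne h, Pi.single_eq_of_ne h, add_zero,
      rationalToLocal_genericGerm k F x.1 _ _ (mem_complement h), sub_self]

/-- The natural morphism from the complex `Γ(C - P, F) ⊕ F̂_P → F̂_P ⊗ K_P` to the adelic complex:
`(w, f) ↦ (w, (f at P, the germ of w at x ≠ P))` in degree `0`, and the inclusion of the factor at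
`P` in degree `1`. -/
noncomputable def comparison : localComplex k F P ⟶ adelicComplex k F :=
  twoTermMap (ModuleCat.ofHom (comparisonZero k F P)) (ModuleCat.ofHom (singleAdele k F P))
    (ModuleCat.hom_ext (LinearMap.ext (comparison_comm k F P)))

end Complexes
end AdelicCurve

/-! Let `M x` be the image of `F_x` in `F_η`. Three local facts hold at a closed point `x`: `F̂_x`
embeds in `F̂_x ⊗ K_x`; a rational section that becomes integral in `F̂_x` already comes from `F_x`;
and `F̂_x ⊗ K_x` is the sum of the images of `F_η` and `F̂_x`. They rest on the flatness of
completion and on `exists_dvd_algebraMap`: in dimension one a nonzerodivisor of `Ô_x` divides a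
nonzero element of `𝒪_x`, so all denominators may be taken in `𝒪_x`.

By the first two facts and gluing, a rational section that is integral at every closed point other
than `P` is a section over `C - P` (`exists_section_of_integral`). This yields surjectivity on `H⁰`
and injectivity on `H¹`; injectivity on `H⁰` holds because sections of a torsion free sheaf embed in
`F_η`.

For surjectivity on `H¹`, the third fact replaces an adele by a family `v x` of rational sections,
almost all zero. What is needed is a single rational section `a` with `v x - a ∈ M x` for all `x ≠
P`: strong approximation (`IsTwoChartCover.strong_approximation`). Its proof has three ingredients.
The curve has two affine charts, linked by a function `t` with `A₁` finite over `k[t]`, and the Čech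
computation on them shows that adeles modulo rational sections and integral adeles are finite
dimensional. Applied to the structure sheaf, this finiteness forces the functions regular away from
`P` to form an infinite dimensional space. Hence some nonzero `g` among them kills a finite set of
generators of the quotient taken away from `P`. Since multiplication by `g` is also bijective on
adeles, that quotient is zero.

The approximation argument is carried out for subrings `O x` of a field `K` and lattices `M x` in a
`K`-vector space `V`; the geometry only supplies the hypotheses. -/

namespace AdelicCurve

/-! ### Approximation and Nullstellensatz on an affine curve, in terms of its local rings. -/

section AffineCharts

variable {k K V ι : Type*} [Field k] [Field K] [Algebra k K] [AddCommGroup V] [Module K V]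

/-- `a` is an invertible element of the subring `R` of the field `K`, or the inverse of one of its
nonzero elements. -/
def InvMem (R : Subalgebra k K) (a : K) : Prop := a ≠ 0 ∧ a⁻¹ ∈ R

theorem InvMem.one (R : Subalgebra k K) : InvMem R 1 := ⟨one_ne_zero, by simp⟩

theorem InvMem.mul {R : Subalgebra k K} {a b : K} (ha : InvMem R a) (hb : InvMem R b) :
    InvMem R (a * b) :=
  ⟨mul_ne_zero ha.1 hb.1, by rw [mul_inv]; exact mul_mem ha.2 hb.2⟩

theorem InvMem.pow {R : Subalgebra k K} {a : K} (ha : InvMem R a) (n : ℕ) : InvMem R (a ^ n) :=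
  ⟨pow_ne_zero n ha.1, by rw [← inv_pow]; exact pow_mem ha.2 n⟩

theorem smul_mem_of_mem {R : Subalgebra k K} (N : Submodule R V) {r : K} (hr : r ∈ R) {v : V}
    (hv : v ∈ N) : r • v ∈ N :=
  N.smul_mem ⟨r, hr⟩ hv

theorem InvMem.smul_mem_iff {R : Subalgebra k K} (N : Submodule R V) {s : K} (hs : InvMem R s)
    {v : V} (hv : s • v ∈ N) : v ∈ N := by
  have := smul_mem_of_mem N hs.2 hv
  rwa [inv_smul_smul₀ hs.1] at this

/-- `A` is the coordinate ring, and `U` the set of points, of an affine open part of a curve with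
function field `K` and local rings `O x`. -/
structure IsAffineChart (O : ι → Subalgebra k K) (A : Subalgebra k K) (U : Set ι) : Prop where
  le : ∀ x ∈ U, A ≤ O x
  finiteType : Algebra.FiniteType k A
  exists_of_isPrime : ∀ 𝔭 : Ideal A, 𝔭.IsPrime → 𝔭 ≠ ⊥ →
    ∃ x ∈ U, ∀ a : A, a ∉ 𝔭 ↔ InvMem (O x) a
  exists_separating : ∀ x ∈ U, ∀ y ∈ U, x ≠ y → ∃ a ∈ A, ¬ InvMem (O x) a ∧ InvMem (O y) a
  exists_denominator : ∀ x ∈ U, ∀ r ∈ O x, ∃ s ∈ A, InvMem (O x) s ∧ s * r ∈ A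
  exists_denominator_generic : ∀ r : K, ∃ s ∈ A, s ≠ 0 ∧ s * r ∈ A

/-- The lattices `M x` for `x ∈ U` are the localizations of the `A`-module of those vectors which
lie in all of them. -/
structure IsLocalizedOn (O : ι → Subalgebra k K) (M : ∀ x, Submodule (O x) V)
    (A : Subalgebra k K) (U : Set ι) : Prop where
  exists_smul : ∀ x ∈ U, ∀ v ∈ M x, ∃ s ∈ A, InvMem (O x) s ∧ ∀ y ∈ U, s • v ∈ M y
  exists_smul_generic : ∀ v : V, ∃ s ∈ A, s ≠ 0 ∧ ∀ y ∈ U, s • v ∈ M y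

variable {O : ι → Subalgebra k K} {M : ∀ x, Submodule (O x) V} {A : Subalgebra k K} {U : Set ι}

namespace IsAffineChart

variable (h : IsAffineChart O A U)
include h

theorem isNoetherianRing : IsNoetherianRing A :=
  have := h.finiteType
  Algebra.FiniteType.isNoetherianRing k A

theorem isLocalizedOn_one : IsLocalizedOn O (fun x => (1 : Submodule (O x) K)) A U where
  exists_smul x hx v hv := by
    obtain ⟨r, rfl⟩ := Submodule.mem_one.mp hv
    obtain ⟨s, hs, hsx, hr⟩ := h.exists_denominator x hx r r.2
    exact ⟨s, hs, hsx, fun y hy => Submodule.mem_one.mpr ⟨⟨_, h.le y hy hr⟩, rfl⟩⟩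
  exists_smul_generic v := by
    obtain ⟨s, hs, hs0, hr⟩ := h.exists_denominator_generic v
    exact ⟨s, hs, hs0, fun y hy => Submodule.mem_one.mpr ⟨⟨_, h.le y hy hr⟩, rfl⟩⟩

/-- In the one-dimensional local ring at `x`, the element `a` of the maximal ideal has a power
divisible by `s`; `u` clears the denominator. Otherwise a prime would contain `s` and avoid every `u
* a ^ n`. It belongs to a point, which must be `x` since a separating function would lie in the
prime and be a unit at `x`; but then it contains `a`. -/
theorem exists_mul_pow_mem {x : ι} (hx : x ∈ U) {s : A} (hs : s ≠ 0) {a : A}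
    (ha : ¬ InvMem (O x) a) : ∃ (u : A) (n : ℕ), InvMem (O x) u ∧ s ∣ u * a ^ n := by
  let T : Submonoid A :=
    { carrier := {b | ∃ (u : A) (n : ℕ), InvMem (O x) u ∧ b = u * a ^ n}
      one_mem' := ⟨1, 0, InvMem.one _, by simp⟩
      mul_mem' := by
        rintro _ _ ⟨u, n, hu, rfl⟩ ⟨u', n', hu', rfl⟩
        exact ⟨u * u', n + n', hu.mul hu', by ring⟩ }
  by_contra hcon
  push Not at hcon
  have hdis : Disjoint (Ideal.span {s} : Set A) T := by
    rw [Set.disjoint_left]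
    rintro b hb ⟨u, n, hu, rfl⟩
    exact hcon u n hu (Ideal.mem_span_singleton.mp hb)
  obtain ⟨𝔭, hp, hle, hd⟩ := Ideal.exists_le_prime_disjoint _ T hdis
  have hne : 𝔭 ≠ ⊥ := by
    rintro rfl
    exact hs (by simpa using hle (Ideal.mem_span_singleton_self s))
  obtain ⟨y, hy, hyp⟩ := h.exists_of_isPrime 𝔭 hp hne
  have hxy : x = y := by
    by_contra hxy
    obtain ⟨b, hb, hby, hbx⟩ := h.exists_separating y hy x hx (Ne.symm hxy)
    have h1 : (⟨b, hb⟩ : A) ∈ 𝔭 := by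
      by_contra h1
      exact hby ((hyp _).mp h1)
    exact Set.disjoint_left.mp hd h1 ⟨⟨b, hb⟩, 0, hbx, by simp⟩
  subst hxy
  have h1 : a ∈ 𝔭 := by
    by_contra h1
    exact ha ((hyp _).mp h1)
  exact Set.disjoint_left.mp hd h1 ⟨1, 1, InvMem.one _, by simp⟩

/-- If `s` clears the poles of `v` on the chart, let `J` be the contraction to `A` of the ideal
generated by `s` in the local ring at `x`. As `J` is finitely generated, one `u`, a unit at `x`,
satisfies `u J ⊆ s A`. The ideal `J` has no zero other than `x`, and `u` does not vanish at `x`, so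
`1 = j + u r` with `j ∈ J`. Then `w = u r v` works: `j v` is integral at `x`, and at `y ≠ x` an
element of `J` that is a unit at `y` shows `u r v` integral. -/
theorem exists_approx_single (hM : IsLocalizedOn O M A U) {x : ι} (hx : x ∈ U) (v : V) :
    ∃ w : V, v - w ∈ M x ∧ ∀ y ∈ U, y ≠ x → w ∈ M y := by
  have := h.isNoetherianRing
  obtain ⟨s₀, hsA, hs0, hsv⟩ := hM.exists_smul_generic v
  let s : A := ⟨s₀, hsA⟩
  have hs : s ≠ 0 := fun h0 => hs0 congr($h0)
  let J : Ideal A :=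
    { carrier := {a | ∃ u : A, InvMem (O x) u ∧ s ∣ u * a}
      zero_mem' := ⟨1, InvMem.one _, by simp⟩
      add_mem' := by
        rintro a b ⟨u, hu, ha⟩ ⟨w, hw, hb⟩
        refine ⟨u * w, hu.mul hw, ?_⟩
        have : u * w * (a + b) = w * (u * a) + u * (w * b) := by ring
        rw [this]
        exact dvd_add (ha.mul_left _) (hb.mul_left _)
      smul_mem' := by
        rintro c a ⟨u, hu, ha⟩
        refine ⟨u, hu, ?_⟩
        have : u * (c • a) = c * (u * a) := by rw [smul_eq_mul]; ring
        rw [this]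
        exact ha.mul_left _ }
  obtain ⟨G, hG⟩ := IsNoetherian.noetherian J
  have huG : ∃ u : A, InvMem (O x) u ∧ ∀ a ∈ G, s ∣ u * a := by
    have hGJ : ∀ a ∈ G, ∃ u : A, InvMem (O x) u ∧ s ∣ u * a := fun a ha => by
      have : a ∈ J := hG ▸ Submodule.subset_span ha
      exact this
    clear hG
    classical
    induction G using Finset.induction_on with
    | empty => exact ⟨1, InvMem.one _, by simp⟩
    | insert a G _ ih =>
      obtain ⟨u, hu, h1⟩ := ih fun b hb => hGJ b (Finset.mem_insert_of_mem hb)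
      obtain ⟨w, hw, h2⟩ := hGJ a (Finset.mem_insert_self _ _)
      refine ⟨u * w, hu.mul hw, fun b hb => ?_⟩
      rcases Finset.mem_insert.mp hb with rfl | hb
      · rw [mul_assoc]; exact h2.mul_left _
      · rw [mul_comm u w, mul_assoc]; exact (h1 b hb).mul_left _
  obtain ⟨u, hu, huG⟩ := huG
  have huJ : ∀ a ∈ J, s ∣ u * a := by
    intro a ha
    rw [← hG] at ha
    induction ha using Submodule.span_induction with
    | mem a ha => exact huG a ha
    | zero => simp
    | add a b _ _ ha hb => rw [mul_add]; exact dvd_add ha hb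
    | smul c a _ ha => rw [smul_eq_mul, mul_left_comm]; exact ha.mul_left _
  have hJy : ∀ y ∈ U, y ≠ x → ∃ a ∈ J, InvMem (O y) a := by
    intro y hy hyx
    obtain ⟨a, ha, hax, hay⟩ := h.exists_separating x hx y hy (Ne.symm hyx)
    obtain ⟨w, n, hw, hd⟩ := h.exists_mul_pow_mem hx hs (a := ⟨a, ha⟩) hax
    exact ⟨⟨a, ha⟩ ^ n, ⟨w, hw, hd⟩, hay.pow n⟩
  have htop : J ⊔ Ideal.span {u} = ⊤ := by
    by_contra hne
    obtain ⟨𝔪, hm, hle⟩ := Ideal.exists_le_maximal _ hne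
    have hu𝔪 : u ∈ 𝔪 := hle (Ideal.mem_sup_right (Ideal.mem_span_singleton_self u))
    have hne : 𝔪 ≠ ⊥ := by
      rintro rfl
      exact hu.1 congr($(show u = 0 by simpa using hu𝔪))
    obtain ⟨y, hy, hyp⟩ := h.exists_of_isPrime 𝔪 hm.isPrime hne
    by_cases hyx : y = x
    · subst hyx
      exact (hyp u).mpr hu hu𝔪
    · obtain ⟨a, ha, hay⟩ := hJy y hy hyx
      exact (hyp a).mpr hay (hle (Ideal.mem_sup_left ha))
  obtain ⟨j, hj, c, hc, hjc⟩ := Submodule.mem_sup.mp ((Ideal.eq_top_iff_one _).mp htop)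
  obtain ⟨r, rfl⟩ := Ideal.mem_span_singleton.mp hc
  have hsM : ∀ y ∈ U, ∀ b : A, (b : K) • s₀ • v ∈ M y := fun y hy b =>
    smul_mem_of_mem _ (h.le y hy b.2) (hsv y hy)
  refine ⟨((u * r : A) : K) • v, ?_, fun y hy hyx => ?_⟩
  · obtain ⟨b, hb⟩ := huJ j hj
    have h1 : v - ((u * r : A) : K) • v = (j : K) • v := by
      have : (j : K) + ((u * r : A) : K) = 1 := congr(($hjc : K))
      rw [sub_eq_iff_eq_add, ← add_smul, this, one_smul]
    rw [h1]
    refine hu.smul_mem_iff _ ?_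
    have h2 : (u : K) * j = b * s₀ := by
      have : (u : K) * j = s₀ * b := congr(($hb : K))
      rw [this, mul_comm]
    rw [smul_smul, h2, ← smul_smul]
    exact hsM x hx b
  · obtain ⟨w, hw, hwy⟩ := hJy y hy hyx
    obtain ⟨b, hb⟩ := huJ w hw
    refine hwy.smul_mem_iff _ ?_
    have h2 : (w : K) * ((u * r : A) : K) = ((r * b : A) : K) * s₀ := by
      have : (u : K) * w = s₀ * b := congr(($hb : K))
      push_cast
      linear_combination (r : K) * this
    rw [smul_smul, h2, ← smul_smul]
    exact hsM y hy _

/-- The corrections at single points are added over the finite set where `b` is not integral; each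
one leaves the conditions at the other points intact. -/
theorem exists_approx (hM : IsLocalizedOn O M A U) (b : ι → V)
    (hb : ∀ᶠ x in Filter.cofinite, b x ∈ M x) : ∃ w : V, ∀ x ∈ U, b x - w ∈ M x := by
  classical
  have key : ∀ S : Finset ι, ∃ w : V, (∀ x ∈ U, x ∈ S → b x - w ∈ M x) ∧
      ∀ x ∈ U, x ∉ S → w ∈ M x := by
    intro S
    induction S using Finset.induction_on with
    | empty => exact ⟨0, by simp, by simp⟩
    | insert x S hxS ih =>
      obtain ⟨w, hw1, hw2⟩ := ih
      by_cases hx : x ∈ U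
      · obtain ⟨w', h1, h2⟩ := h.exists_approx_single hM hx (b x - w)
        refine ⟨w + w', fun y hy hyS => ?_, fun y hy hyS => ?_⟩
        · rw [← sub_sub]
          by_cases hyx : y = x
          · subst hyx; exact h1
          · exact sub_mem (hw1 y hy ((Finset.mem_insert.mp hyS).resolve_left hyx)) (h2 y hy hyx)
        · rw [Finset.mem_insert, not_or] at hyS
          exact add_mem (hw2 y hy hyS.2) (h2 y hy hyS.1)
      · refine ⟨w, fun y hy hyS => hw1 y hy ((Finset.mem_insert.mp hyS).resolve_left ?_),
          fun y hy hyS => hw2 y hy fun h' => hyS (Finset.mem_insert_of_mem h')⟩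
        rintro rfl
        exact hx hy
  obtain ⟨w, h1, h2⟩ := key (Filter.eventually_cofinite.mp hb).toFinset
  refine ⟨w, fun x hx => ?_⟩
  by_cases hxb : b x ∈ M x
  · exact sub_mem hxb (h2 x hx (by simpa using hxb))
  · exact h1 x hx (by simpa using hxb)

/-- A proper ideal of the chart which contains a nonzero element vanishes at a point. -/
theorem mem_of_forall_exists (I : Ideal A) (hI : ∃ a ∈ I, a ≠ 0) (t : A)
    (hx : ∀ x ∈ U, InvMem (O x) t → ∃ a ∈ I, InvMem (O x) a) : ∃ n : ℕ, t ^ n ∈ I := by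
  by_contra hcon
  push Not at hcon
  have hdis : Disjoint (I : Set A) (Submonoid.powers t) := by
    rw [Set.disjoint_left]
    rintro _ hb ⟨n, rfl⟩
    exact hcon n hb
  -- Such a prime would be the ideal of a point where `t` is a unit and all of `I` vanishes.
  obtain ⟨𝔭, hp, hle, hd⟩ := Ideal.exists_le_prime_disjoint _ _ hdis
  obtain ⟨a, ha, ha0⟩ := hI
  have hne : 𝔭 ≠ ⊥ := by
    rintro rfl
    exact ha0 (by simpa using hle ha)
  obtain ⟨y, hy, hyp⟩ := h.exists_of_isPrime 𝔭 hp hne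
  have ht : t ∉ 𝔭 := fun ht => Set.disjoint_left.mp hd ht ⟨1, pow_one t⟩
  obtain ⟨b, hb, hby⟩ := hx y hy ((hyp t).mp ht)
  exact (hyp b).mpr hby (hle hb)

/-- The multipliers that make `v` integral on all of `U` form an ideal without zeros on the locus
where `t` is invertible, so it contains a power of `t`. -/
theorem exists_pow_smul_mem (hM : IsLocalizedOn O M A U) (t : A) (v : V)
    (hv : ∀ x ∈ U, InvMem (O x) t → v ∈ M x) : ∃ n : ℕ, ∀ x ∈ U, (t : K) ^ n • v ∈ M x := by
  let I : Ideal A :=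
    { carrier := {a | ∀ x ∈ U, (a : K) • v ∈ M x}
      zero_mem' := fun x hx => by simp
      add_mem' := fun {a b} ha hb x hx => by
        push_cast
        rw [add_smul]
        exact add_mem (ha x hx) (hb x hx)
      smul_mem' := fun c a ha x hx => by
        rw [smul_eq_mul, Subalgebra.coe_mul, ← smul_smul]
        exact smul_mem_of_mem _ (h.le x hx c.2) (ha x hx) }
  obtain ⟨s, hs, hs0, hsv⟩ := hM.exists_smul_generic v
  obtain ⟨n, hn⟩ := h.mem_of_forall_exists I ⟨⟨s, hs⟩, hsv, fun h0 => hs0 congr($h0)⟩ t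
    fun x hx htx => by
      obtain ⟨r, hr, hrx, hrv⟩ := hM.exists_smul x hx v (hv x hx htx)
      exact ⟨⟨r, hr⟩, hrv, hrx⟩
  exact ⟨n, hn⟩

/-- Local generators generate globally: the ideal of `a` with `a • v` in the `A`-span of `E` is
nonzero and has no zero on `U`, since `v` has a unit denominator at each point. -/
theorem mem_span_of_forall_mem {E : Set V} (hE : Submodule.span K E = ⊤)
    (hEM : ∀ x ∈ U, M x ≤ Submodule.span (O x) E) {v : V} (hv : ∀ x ∈ U, v ∈ M x) :
    v ∈ Submodule.span A E := by
  let I : Ideal A := (Submodule.span A E).comap (LinearMap.toSpanSingleton A V v)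
  have hden : ∀ x ∈ U, ∀ w ∈ Submodule.span (O x) E,
      ∃ s : A, InvMem (O x) s ∧ (s : K) • w ∈ Submodule.span A E := by
    intro x hx w hw
    induction hw using Submodule.span_induction with
    | mem w hw => exact ⟨1, InvMem.one _, by simpa using Submodule.subset_span hw⟩
    | zero => exact ⟨1, InvMem.one _, by simp⟩
    | add w w' _ _ hw hw' =>
      obtain ⟨s, hs, h1⟩ := hw
      obtain ⟨s', hs', h2⟩ := hw'
      refine ⟨s * s', hs.mul hs', ?_⟩
      have : ((s * s' : A) : K) • (w + w') = s' • ((s : K) • w) + s • ((s' : K) • w') := by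
        rw [Subalgebra.smul_def, Subalgebra.smul_def, smul_smul, smul_smul, smul_add]
        push_cast
        rw [mul_comm (s' : K)]
      rw [this]
      exact add_mem (Submodule.smul_mem _ _ h1) (Submodule.smul_mem _ _ h2)
    | smul r w _ hw =>
      obtain ⟨s, hs, h1⟩ := hw
      obtain ⟨s', hs', hsx, hr⟩ := h.exists_denominator x hx r r.2
      refine ⟨⟨s', hs'⟩ * s, hsx.mul hs, ?_⟩
      have : (((⟨s', hs'⟩ : A) * s : A) : K) • r • w = (⟨s' * r, hr⟩ : A) • ((s : K) • w) := by
        rw [Subalgebra.smul_def, Subalgebra.smul_def, smul_smul, smul_smul]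
        push_cast
        congr 1
        ring
      rw [this]
      exact Submodule.smul_mem _ _ h1
  have hgen : ∀ w ∈ Submodule.span K E, ∃ s : A, s ≠ 0 ∧ (s : K) • w ∈ Submodule.span A E := by
    intro w hw
    induction hw using Submodule.span_induction with
    | mem w hw => exact ⟨1, one_ne_zero, by simpa using Submodule.subset_span hw⟩
    | zero => exact ⟨1, one_ne_zero, by simp⟩
    | add w w' _ _ hw hw' =>
      obtain ⟨s, hs, h1⟩ := hw
      obtain ⟨s', hs', h2⟩ := hw'
      refine ⟨s * s', mul_ne_zero hs hs', ?_⟩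
      have : ((s * s' : A) : K) • (w + w') = s' • ((s : K) • w) + s • ((s' : K) • w') := by
        rw [Subalgebra.smul_def, Subalgebra.smul_def, smul_smul, smul_smul, smul_add]
        push_cast
        rw [mul_comm (s' : K)]
      rw [this]
      exact add_mem (Submodule.smul_mem _ _ h1) (Submodule.smul_mem _ _ h2)
    | smul r w _ hw =>
      obtain ⟨s, hs, h1⟩ := hw
      obtain ⟨s', hs', hs0, hr⟩ := h.exists_denominator_generic r
      refine ⟨⟨s', hs'⟩ * s, mul_ne_zero (fun h0 => hs0 (congrArg Subtype.val h0)) hs, ?_⟩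
      have : (((⟨s', hs'⟩ : A) * s : A) : K) • r • w = (⟨s' * r, hr⟩ : A) • ((s : K) • w) := by
        rw [Subalgebra.smul_def, smul_smul, smul_smul]
        push_cast
        congr 1
        ring
      rw [this]
      exact Submodule.smul_mem _ _ h1
  obtain ⟨s, hs, hsv⟩ := hgen v (hE ▸ Submodule.mem_top)
  -- The element `t` is taken to be `1` here, so that membership of a power means that the ideal is
  -- everything.
  obtain ⟨n, hn⟩ := h.mem_of_forall_exists I ⟨s, hsv, hs⟩ 1 fun x hx _ => by
    obtain ⟨s, hs, h1⟩ := hden x hx v (hEM x hx (hv x hx))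
    exact ⟨s, h1, hs⟩
  have : (1 : A) • v ∈ Submodule.span A E := by simpa [I] using hn
  simpa using this

end IsAffineChart

end AffineCharts

/-! ### Finiteness of the first cohomology from two charts. -/

section TwoCharts

variable {k K V ι : Type*} [Field k] [Field K] [Algebra k K] [AddCommGroup V] [Module K V]

/-- Two affine charts covering a complete curve with function field `K` and local rings `O x`,
together with a rational function `t` such that `t` is regular on the first chart, `t⁻¹` is regular
on the second one, and the intersection of the charts is where both are regular. -/
structure IsTwoChartCover (O : ι → Subalgebra k K) (A₁ A₂ : Subalgebra k K) (U₁ U₂ : Set ι)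
    (t : K) : Prop where
  chart₁ : IsAffineChart O A₁ U₁
  chart₂ : IsAffineChart O A₂ U₂
  cover : ∀ x, x ∈ U₁ ∨ x ∈ U₂
  ne_zero : t ≠ 0
  mem₁ : t ∈ A₁
  inv_mem₂ : t⁻¹ ∈ A₂
  mem_of_inv_mem : ∀ x ∈ U₁, t⁻¹ ∈ O x → x ∈ U₂
  mem_of_mem : ∀ x ∈ U₂, t ∈ O x → x ∈ U₁
  eventually_mem : ∀ a : K, ∀ᶠ x in Filter.cofinite, a ∈ O x
  exists_center : ∀ v : ValuationSubring K, (∀ c : k, algebraMap k K c ∈ v) → v ≠ ⊤ →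
    ∃ x, (∀ a ∈ O x, a ∈ v) ∧ ∀ a ∈ O x, a⁻¹ ∈ v → a⁻¹ ∈ O x

namespace IsTwoChartCover

variable {O : ι → Subalgebra k K} {M : ∀ x, Submodule (O x) V} {A₁ A₂ : Subalgebra k K}
  {U₁ U₂ : Set ι} {t : K} (h : IsTwoChartCover O A₁ A₂ U₁ U₂ t)
include h

/-- The integral closure of `k[t]` is the intersection of the valuation rings containing it. The
centre of such a ring lies in `U₁`: on `U₂` the function `t⁻¹` is regular and its inverse is in `v`,
so by domination `t` is regular at the centre too. Hence `A₁` lies in every such valuation ring. -/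
theorem isIntegral {a : K} (ha : a ∈ A₁) : IsIntegral (Algebra.adjoin k {t}) a := by
  have key : a ∈ (⨅ V : {V : ValuationSubring K //
      Set.range (algebraMap k K) ∪ {t} ⊆ V.toSubring}, V.1.toSubring) := by
    rw [Subring.mem_iInf]
    rintro ⟨v, hv⟩
    have hvk : ∀ c : k, algebraMap k K c ∈ v := fun c => hv (Or.inl ⟨c, rfl⟩)
    have hvt : t ∈ v := hv (Or.inr rfl)
    by_cases htop : v = ⊤
    · subst htop; trivial
    obtain ⟨x, hx, hx'⟩ := h.exists_center v hvk htop
    have hx1 : x ∈ U₁ := by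
      rcases h.cover x with hx1 | hx2
      · exact hx1
      · refine h.mem_of_mem x hx2 ?_
        have := hx' t⁻¹ (h.chart₂.le x hx2 h.inv_mem₂) (by rwa [inv_inv])
        rwa [inv_inv] at this
    exact hx a (h.chart₁.le x hx1 ha)
  rw [iInf_valuationSubring_superset] at key
  have key' : IsIntegral (Subring.closure (Set.range (algebraMap k K) ∪ {t})) a := key
  rw [← Algebra.adjoin_eq_ring_closure] at key'
  exact key'

/-- Sections over the first chart are spanned over `k[t]` by finitely many of them. -/
theorem exists_finite_span {E : Set V} (hEfin : E.Finite) (hE : Submodule.span K E = ⊤)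
    (hEM : ∀ x ∈ U₁, M x ≤ Submodule.span (O x) E) (hEM' : ∀ x ∈ U₁, E ⊆ M x) :
    ∃ E' : Set V, E'.Finite ∧ (∀ x ∈ U₁, E' ⊆ M x) ∧ ∀ v, (∀ x ∈ U₁, v ∈ M x) →
      v ∈ Submodule.span (Algebra.adjoin k {t}) E' := by
  obtain ⟨S, hS⟩ := (Subalgebra.fg_iff_finiteType _).mpr h.chart₁.finiteType
  have hSA : (S : Set K) ⊆ A₁ := hS ▸ Algebra.subset_adjoin
  -- `A₁` is of finite type over `k` and integral over `k[t]`, hence a finite module over it.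
  -- Products of module generators with elements of `E` will span the sections.
  have hfg : (Algebra.adjoin (Algebra.adjoin k {t}) (S : Set K)).toSubmodule.FG :=
    fg_adjoin_of_finite S.finite_toSet fun a ha => h.isIntegral (hSA ha)
  obtain ⟨Y, hY⟩ := hfg
  have hBA : Algebra.adjoin k {t} ≤ A₁ := Algebra.adjoin_le (by simpa using h.mem₁)
  have hYA : ∀ y ∈ Y, y ∈ A₁ := by
    intro y hy
    have hy' : y ∈ Algebra.adjoin (Algebra.adjoin k {t}) (S : Set K) := by
      rw [← Subalgebra.mem_toSubmodule, ← hY]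
      exact Submodule.subset_span hy
    clear hy
    induction hy' using Algebra.adjoin_induction with
    | mem y hy => exact hSA hy
    | algebraMap r => exact hBA r.2
    | add y z _ _ hy hz => exact add_mem (hy) (hz)
    | mul y z _ _ hy hz => exact mul_mem (hy) (hz)
  have hAY : ∀ a ∈ A₁, a ∈ Submodule.span (Algebra.adjoin k {t}) (Y : Set K) := by
    intro a ha
    rw [hY, Subalgebra.mem_toSubmodule]
    rw [← hS] at ha
    have : Algebra.adjoin k (S : Set K) ≤
        (Algebra.adjoin (Algebra.adjoin k {t}) (S : Set K)).restrictScalars k :=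
      Algebra.adjoin_le Algebra.subset_adjoin
    exact this ha
  refine ⟨Set.image2 (fun y e => y • e) (Y : Set K) E, Y.finite_toSet.image2 _ hEfin, ?_, ?_⟩
  · rintro x hx _ ⟨y, hy, e, he, rfl⟩
    exact smul_mem_of_mem _ (h.chart₁.le x hx (hYA y hy)) (hEM' x hx he)
  · intro v hv
    have hv' := h.chart₁.mem_span_of_forall_mem hE hEM hv
    have hsub : ∀ a ∈ A₁, ∀ e ∈ E, a • e ∈ Submodule.span (Algebra.adjoin k {t})
        (Set.image2 (fun (y : K) (e : V) => y • e) (Y : Set K) E) := by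
      intro a ha e he
      have haY := hAY a ha
      clear ha
      induction haY using Submodule.span_induction with
      | mem y hy => exact Submodule.subset_span ⟨y, hy, e, he, rfl⟩
      | zero => simp
      | add y z _ _ hy hz => rw [add_smul]; exact add_mem hy hz
      | smul c y _ hy => rw [smul_assoc]; exact Submodule.smul_mem _ c hy
    have hsmul : ∀ a ∈ A₁, ∀ w ∈ Submodule.span (Algebra.adjoin k {t})
        (Set.image2 (fun (y : K) (e : V) => y • e) (Y : Set K) E),
        a • w ∈ Submodule.span (Algebra.adjoin k {t})
          (Set.image2 (fun (y : K) (e : V) => y • e) (Y : Set K) E) := by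
      intro a ha w hw
      induction hw using Submodule.span_induction with
      | mem w hw =>
        obtain ⟨y, hy, e, he, rfl⟩ := hw
        rw [smul_smul]
        exact hsub _ (mul_mem ha (hYA y hy)) e he
      | zero => simp
      | add y z _ _ hy hz => rw [smul_add]; exact add_mem hy hz
      | smul c y _ hy => rw [smul_comm]; exact Submodule.smul_mem _ c hy
    clear hv
    induction hv' using Submodule.span_induction with
    | mem y hy => simpa using hsub 1 (one_mem _) y hy
    | zero => simp
    | add y z _ _ hy hz => exact add_mem hy hz
    | smul c y _ hy => exact hsmul c c.2 y hy

variable [Module k V] [IsScalarTower k K V]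

/-- Sections over the intersection of the charts are sums of sections over the charts, up to a
finite dimensional space: the finiteness of the first cohomology. -/
theorem exists_finite_complement (hM₁ : IsLocalizedOn O M A₁ U₁) (hM₂ : IsLocalizedOn O M A₂ U₂)
    {E : Set V} (hEfin : E.Finite) (hE : Submodule.span K E = ⊤)
    (hEM : ∀ x ∈ U₁, M x ≤ Submodule.span (O x) E) (hEM' : ∀ x ∈ U₁, E ⊆ M x) :
    ∃ B : Set V, B.Finite ∧ ∀ v, (∀ x ∈ U₁, x ∈ U₂ → v ∈ M x) →
      ∃ m₁ m₂ e, (∀ x ∈ U₁, m₁ ∈ M x) ∧ (∀ x ∈ U₂, m₂ ∈ M x) ∧ e ∈ Submodule.span k B ∧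
        v = m₁ + m₂ + e := by
  obtain ⟨E', hfin, hE'M, hE'⟩ := h.exists_finite_span hEfin hE hEM hEM'
  have ht0 := h.ne_zero
  -- Inside `U₂` the overlap is the locus where `t⁻¹` is a unit, so a high power of `t⁻¹` clears the
  -- poles of `e` off `U₁`; one exponent serves the finite set `E'`.
  have hN : ∃ N : ℕ, ∀ e ∈ E', ∀ n ≥ N, ∀ x ∈ U₂, t⁻¹ ^ n • e ∈ M x := by
    have h1 : ∀ e ∈ E', ∃ N : ℕ, ∀ n ≥ N, ∀ x ∈ U₂, t⁻¹ ^ n • e ∈ M x := by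
      intro e he
      obtain ⟨N, hN⟩ := h.chart₂.exists_pow_smul_mem hM₂ ⟨t⁻¹, h.inv_mem₂⟩ e fun x hx hxt => by
        refine hE'M x (h.mem_of_mem x hx ?_) he
        simpa using hxt.2
      refine ⟨N, fun n hn x hx => ?_⟩
      obtain ⟨m, rfl⟩ := Nat.exists_eq_add_of_le hn
      rw [add_comm, pow_add, mul_smul]
      exact smul_mem_of_mem _ (pow_mem (h.chart₂.le x hx h.inv_mem₂) m) (hN x hx)
    choose! N hN using h1
    obtain ⟨m, hm⟩ := (hfin.image N).bddAbove
    exact ⟨m, fun e he n hn => hN e he n (le_trans (hm ⟨e, he, rfl⟩) hn)⟩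
  obtain ⟨N, hN⟩ := hN
  let B : Set V := Set.image2 (fun (j : ℕ) (e : V) => t⁻¹ ^ j • e) (Set.Iio N) E'
  let L₁ : Submodule k V := ⨅ x ∈ U₁, (M x).restrictScalars k
  let L₂ : Submodule k V := ⨅ x ∈ U₂, (M x).restrictScalars k
  have hL₁ : ∀ v, v ∈ L₁ ↔ ∀ x ∈ U₁, v ∈ M x := fun v => by simp [L₁, Submodule.mem_iInf]
  have hL₂ : ∀ v, v ∈ L₂ ↔ ∀ x ∈ U₂, v ∈ M x := fun v => by simp [L₂, Submodule.mem_iInf]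
  refine ⟨B, (Set.finite_Iio N).image2 _ hfin, fun v hv => ?_⟩
  suffices hmem : v ∈ L₁ ⊔ L₂ ⊔ Submodule.span k B by
    obtain ⟨m, hm, e, he, rfl⟩ := Submodule.mem_sup.mp hmem
    obtain ⟨m₁, h1, m₂, h2, rfl⟩ := Submodule.mem_sup.mp hm
    exact ⟨m₁, m₂, e, (hL₁ _).mp h1, (hL₂ _).mp h2, he, rfl⟩
  obtain ⟨n, hn⟩ := h.chart₁.exists_pow_smul_mem hM₁ ⟨t, h.mem₁⟩ v fun x hx hxt =>
    hv x hx (h.mem_of_inv_mem x hx hxt.2)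
  -- The monomial `t ^ (i - n) • e` extends to `U₁` if `i ≥ n` and to `U₂` if `n - i ≥ N`. Only the
  -- exponents `0 < n - i < N` remain, and these are in `B`.
  have hmono : ∀ (i : ℕ), ∀ e ∈ E', t⁻¹ ^ n • t ^ i • e ∈ L₁ ⊔ L₂ ⊔ Submodule.span k B := by
    intro i e he
    rcases le_total n i with hni | hin
    · refine Submodule.mem_sup_left (Submodule.mem_sup_left ((hL₁ _).mpr fun x hx => ?_))
      obtain ⟨m, rfl⟩ := Nat.exists_eq_add_of_le hni
      rw [smul_smul, pow_add, ← mul_assoc, ← mul_pow, inv_mul_cancel₀ ht0, one_pow, one_mul]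
      exact smul_mem_of_mem _ (pow_mem (h.chart₁.le x hx h.mem₁) m) (hE'M x hx he)
    · obtain ⟨m, rfl⟩ := Nat.exists_eq_add_of_le hin
      rw [smul_smul, add_comm, pow_add, mul_assoc, ← mul_pow, inv_mul_cancel₀ ht0, one_pow,
        mul_one]
      rcases lt_or_ge m N with hmN | hmN
      · exact Submodule.mem_sup_right (Submodule.subset_span ⟨m, hmN, e, he, rfl⟩)
      · exact Submodule.mem_sup_left (Submodule.mem_sup_right
          ((hL₂ _).mpr fun x hx => hN e he m hmN x hx))
  have hw := hE' _ hn
  have hspan : ∀ w ∈ Submodule.span (Algebra.adjoin k {t}) E', ∀ b ∈ Algebra.adjoin k {t},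
      t⁻¹ ^ n • b • w ∈ L₁ ⊔ L₂ ⊔ Submodule.span k B := by
    intro w hw
    induction hw using Submodule.span_induction with
    | mem e he =>
      intro b hb
      rw [Algebra.adjoin_singleton_eq_range_aeval] at hb
      obtain ⟨p, rfl⟩ := hb
      change _ • Polynomial.aeval t p • e ∈ _
      rw [Polynomial.aeval_eq_sum_range, Finset.sum_smul, Finset.smul_sum]
      refine sum_mem fun i _ => ?_
      rw [smul_assoc, smul_comm]
      exact Submodule.smul_mem _ _ (hmono i e he)
    | zero => simp
    | add y z _ _ hy hz =>
      intro b hb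
      rw [smul_add, smul_add]
      exact add_mem (hy b hb) (hz b hb)
    | smul c y _ hy =>
      intro b hb
      rw [Subalgebra.smul_def, smul_smul b]
      exact hy _ (mul_mem hb c.2)
  have := hspan _ hw 1 (one_mem _)
  rwa [one_smul, smul_smul, ← mul_pow, inv_mul_cancel₀ ht0, one_pow, one_smul] at this

/-- The adelic first cohomology of a lattice is spanned by finitely many adeles. -/
theorem exists_finite_adeles (hV : ∀ v : V, ∀ᶠ x in Filter.cofinite, v ∈ M x)
    (hM₁ : IsLocalizedOn O M A₁ U₁) (hM₂ : IsLocalizedOn O M A₂ U₂)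
    {E : Set V} (hEfin : E.Finite) (hE : Submodule.span K E = ⊤)
    (hEM : ∀ x ∈ U₁, M x ≤ Submodule.span (O x) E) (hEM' : ∀ x ∈ U₁, E ⊆ M x) :
    ∃ D : Set (ι → V), D.Finite ∧ (∀ d ∈ D, ∀ᶠ x in Filter.cofinite, d x ∈ M x) ∧
      ∀ b : ι → V, (∀ᶠ x in Filter.cofinite, b x ∈ M x) →
        ∃ d ∈ Submodule.span k D, ∃ a : V, ∀ x, b x - d x - a ∈ M x := by
  classical
  obtain ⟨B, hBfin, hB⟩ := h.exists_finite_complement hM₁ hM₂ hEfin hE hEM hEM'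
  -- A Čech cocycle on the overlap becomes an adele by placing it at all points outside `U₁`.
  let φ : V →ₗ[k] (ι → V) := LinearMap.pi fun x => if x ∈ U₁ then 0 else LinearMap.id
  have hφ₁ : ∀ x ∈ U₁, ∀ v, φ v x = 0 := fun x hx v => by simp [φ, hx]
  have hφ₂ : ∀ x ∉ U₁, ∀ v, φ v x = v := fun x hx v => by simp [φ, hx]
  refine ⟨φ '' B, hBfin.image _, ?_, fun b hb => ?_⟩
  · rintro _ ⟨v, -, rfl⟩
    refine (hV v).mono fun x hx => ?_
    by_cases hxU : x ∈ U₁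
    · rw [hφ₁ x hxU]; exact zero_mem _
    · rwa [hφ₂ x hxU]
  -- The approximations of `b` on the charts are `a₁` and `a₁ + a₂`; their difference `a₂` is
  -- integral on the overlap. Splitting it as `m₁ + m₂ + e` makes `a₁ + m₁` valid everywhere, up to
  -- the adele of `e`.
  · obtain ⟨a₁, ha₁⟩ := h.chart₁.exists_approx hM₁ b hb
    obtain ⟨a₂, ha₂⟩ := h.chart₂.exists_approx hM₂ (fun x => b x - a₁)
      ((hb.and (hV a₁)).mono fun x hx => sub_mem hx.1 hx.2)
    obtain ⟨m₁, m₂, e, h1, h2, he, hsum⟩ := hB a₂ fun x hx1 hx2 => by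
      have := sub_mem (ha₁ x hx1) (ha₂ x hx2)
      simpa using this
    refine ⟨φ e, ?_, a₁ + m₁, fun x => ?_⟩
    · rw [← Submodule.map_span]
      exact Submodule.mem_map_of_mem he
    · by_cases hx : x ∈ U₁
      · rw [hφ₁ x hx, sub_zero, ← sub_sub]
        exact sub_mem (ha₁ x hx) (h1 x hx)
      · have hx2 := (h.cover x).resolve_left hx
        rw [hφ₂ x hx]
        have : b x - e - (a₁ + m₁) = (b x - a₁ - a₂) + m₂ := by rw [hsum]; abel
        rw [this]
        exact add_mem (ha₂ x hx2) (h2 x hx2)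

end IsTwoChartCover

end TwoCharts

/-! ### Strong approximation away from a point. -/

section StrongApproximation

variable {k K V ι : Type*} [Field k] [Field K] [Algebra k K] [AddCommGroup V] [Module K V]
  [Module k V] [IsScalarTower k K V]

/-- The families of vectors which agree, away from `T`, with a global vector modulo the lattices
`M x`. -/
def principalAdeles {O : ι → Subalgebra k K} (M : ∀ x, Submodule (O x) V) (T : Set ι) :
    Submodule k (ι → V) where
  carrier := {b | ∃ a : V, ∀ x ∉ T, b x - a ∈ M x}
  zero_mem' := ⟨0, fun x _ => by simp⟩
  add_mem' := by
    rintro b c ⟨a, ha⟩ ⟨a', ha'⟩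
    refine ⟨a + a', fun x hx => ?_⟩
    rw [Pi.add_apply, add_sub_add_comm]
    exact add_mem (ha x hx) (ha' x hx)
  smul_mem' := by
    rintro c b ⟨a, ha⟩
    refine ⟨c • a, fun x hx => ?_⟩
    rw [Pi.smul_apply, ← smul_sub]
    exact (M x).smul_of_tower_mem c (ha x hx)

variable {O : ι → Subalgebra k K} {M : ∀ x, Submodule (O x) V} {A₁ A₂ : Subalgebra k K}
  {U₁ U₂ : Set ι} {t : K}

/-- The rational functions which are regular away from `P`. -/
def regularAwayFrom (O : ι → Subalgebra k K) (P : ι) : Submodule k K :=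
  ⨅ x ∈ ({P} : Set ι)ᶜ, Subalgebra.toSubmodule (O x)

theorem mem_regularAwayFrom {P : ι} {g : K} :
    g ∈ regularAwayFrom O P ↔ ∀ x, x ≠ P → g ∈ O x := by
  simp [regularAwayFrom, Submodule.mem_iInf]

/-- There is an infinite dimensional space of functions regular away from a point. -/
theorem IsTwoChartCover.not_finite_regularAwayFrom (h : IsTwoChartCover O A₁ A₂ U₁ U₂ t) (P : ι)
    (hP : ∃ c ∈ O P, c⁻¹ ∉ O P) : ¬ Module.Finite k (regularAwayFrom O P) := by
  classical
  intro hfin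
  obtain ⟨D, hDfin, -, hD⟩ := h.exists_finite_adeles
    (M := fun x => (1 : Submodule (O x) K))
    (fun v => (h.eventually_mem v).mono fun x hx => Submodule.mem_one.mpr ⟨⟨v, hx⟩, rfl⟩)
    h.chart₁.isLocalizedOn_one h.chart₂.isLocalizedOn_one (Set.finite_singleton (1 : K))
    (by rw [Submodule.eq_top_iff']; exact fun a => Submodule.mem_span_singleton.mpr ⟨a, by simp⟩)
    (fun x _ => by rw [Submodule.one_eq_span])
    (fun x _ => by
      rw [Set.singleton_subset_iff]
      exact Submodule.mem_one.mpr ⟨1, map_one _⟩)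
  have hmem : ∀ x (a : K), a ∈ (1 : Submodule (O x) K) ↔ a ∈ O x := fun x a => by
    rw [Submodule.mem_one]
    constructor
    · rintro ⟨y, rfl⟩
      exact y.2
    · exact fun ha => ⟨⟨a, ha⟩, rfl⟩
  let B := principalAdeles (fun x => (1 : Submodule (O x) K)) ∅
  -- A function is sent to the class of the adele supported at `P`. The image is finite dimensional,
  -- and the kernel is contained in `regularAwayFrom O P + O P`.
  let ψ : K →ₗ[k] (ι → K) ⧸ B := B.mkQ ∘ₗ LinearMap.single k (fun _ => K) P
  have hDQ : Module.Finite k ((Submodule.span k D).map B.mkQ) := by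
    have : Module.Finite k (Submodule.span k D) := FiniteDimensional.span_of_finite k hDfin
    infer_instance
  have hψ : LinearMap.range ψ ≤ (Submodule.span k D).map B.mkQ := by
    rintro _ ⟨a, rfl⟩
    obtain ⟨d, hd, w, hw⟩ := hD (Pi.single P a) (by
      refine (Set.finite_singleton P).subset fun x hx => by_contra fun hxP => hx ?_
      change Pi.single (M := fun _ => K) P a x ∈ (1 : Submodule (O x) K)
      rw [Pi.single_eq_of_ne hxP]
      exact zero_mem _)
    refine ⟨d, hd, ?_⟩
    refine ((Submodule.Quotient.eq B).mpr ?_).symm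
    exact ⟨w, fun x _ => hw x⟩
  have hψfin : Module.Finite k (LinearMap.range ψ) :=
    Submodule.finiteDimensional_of_le hψ
  have hker : LinearMap.ker ψ ≤ regularAwayFrom O P ⊔ Subalgebra.toSubmodule (O P) := by
    intro a ha
    have ha' : Pi.single P a ∈ B := (Submodule.Quotient.mk_eq_zero B).mp ha
    obtain ⟨w, hw⟩ := ha'
    have h1 := (hmem _ _).mp (hw P (by simp))
    rw [Pi.single_eq_same] at h1
    refine Submodule.mem_sup.mpr ⟨w, mem_regularAwayFrom.mpr fun x hx => ?_, a - w, h1, by simp⟩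
    have h2 := (hmem _ _).mp (hw x (by simp))
    rw [Pi.single_eq_of_ne hx, zero_sub] at h2
    simpa using neg_mem h2
  obtain ⟨W, hW⟩ := (LinearMap.ker ψ).exists_isCompl
  have hWfin : Module.Finite k W :=
    Module.Finite.equiv (ψ.quotKerEquivRange.symm.trans (Submodule.quotientEquivOfIsCompl _ W hW))
  let N := Subalgebra.toSubmodule (O P)
  -- `K` is the sum of the kernel of `ψ` and the finite dimensional complement `W`, so if the
  -- functions regular away from `P` were finite dimensional, `K / O P` would be too.
  have hQ : Module.Finite k (K ⧸ N) := by
    have h1 : ((W ⊔ regularAwayFrom O P : Submodule k K)).map N.mkQ = ⊤ := by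
      rw [eq_top_iff, ← N.range_mkQ, ← Submodule.map_top, Submodule.map_le_iff_le_comap,
        Submodule.comap_map_mkQ, ← hW.sup_eq_top]
      refine sup_le (hker.trans ?_) ?_
      · exact sup_le (le_sup_of_le_right le_sup_right) le_sup_left
      · exact le_sup_of_le_right le_sup_left
    have h2 : Module.Finite k (W ⊔ regularAwayFrom O P : Submodule k K) := inferInstance
    have h3 : Module.Finite k (((W ⊔ regularAwayFrom O P : Submodule k K)).map N.mkQ) :=
      inferInstance
    rw [h1] at h3
    exact Module.Finite.equiv (Submodule.topEquiv)
  obtain ⟨c, hc, hc'⟩ := hP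
  have hc0 : c ≠ 0 := by
    rintro rfl
    exact hc' (by simp)
  -- Multiplication by `c` is onto `K / O P`, hence injective in finite dimension; yet it kills the
  -- nonzero class of `c⁻¹`.
  let μ : (K ⧸ N) →ₗ[k] (K ⧸ N) := N.mapQ N (LinearMap.mulLeft k c) fun a ha =>
    show c * a ∈ O P from mul_mem hc ha
  have hμ : Function.Surjective μ := by
    intro q
    obtain ⟨a, rfl⟩ := N.mkQ_surjective q
    refine ⟨N.mkQ (c⁻¹ * a), ?_⟩
    change N.mkQ (c * (c⁻¹ * a)) = _
    rw [mul_inv_cancel_left₀ hc0]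
  have hinj : Function.Injective μ := LinearMap.injective_iff_surjective.mpr hμ
  have h0 : μ (N.mkQ c⁻¹) = 0 := by
    change N.mkQ (c * c⁻¹) = 0
    rw [mul_inv_cancel₀ hc0]
    exact (Submodule.Quotient.mk_eq_zero N).mpr (one_mem (O P))
  have h1 : N.mkQ c⁻¹ = 0 := hinj (h0.trans (map_zero μ).symm)
  exact hc' ((Submodule.Quotient.mk_eq_zero N).mp h1)

/-- Strong approximation away from a point. -/
theorem IsTwoChartCover.strong_approximation (h : IsTwoChartCover O A₁ A₂ U₁ U₂ t)
    (hV : ∀ v : V, ∀ᶠ x in Filter.cofinite, v ∈ M x)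
    (hM₁ : IsLocalizedOn O M A₁ U₁) (hM₂ : IsLocalizedOn O M A₂ U₂)
    {E : Set V} (hEfin : E.Finite) (hE : Submodule.span K E = ⊤)
    (hEM : ∀ x ∈ U₁, M x ≤ Submodule.span (O x) E) (hEM' : ∀ x ∈ U₁, E ⊆ M x)
    (P : ι) (hP : ∃ c ∈ O P, c⁻¹ ∉ O P) (b : ι → V)
    (hb : ∀ᶠ x in Filter.cofinite, b x ∈ M x) : ∃ a : V, ∀ x, x ≠ P → b x - a ∈ M x := by
  obtain ⟨D, hDfin, hDM, hD⟩ := h.exists_finite_adeles hV hM₁ hM₂ hEfin hE hEM hEM'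
  let B := principalAdeles M {P}
  have hsub : ∀ b : ι → V, (∀ᶠ x in Filter.cofinite, b x ∈ M x) →
      B.mkQ b ∈ (Submodule.span k D).map B.mkQ := by
    intro b hb
    obtain ⟨d, hd, w, hw⟩ := hD b hb
    exact ⟨d, hd, ((Submodule.Quotient.eq B).mpr ⟨w, fun x _ => hw x⟩).symm⟩
  have hDQ : Module.Finite k ((Submodule.span k D).map B.mkQ) := by
    have : Module.Finite k (Submodule.span k D) := FiniteDimensional.span_of_finite k hDfin
    infer_instance
  have hsmul : ∀ g ∈ regularAwayFrom O P, ∀ b : ι → V, (∀ᶠ x in Filter.cofinite, b x ∈ M x) →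
      ∀ᶠ x in Filter.cofinite, (g • b) x ∈ M x := by
    intro g hg b hb
    exact (hb.and (h.eventually_mem g)).mono fun x hx => smul_mem_of_mem (M x) hx.2 hx.1
  -- A function `g` goes to the classes of `g • d` for `d ∈ D`. The source is infinite dimensional
  -- and the target is not, so some nonzero `g` carries all of `D` into `B`.
  let θ : regularAwayFrom O P →ₗ[k] (D → (Submodule.span k D).map B.mkQ) :=
    LinearMap.pi fun d =>
      { toFun := fun g => ⟨B.mkQ ((g : K) • (d : ι → V)), hsub _ (hsmul g g.2 d (hDM d d.2))⟩
        map_add' := fun g g' => Subtype.ext (by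
          push_cast
          rw [add_smul, map_add])
        map_smul' := fun c g => Subtype.ext (by
          change B.mkQ ((c • (g : K)) • (d : ι → V)) = c • B.mkQ ((g : K) • (d : ι → V))
          rw [smul_assoc, map_smul]) }
  have : Finite D := hDfin
  have hθ : ¬ Function.Injective θ := fun hinj =>
    h.not_finite_regularAwayFrom P hP (Module.Finite.of_injective θ hinj)
  rw [← LinearMap.ker_eq_bot, Submodule.eq_bot_iff] at hθ
  push Not at hθ
  obtain ⟨⟨g, hgG⟩, hgker, hg0⟩ := hθ
  have hg0 : g ≠ 0 := fun h0 => hg0 (Subtype.ext h0)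
  have hBsmul : ∀ b ∈ B, g • b ∈ B := by
    rintro b ⟨a, ha⟩
    refine ⟨g • a, fun x hx => ?_⟩
    rw [Pi.smul_apply, ← smul_sub]
    exact smul_mem_of_mem _ (mem_regularAwayFrom.mp hgG x hx) (ha x hx)
  have hDB : ∀ d ∈ Submodule.span k D, g • d ∈ B := by
    intro d hd
    induction hd using Submodule.span_induction with
    | mem d hd =>
      have h1 : θ ⟨g, hgG⟩ ⟨d, hd⟩ = 0 := congrFun hgker ⟨d, hd⟩
      exact (Submodule.Quotient.mk_eq_zero B).mp (congrArg Subtype.val h1)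
    | zero => simp
    | add d d' _ _ h1 h2 => rw [smul_add]; exact add_mem h1 h2
    | smul c d _ h1 => rw [smul_comm]; exact B.smul_mem c h1
  -- Finiteness is applied to `g⁻¹ • b`: it differs from some `d` in the span of `D` by an element
  -- of `B`. Multiplication by `g` preserves `B` and moves `d` into it, so `b ∈ B`.
  obtain ⟨d, hd, w, hw⟩ := hD (g⁻¹ • b) ((hb.and (h.eventually_mem g⁻¹)).mono fun x hx =>
    smul_mem_of_mem (M x) hx.2 hx.1)
  have h1 : g⁻¹ • b - d ∈ B := ⟨w, fun x _ => hw x⟩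
  have h2 := add_mem (hBsmul _ h1) (hDB d hd)
  rw [← smul_add, sub_add_cancel, smul_inv_smul₀ hg0] at h2
  obtain ⟨a, ha⟩ := h2
  exact ⟨a, fun x hx => ha x hx⟩

end StrongApproximation

/-! ### Completion of a one-dimensional Noetherian local domain. -/

section CompletionDimensionOne

open IsLocalRing TensorProduct

theorem isPrecomplete_pi {S κ : Type*} [CommRing S] [Finite κ] (I : Ideal S)
    [IsPrecomplete I S] : IsPrecomplete I (κ → S) := by
  classical
  have := Fintype.ofFinite κ
  refine ⟨fun f hf => ?_⟩
  have h1 : ∀ i, ∃ a : S, ∀ n, f n i ≡ a [SMOD (I ^ n • ⊤ : Submodule S S)] := by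
    intro i
    refine IsPrecomplete.prec' (fun n => f n i) fun {m n} hmn => ?_
    refine ((hf hmn).map (LinearMap.proj i)).mono ?_
    rw [Submodule.map_smul'']
    exact smul_mono_right _ le_top
  choose a ha using h1
  refine ⟨a, fun n => ?_⟩
  rw [SModEq.sub_mem, pi_eq_sum_univ (f n - a)]
  refine sum_mem fun i _ => Submodule.smul_mem_smul ?_ trivial
  have := SModEq.sub_mem.mp (ha i n)
  rwa [smul_eq_mul, Ideal.mul_top] at this

variable {R : Type*} [CommRing R] [IsLocalRing R] [Ring.DimensionLEOne R]

theorem eq_maximalIdeal_of_isPrime {p : Ideal R} (hp : p.IsPrime) (h : p ≠ ⊥) :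
    p = maximalIdeal R :=
  eq_maximalIdeal (Ring.DimensionLEOne.maximalOfPrime h hp)

variable [IsNoetherianRing R]

theorem exists_maximalIdeal_pow_le {c : R} (hc : c ≠ 0) :
    ∃ n : ℕ, maximalIdeal R ^ n ≤ Ideal.span {c} := by
  have h1 : maximalIdeal R ≤ (Ideal.span {c}).radical := by
    rw [Ideal.radical_eq_sInf]
    refine le_sInf fun p ⟨hcp, hp⟩ => (eq_maximalIdeal_of_isPrime hp ?_).ge
    rintro rfl
    exact hc (by simpa using hcp (Ideal.mem_span_singleton_self c))
  exact Ideal.exists_pow_le_of_le_radical_of_fg h1 (maximalIdeal R).fg_of_isNoetherianRing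

theorem exists_completion_pow_le {c : R} (hc : c ≠ 0) :
    ∃ n : ℕ, maximalIdeal (AdicCompletion (maximalIdeal R) R) ^ n ≤
      Ideal.span {algebraMap R (AdicCompletion (maximalIdeal R) R) c} := by
  obtain ⟨n, hn⟩ := exists_maximalIdeal_pow_le hc
  refine ⟨n, ?_⟩
  rw [AdicCompletion.maximalIdeal_eq_map, ← Ideal.map_pow]
  refine (Ideal.map_mono hn).trans ?_
  rw [Ideal.map_span, Set.image_singleton]

/-- Some power of the maximal ideal lies in `(c)`, and modulo that power the ring and its completion
agree. -/
theorem exists_sub_algebraMap_mem {c : R} (hc : c ≠ 0) (a : AdicCompletion (maximalIdeal R) R) :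
    ∃ (r : R) (b : AdicCompletion (maximalIdeal R) R),
      a = algebraMap R (AdicCompletion (maximalIdeal R) R) r +
        algebraMap R (AdicCompletion (maximalIdeal R) R) c * b := by
  obtain ⟨n, hn⟩ := exists_maximalIdeal_pow_le hc
  obtain ⟨r, hr⟩ := Submodule.Quotient.mk_surjective _ (AdicCompletion.eval (maximalIdeal R) R n a)
  have h1 : a - algebraMap R (AdicCompletion (maximalIdeal R) R) r ∈
      (AdicCompletion.eval (maximalIdeal R) R n).ker := by
    rw [LinearMap.mem_ker, map_sub, sub_eq_zero, ← hr]
    rfl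
  rw [← AdicCompletion.pow_smul_top_eq_ker_eval (maximalIdeal R).fg_of_isNoetherianRing,
    Ideal.smul_top_eq_map, Submodule.restrictScalars_mem] at h1
  have h2 := Ideal.map_mono (f := algebraMap R (AdicCompletion (maximalIdeal R) R)) hn h1
  rw [Ideal.map_span, Set.image_singleton, Ideal.mem_span_singleton] at h2
  obtain ⟨b, hb⟩ := h2
  exact ⟨r, b, by rw [← hb]; ring⟩

/-- The completion of a one-dimensional Noetherian local domain is Noetherian. -/
theorem isNoetherianRing_completion (hm : maximalIdeal R ≠ ⊥) :
    IsNoetherianRing (AdicCompletion (maximalIdeal R) R) := by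
  obtain ⟨c, hcm, hc⟩ := Submodule.exists_mem_ne_zero_of_ne_bot hm
  obtain ⟨n, hn⟩ := exists_completion_pow_le hc
  classical
  set S := AdicCompletion (maximalIdeal R) R
  have hcS : algebraMap R S c ∈ maximalIdeal S := by
    rw [AdicCompletion.maximalIdeal_eq_map]
    exact Ideal.mem_map_of_mem _ hcm
  -- By Cohen's theorem it is enough to generate prime ideals finitely. Those containing `c` are
  -- maximal, because a power of the maximal ideal lies in `(c)`.
  refine IsNoetherianRing.of_prime fun P hP => ?_
  by_cases hcP : algebraMap R S c ∈ P
  · have : P = maximalIdeal S := by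
      refine le_antisymm (le_maximalIdeal hP.ne_top) ?_
      refine hP.le_of_pow_le (n := n) (hn.trans ?_)
      rwa [Ideal.span_singleton_le_iff_mem]
    rw [this, AdicCompletion.maximalIdeal_eq_map]
    exact (maximalIdeal R).fg_of_isNoetherianRing.map _
  · have hsurj : Function.Surjective ((Ideal.Quotient.mk (Ideal.span {algebraMap R S c})).comp
        (algebraMap R S)) := by
      intro q
      obtain ⟨a, rfl⟩ := Ideal.Quotient.mk_surjective q
      obtain ⟨r, b, rfl⟩ := exists_sub_algebraMap_mem hc a
      refine ⟨r, ?_⟩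
      rw [RingHom.comp_apply, map_add, left_eq_add, Ideal.Quotient.eq_zero_iff_mem,
        Ideal.mem_span_singleton]
      exact dvd_mul_right _ _
    have hnoeth : IsNoetherianRing (S ⧸ Ideal.span {algebraMap R S c}) :=
      isNoetherianRing_of_surjective R _ _ hsurj
    obtain ⟨G, hG⟩ :=
      (P.map (Ideal.Quotient.mk (Ideal.span {algebraMap R S c}))).fg_of_isNoetherianRing
    have hlift : ∀ g ∈ G, ∃ p ∈ P, Ideal.Quotient.mk (Ideal.span {algebraMap R S c}) p = g := by
      intro g hg
      have : g ∈ P.map (Ideal.Quotient.mk (Ideal.span {algebraMap R S c})) :=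
        hG ▸ Submodule.subset_span hg
      exact (Ideal.mem_map_iff_of_surjective _ Ideal.Quotient.mk_surjective).mp this
    choose! p hpP hpG using hlift
    let f : (G → S) →ₗ[S] P := Fintype.linearCombination S fun g => ⟨p g, hpP g g.2⟩
    -- `S / c` is a quotient of `R`, so the image of `P` has finitely many generators, with lifts `p
    -- g ∈ P`. Since `c ∉ P`, a multiple `c b` in `P` has `b ∈ P`, and so `P` is the ideal of the
    -- lifts plus `c P`.
    have hdecomp : ∀ a ∈ P, ∃ b ∈ P, a - algebraMap R S c * b ∈
        Ideal.span (p '' (G : Set (S ⧸ Ideal.span {algebraMap R S c}))) := by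
      intro a ha
      have h1 : Ideal.Quotient.mk (Ideal.span {algebraMap R S c}) a ∈
          (Ideal.span (p '' (G : Set (S ⧸ Ideal.span {algebraMap R S c})))).map
            (Ideal.Quotient.mk (Ideal.span {algebraMap R S c})) := by
        rw [Ideal.map_span, Set.image_image, Set.image_congr (g := id) (fun g hg => hpG g hg),
          Set.image_id]
        have : Ideal.span (G : Set (S ⧸ Ideal.span {algebraMap R S c})) = _ := hG
        rw [this]
        exact Ideal.mem_map_of_mem _ ha
      obtain ⟨a', ha', h2⟩ :=
        (Ideal.mem_map_iff_of_surjective _ Ideal.Quotient.mk_surjective).mp h1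
      rw [Eq.comm, Ideal.Quotient.eq, Ideal.mem_span_singleton] at h2
      obtain ⟨b, hb⟩ := h2
      have ha'P : a' ∈ P := by
        refine (Ideal.span_le (I := P)).mpr ?_ ha'
        rintro _ ⟨g, hg, rfl⟩
        exact hpP g hg
      refine ⟨b, ?_, ?_⟩
      · refine (hP.mem_or_mem (x := algebraMap R S c) (y := b) ?_).resolve_left hcP
        rw [← hb]
        exact sub_mem ha ha'P
      · rw [← hb, sub_sub_cancel]
        exact ha'
    have hspan : ∀ a ∈ Ideal.span (p '' (G : Set (S ⧸ Ideal.span {algebraMap R S c}))),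
        ∃ x, (f x : S) = a := by
      intro a ha
      induction ha using Submodule.span_induction with
      | mem a ha =>
        obtain ⟨g, hg, rfl⟩ := ha
        exact ⟨Pi.single ⟨g, hg⟩ 1, by simp [f, Fintype.linearCombination_apply_single]⟩
      | zero => exact ⟨0, by simp⟩
      | add a b _ _ ha hb =>
        obtain ⟨x, rfl⟩ := ha
        obtain ⟨y, rfl⟩ := hb
        exact ⟨x + y, by simp⟩
      | smul s a _ ha =>
        obtain ⟨x, rfl⟩ := ha
        exact ⟨s • x, by rw [map_smul]; rfl⟩
    have hhaus : IsHausdorff (maximalIdeal S) P := by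
      refine ⟨fun x hx => Subtype.ext ?_⟩
      refine IsHausdorff.haus (inferInstance : IsHausdorff (maximalIdeal S) S) (x : S) fun m => ?_
      have h1 := hx m
      rw [SModEq.zero] at h1 ⊢
      have h2 := Submodule.mem_map_of_mem (f := P.subtype) h1
      rw [Submodule.map_smul''] at h2
      have h3 : maximalIdeal S ^ m • Submodule.map P.subtype ⊤ ≤ maximalIdeal S ^ m • ⊤ :=
        smul_mono_right _ le_top
      exact h3 h2
    have hprec : IsPrecomplete (maximalIdeal S) (G → S) := isPrecomplete_pi _
    -- `f` is onto modulo the maximal ideal. Completeness of `G → S` and separatedness of `P` lift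
    -- this to surjectivity; Nakayama's lemma would presuppose that `P` is finitely generated.
    have hf : Function.Surjective f := by
      refine surjective_of_mkQ_comp_surjective (I := maximalIdeal S) fun q => ?_
      obtain ⟨a, rfl⟩ := Submodule.mkQ_surjective _ q
      obtain ⟨b, hb, hab⟩ := hdecomp a a.2
      obtain ⟨x, hx⟩ := hspan _ hab
      refine ⟨x, ((Submodule.Quotient.eq _).mpr ?_)⟩
      have : f x - a = -(algebraMap R S c • (⟨b, hb⟩ : P)) := Subtype.ext (by
        change (f x : S) - a = -(algebraMap R S c * b)
        rw [hx]; ring)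
      rw [this]
      exact neg_mem (Submodule.smul_mem_smul hcS trivial)
    have : Module.Finite S P := Module.Finite.of_surjective f hf
    exact (Submodule.fg_top P).mp this.fg_top

variable [IsDomain R]

/-- A nonzerodivisor in the completion of a one-dimensional Noetherian local domain divides a
nonzero element of the ring. -/
theorem exists_dvd_algebraMap (hm : maximalIdeal R ≠ ⊥)
    {a : AdicCompletion (maximalIdeal R) R} (ha : a ∈ nonZeroDivisors _) :
    ∃ c : R, c ≠ 0 ∧ a ∣ algebraMap R (AdicCompletion (maximalIdeal R) R) c := by
  have := isNoetherianRing_completion hm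
  obtain ⟨c, hcm, hc⟩ := Submodule.exists_mem_ne_zero_of_ne_bot hm
  obtain ⟨n, hn⟩ := exists_completion_pow_le hc
  let S := AdicCompletion (maximalIdeal R) R
  have hcS : algebraMap R S c ∈ maximalIdeal S := by
    rw [AdicCompletion.maximalIdeal_eq_map]
    exact Ideal.mem_map_of_mem _ hcm
  have hmax : ∀ P : Ideal S, P.IsPrime → algebraMap R S c ∈ P → P = maximalIdeal S := by
    intro P hP hcP
    refine le_antisymm (le_maximalIdeal hP.ne_top) ?_
    refine hP.le_of_pow_le (n := n) (hn.trans ?_)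
    rwa [Ideal.span_singleton_le_iff_mem]
  -- Krull's principal ideal theorem then bounds the height of the maximal ideal by one.
  have hmin : maximalIdeal S ∈ (Ideal.span {algebraMap R S c}).minimalPrimes := by
    refine ⟨⟨inferInstance, by rwa [Ideal.span_singleton_le_iff_mem]⟩, ?_⟩
    rintro Q ⟨hQ, hcQ⟩ -
    rw [hmax Q hQ (by rwa [Ideal.span_singleton_le_iff_mem] at hcQ)]
  have hheight : (maximalIdeal S).height ≤ 1 := by
    have : (Ideal.span {algebraMap R S c}).IsPrincipal := ⟨⟨_, rfl⟩⟩
    exact Ideal.height_le_one_of_isPrincipal_of_mem_minimalPrimes _ _ hmin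
  -- A prime containing `a` but not `c` would lie strictly below the maximal ideal, hence be a
  -- minimal prime, and the elements of minimal primes are zero divisors.
  have hrad : algebraMap R S c ∈ (Ideal.span {a}).radical := by
    rw [Ideal.radical_eq_sInf, Submodule.mem_sInf]
    rintro P ⟨haP, hP⟩
    by_contra hcP
    have hlt : P < maximalIdeal S := lt_of_le_of_ne (le_maximalIdeal hP.ne_top) (by
      rintro rfl
      exact hcP hcS)
    have hP0 : Ideal.height P = 0 := by
      have h1 := (Ideal.height_add_one_le_of_lt_of_isPrime hlt).trans hheight
      have h2 : Ideal.height P + 1 ≤ 0 + 1 := by rwa [zero_add]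
      exact le_antisymm ((ENat.add_le_add_iff_right ENat.one_ne_top).mp h2) zero_le
    have hPmin : P ∈ minimalPrimes S := Ideal.height_eq_zero_iff.mp hP0
    exact notMem_nonZeroDivisors_of_mem_mem_minimalPrimes
      ((Ideal.span_singleton_le_iff_mem P).mp haP) hPmin ha
  obtain ⟨m, hm⟩ := hrad
  refine ⟨c ^ m, pow_ne_zero m hc, ?_⟩
  rw [map_pow]
  exact Ideal.mem_span_singleton.mp hm

variable {M : Type*} [AddCommGroup M] [Module R M]

omit [IsDomain R] in
theorem exists_eq_tmul_add_smul {c : R} (hc : c ≠ 0)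
    (x : AdicCompletion (maximalIdeal R) R ⊗[R] M) :
    ∃ (m : M) (y : AdicCompletion (maximalIdeal R) R ⊗[R] M), x = 1 ⊗ₜ m + c • y := by
  induction x using TensorProduct.induction_on with
  | zero => exact ⟨0, 0, by simp⟩
  | tmul a m =>
    obtain ⟨r, b, rfl⟩ := exists_sub_algebraMap_mem hc a
    refine ⟨r • m, b ⊗ₜ m, ?_⟩
    rw [add_tmul, ← Algebra.smul_def, Algebra.algebraMap_eq_smul_one, smul_tmul, smul_tmul']
  | add x y hx hy =>
    obtain ⟨m, x', rfl⟩ := hx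
    obtain ⟨n, y', rfl⟩ := hy
    exact ⟨m + n, x' + y', by rw [tmul_add, smul_add]; abel⟩

omit [Ring.DimensionLEOne R] in
-- Multiplication by `c` is injective on `M`, and the completion is flat.
theorem completion_smul_injective [Module.IsTorsionFree R M] {c : R} (hc : c ≠ 0)
    {x : AdicCompletion (maximalIdeal R) R ⊗[R] M} (h : c • x = 0) : x = 0 := by
  have h1 : Function.Injective (LinearMap.lsmul R M c) := smul_right_injective M hc
  have h2 := Module.Flat.lTensor_preserves_injective_linearMap
    (M := AdicCompletion (maximalIdeal R) R) _ h1
  have h3 : ∀ y, LinearMap.lTensor (AdicCompletion (maximalIdeal R) R)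
      (LinearMap.lsmul R M c) y = c • y := by
    intro y
    induction y using TensorProduct.induction_on with
    | zero => simp
    | tmul a m => simp
    | add x y hx hy => rw [map_add, hx, hy, smul_add]
  exact h2 ((h3 x).trans (h.trans (map_zero _).symm))

/-- An element of the kernel is killed by a nonzerodivisor `a` of the completion. As `a` divides
some nonzero `c ∈ R`, the element is killed by `c`, which acts injectively. -/
theorem completion_mk_injective [Module.IsTorsionFree R M] (hm : maximalIdeal R ≠ ⊥) :
    Function.Injective (TensorProduct.mk (AdicCompletion (maximalIdeal R) R)
      (FractionRing (AdicCompletion (maximalIdeal R) R))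
      (AdicCompletion (maximalIdeal R) R ⊗[R] M) 1) := by
  have hloc : IsLocalizedModule (nonZeroDivisors (AdicCompletion (maximalIdeal R) R))
    (TensorProduct.mk (AdicCompletion (maximalIdeal R) R)
      (FractionRing (AdicCompletion (maximalIdeal R) R))
      (AdicCompletion (maximalIdeal R) R ⊗[R] M) 1) := inferInstance
  rw [injective_iff_map_eq_zero]
  intro x hx
  obtain ⟨⟨a, ha⟩, h1⟩ := (IsLocalizedModule.eq_zero_iff (nonZeroDivisors _) _).mp hx
  obtain ⟨c, hc, b, hb⟩ := exists_dvd_algebraMap hm ha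
  refine completion_smul_injective hc ?_
  rw [← algebraMap_smul (AdicCompletion (maximalIdeal R) R) c x, hb, mul_comm, mul_smul]
  have : a • x = 0 := h1
  rw [this, smul_zero]

omit [Ring.DimensionLEOne R] [IsDomain R] in
-- By faithful flatness `M / cM` embeds in its base change to the completion, where the class of `m`
-- vanishes.
theorem exists_eq_smul_of_completion {c : R} {m : M}
    {x : AdicCompletion (maximalIdeal R) R ⊗[R] M} (h : 1 ⊗ₜ m = c • x) : ∃ n : M, m = c • n := by
  have : Module.FaithfullyFlat R (AdicCompletion (maximalIdeal R) R) :=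
    Module.FaithfullyFlat.of_flat_of_isLocalHom
  let N : Submodule R M := LinearMap.range (LinearMap.lsmul R M c)
  have hinj := Module.FaithfullyFlat.tensorProduct_mk_injective (A := R)
    (B := AdicCompletion (maximalIdeal R) R) (M ⧸ N)
  have h1 : N.mkQ m = 0 := by
    refine hinj ?_
    rw [map_zero]
    have h2 := congrArg (LinearMap.lTensor (AdicCompletion (maximalIdeal R) R) N.mkQ) h
    rw [LinearMap.lTensor_tmul, map_smul] at h2
    refine h2.trans ?_
    generalize (LinearMap.lTensor (AdicCompletion (maximalIdeal R) R) N.mkQ) x = y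
    induction y using TensorProduct.induction_on with
    | zero => simp
    | tmul a q =>
      obtain ⟨n, rfl⟩ := N.mkQ_surjective q
      rw [smul_tmul', smul_tmul, ← map_smul]
      have : N.mkQ (c • n) = 0 := (Submodule.Quotient.mk_eq_zero N).mpr ⟨n, rfl⟩
      rw [this, tmul_zero]
    | add x y hx hy => rw [smul_add, hx, hy, add_zero]
  obtain ⟨n, hn⟩ := (Submodule.Quotient.mk_eq_zero N).mp h1
  exact ⟨n, hn.symm⟩

/-- Every element of the completed rational stalk has a denominator in the ring itself, and is
congruent to a fraction `m / c`, modulo the image of the completed stalk. -/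
theorem exists_smul_eq_mk (hm : maximalIdeal R ≠ ⊥)
    (w : FractionRing (AdicCompletion (maximalIdeal R) R) ⊗[AdicCompletion (maximalIdeal R) R]
      (AdicCompletion (maximalIdeal R) R ⊗[R] M)) :
    ∃ (c : R) (m : M) (y : AdicCompletion (maximalIdeal R) R ⊗[R] M), c ≠ 0 ∧
      c • w = TensorProduct.mk (AdicCompletion (maximalIdeal R) R)
        (FractionRing (AdicCompletion (maximalIdeal R) R))
        (AdicCompletion (maximalIdeal R) R ⊗[R] M) 1 (1 ⊗ₜ m + c • y) := by
  obtain ⟨⟨x, a, ha⟩, h1⟩ := IsLocalizedModule.surj (nonZeroDivisors _)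
    (TensorProduct.mk (AdicCompletion (maximalIdeal R) R)
      (FractionRing (AdicCompletion (maximalIdeal R) R))
      (AdicCompletion (maximalIdeal R) R ⊗[R] M) 1) w
  obtain ⟨c, hc, b, hb⟩ := exists_dvd_algebraMap hm ha
  obtain ⟨m, y, hy⟩ := exists_eq_tmul_add_smul hc (b • x)
  refine ⟨c, m, y, hc, ?_⟩
  rw [← hy, ← algebraMap_smul (AdicCompletion (maximalIdeal R) R) c w, hb, mul_comm, mul_smul]
  have : a • w = _ := h1
  rw [this, map_smul]

end CompletionDimensionOne

/-! ### Points and local rings of a one-dimensional integral scheme. -/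

section Points

variable {C : Scheme.{u}} [IsIntegral C]

/-- A proper specialization `y` of `x` would give a chain of length two: the closures of `y`, of `x`
and of the generic point. -/
theorem isClosed_singleton_of_ne_genericPoint (h : topologicalKrullDim C = 1) {x : C}
    (hx : x ≠ genericPoint C) : IsClosed ({x} : Set C) := by
  by_contra hcl
  have hlt : ∃ y ∈ closure ({x} : Set C), y ≠ x := by
    by_contra hcon
    push Not at hcon
    refine hcl ?_
    have : closure ({x} : Set C) = {x} :=
      Set.Subset.antisymm (fun y hy => hcon y hy) subset_closure
    rw [← this]
    exact isClosed_closure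
  obtain ⟨y, hy, hyx⟩ := hlt
  let cl (z : C) : IrreducibleCloseds C :=
    ⟨closure {z}, isIrreducible_singleton.closure, isClosed_closure⟩
  have key : ∀ z w : C, w ∈ closure ({z} : Set C) → w ≠ z → cl w < cl z := by
    intro z w hw hwz
    have hzw : z ⤳ w := specializes_iff_mem_closure.mpr hw
    refine lt_of_le_of_ne (hzw.closure_subset) fun heq => hwz ?_
    have : closure ({w} : Set C) = closure {z} :=
      congrArg (fun a : IrreducibleCloseds C => (a : Set C)) heq
    have hz : z ∈ closure ({w} : Set C) := this ▸ subset_closure rfl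
    exact ((specializes_iff_mem_closure.mpr hz).antisymm hzw).eq
  let p : LTSeries (IrreducibleCloseds C) :=
    { length := 2
      toFun := ![cl y, cl x, cl (genericPoint C)]
      step := fun i => by
        fin_cases i
        · exact key _ _ hy hyx
        · exact key _ _ (specializes_iff_mem_closure.mp (specializes_genericPoint x)) hx }
  have hp : ((2 : ℕ) : WithBot ℕ∞) ≤ topologicalKrullDim C := Order.LTSeries.length_le_krullDim p
  rw [h] at hp
  exact absurd hp (by decide)

theorem fromSpecStalk_eq_genericPoint_iff (x : C) (p : PrimeSpectrum (C.presheaf.stalk x)) :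
    C.fromSpecStalk x p = genericPoint C ↔ p.asIdeal = ⊥ := by
  have hinj : Function.Injective (C.fromSpecStalk x) :=
    (C.fromSpecStalk x).isEmbedding.injective
  obtain ⟨q, hq⟩ : genericPoint C ∈ Set.range (C.fromSpecStalk x) := by
    rw [Scheme.range_fromSpecStalk]
    exact specializes_genericPoint x
  let b : PrimeSpectrum (C.presheaf.stalk x) := ⊥
  have hbq : b ⤳ q := (PrimeSpectrum.le_iff_specializes b q).mp bot_le
  have h1 : C.fromSpecStalk x b ⤳ genericPoint C := hq ▸ hbq.map (C.fromSpecStalk x).continuous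
  have h2 : C.fromSpecStalk x b = genericPoint C :=
    (h1.antisymm (specializes_genericPoint _)).eq
  constructor
  · intro h
    rw [← h2] at h
    rw [hinj h]
    rfl
  · intro h
    have : p = b := PrimeSpectrum.ext h
    rw [this, h2]

/-- Primes of `𝒪_x` are the points specializing to `x`. A nonzero prime is not the generic point, so
its point is closed and must be `x`. -/
theorem dimensionLEOne_stalk (h : topologicalKrullDim C = 1) (x : C) :
    Ring.DimensionLEOne (C.presheaf.stalk x) := by
  refine ⟨fun {p} hp hprime => ?_⟩
  have hinj : Function.Injective (C.fromSpecStalk x) :=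
    (C.fromSpecStalk x).isEmbedding.injective
  let y := C.fromSpecStalk x ⟨p, hprime⟩
  have hy : y ≠ genericPoint C := fun h' =>
    hp ((fromSpecStalk_eq_genericPoint_iff x ⟨p, hprime⟩).mp h')
  have hyx : y ⤳ x := by
    have : y ∈ Set.range (C.fromSpecStalk x) := ⟨_, rfl⟩
    rwa [Scheme.range_fromSpecStalk] at this
  have hcl := isClosed_singleton_of_ne_genericPoint h hy
  rw [specializes_iff_mem_closure, hcl.closure_eq] at hyx
  have h1 : y = C.fromSpecStalk x (IsLocalRing.closedPoint _) := by
    rw [Scheme.fromSpecStalk_closedPoint]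
    exact hyx.symm
  have h2 := congrArg PrimeSpectrum.asIdeal (hinj h1)
  have h3 : p = IsLocalRing.maximalIdeal _ := h2
  rw [h3]
  infer_instance

theorem maximalIdeal_stalk_ne_bot {x : C} (hx : x ≠ genericPoint C) :
    IsLocalRing.maximalIdeal (C.presheaf.stalk x) ≠ ⊥ := fun h =>
  hx (Scheme.fromSpecStalk_closedPoint.symm.trans
    ((fromSpecStalk_eq_genericPoint_iff x (IsLocalRing.closedPoint _)).mpr h))

end Points

/-! ### The local rings and affine coordinate rings of a curve inside its function field. -/

section LocalRings

variable (k : Type u) [Field k] {C : Scheme.{u}} [C.Over (Spec (.of k))] [IsIntegral C]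

theorem algebraMap_functionField (x : C) (c : k) :
    algebraMap (C.presheaf.stalk x) C.functionField (algebraMap k (C.presheaf.stalk x) c) =
      algebraMap k C.functionField c :=
  C.presheaf.germ_stalkSpecializes_apply _ (specializes_genericPoint x) _

/-- The local ring `𝒪_x` as a subring of the function field. -/
noncomputable def localRing (x : C) : Subalgebra k C.functionField :=
  { (algebraMap (C.presheaf.stalk x) C.functionField).range with
    algebraMap_mem' := fun c => ⟨_, algebraMap_functionField k x c⟩ }

variable {k}

/-- For elements that already lie in the local ring, `InvMem` thus expresses that they do not vanish
at `x`. -/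
theorem invMem_localRing_iff {x : C} (r : C.presheaf.stalk x) :
    InvMem (localRing k x) (algebraMap (C.presheaf.stalk x) C.functionField r) ↔ IsUnit r := by
  have hinj := IsFractionRing.injective (C.presheaf.stalk x) C.functionField
  constructor
  · rintro ⟨h0, s, hs⟩
    refine IsUnit.of_mul_eq_one s (hinj ?_)
    rw [map_mul, hs, map_one, mul_inv_cancel₀ h0]
  · intro h
    obtain ⟨u, rfl⟩ := h
    have h1 : algebraMap (C.presheaf.stalk x) C.functionField u *
        algebraMap (C.presheaf.stalk x) C.functionField (u⁻¹ : (C.presheaf.stalk x)ˣ) = 1 := by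
      rw [← map_mul, Units.mul_inv, map_one]
    exact ⟨left_ne_zero_of_mul_eq_one h1, _, eq_inv_of_mul_eq_one_right h1⟩

theorem algebraMap_germ {U : C.Opens} {x : C} (hx : x ∈ U) (s : Γ(C, U)) :
    algebraMap (C.presheaf.stalk x) C.functionField (C.presheaf.germ U x hx s) =
      C.presheaf.germ U (genericPoint C) (genericPoint_mem U hx) s :=
  C.presheaf.germ_stalkSpecializes_apply _ _ _

theorem invMem_germ_iff {U : C.Opens} (hU : genericPoint C ∈ U) {x : C} (hx : x ∈ U)
    (s : Γ(C, U)) :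
    InvMem (localRing k x) (C.presheaf.germ U (genericPoint C) hU s) ↔ x ∈ C.basicOpen s := by
  rw [← algebraMap_germ hx, invMem_localRing_iff, Scheme.mem_basicOpen C s x hx]

variable (k) in
/-- The ring of functions on a nonempty open set, inside of the function field. -/
noncomputable def coordinateRing (U : C.Opens) (hU : genericPoint C ∈ U) :
    Subalgebra k C.functionField :=
  { (C.presheaf.germ U (genericPoint C) hU).hom.range with
    algebraMap_mem' := fun c => ⟨_, germ_scalarsToSections (genericPoint C) k U hU c⟩ }

theorem coordinateRing_le_localRing {U : C.Opens} (hU : genericPoint C ∈ U) {x : C} (hx : x ∈ U) :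
    coordinateRing k U hU ≤ localRing k x := by
  rintro _ ⟨s, rfl⟩
  exact ⟨_, algebraMap_germ hx s⟩

theorem finiteType_coordinateRing [LocallyOfFiniteType (C ↘ Spec (.of k))] {U : C.Opens}
    (hU : genericPoint C ∈ U) (hUa : IsAffineOpen U) :
    Algebra.FiniteType k (coordinateRing k U hU) := by
  have h1 : (scalarsToSections k C U).FiniteType := by
    have h2 : ((C ↘ Spec (.of k)).appLE ⊤ U le_top).hom.FiniteType :=
      LocallyOfFiniteType.finiteType_appLE _ (isAffineOpen_top _) hUa _
    have h3 : (Scheme.ΓSpecIso (.of k)).inv.hom.FiniteType :=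
      RingHom.FiniteType.of_surjective _
        (ConcreteCategory.bijective_of_isIso (Scheme.ΓSpecIso (.of k)).inv).2
    exact h2.comp h3
  let f : Γ(C, U) →+* coordinateRing k U hU :=
    (C.presheaf.germ U (genericPoint C) hU).hom.rangeRestrict
  have hf : Function.Surjective f :=
    (C.presheaf.germ U (genericPoint C) hU).hom.rangeRestrict_surjective
  have h3 : (f.comp (scalarsToSections k C U)).FiniteType :=
    (RingHom.FiniteType.of_surjective f hf).comp h1
  have h4 : f.comp (scalarsToSections k C U) = algebraMap k (coordinateRing k U hU) :=
    RingHom.ext fun c => Subtype.ext (germ_scalarsToSections (genericPoint C) k U hU c)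
  rw [h4] at h3
  exact RingHom.finiteType_algebraMap.mp h3

omit [IsIntegral C] in
theorem exists_germ_mul_eq {U : C.Opens} (hU : IsAffineOpen U) {x : C} (hx : x ∈ U)
    (a : C.presheaf.stalk x) : ∃ s b : Γ(C, U), IsUnit (C.presheaf.germ U x hx s) ∧
      C.presheaf.germ U x hx s * a = C.presheaf.germ U x hx b := by
  let : Algebra Γ(C, U) (C.presheaf.stalk x) := (C.presheaf.germ U x hx).hom.toAlgebra
  have : IsLocalization.AtPrime (C.presheaf.stalk x) (hU.primeIdealOf ⟨x, hx⟩).asIdeal :=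
    hU.isLocalization_stalk ⟨x, hx⟩
  obtain ⟨⟨b, s⟩, h⟩ := IsLocalization.surj (hU.primeIdealOf ⟨x, hx⟩).asIdeal.primeCompl a
  exact ⟨s, b, IsLocalization.map_units (C.presheaf.stalk x) s, (mul_comm _ _).trans h⟩

theorem isAffineChart [LocallyOfFiniteType (C ↘ Spec (.of k))] (hdim : topologicalKrullDim C = 1)
    {U : C.Opens} (hU : genericPoint C ∈ U) (hUa : IsAffineOpen U) :
    IsAffineChart (fun x : closedPoints C => localRing k x.1) (coordinateRing k U hU)
      {x | x.1 ∈ U} where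
  le x hx := coordinateRing_le_localRing hU hx
  finiteType := finiteType_coordinateRing hU hUa
  exists_of_isPrime 𝔭 hp hne := by
    let f : Γ(C, U) →+* coordinateRing k U hU :=
      (C.presheaf.germ U (genericPoint C) hU).hom.rangeRestrict
    have hf : Function.Surjective f :=
      (C.presheaf.germ U (genericPoint C) hU).hom.rangeRestrict_surjective
    -- The prime, pulled back to `Γ(C, U)`, is a point of the affine open `U`. It is not generic
    -- since the prime is nonzero, hence it is closed.
    let q : PrimeSpectrum Γ(C, U) := ⟨𝔭.comap f, hp.comap f⟩
    let y : C := hUa.fromSpec q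
    have hyU : y ∈ U := by
      have : y ∈ hUa.fromSpec.opensRange := ⟨q, rfl⟩
      rwa [hUa.opensRange_fromSpec] at this
    have hys : ∀ s : Γ(C, U), s ∉ 𝔭.comap f ↔ y ∈ C.basicOpen s := by
      intro s
      have h1 : q ∈ hUa.fromSpec ⁻¹ᵁ C.basicOpen s ↔ q ∈ PrimeSpectrum.basicOpen s := by
        rw [hUa.fromSpec_preimage_basicOpen]
        exact Iff.rfl
      exact h1.symm
    have hyη : y ≠ genericPoint C := by
      intro h
      obtain ⟨a, ha, ha0⟩ := Submodule.exists_mem_ne_zero_of_ne_bot hne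
      obtain ⟨s, rfl⟩ := hf a
      refine (hys s).mpr ?_ ha
      rw [h, Scheme.mem_basicOpen C s _ hU, isUnit_iff_ne_zero]
      exact fun h0 => ha0 (Subtype.ext h0)
    refine ⟨⟨y, isClosed_singleton_of_ne_genericPoint hdim hyη⟩, hyU, fun a => ?_⟩
    obtain ⟨s, rfl⟩ := hf a
    exact (hys s).trans (invMem_germ_iff hU hyU s).symm
  exists_separating x hx y hy hxy := by
    -- A basic open neighbourhood of `y` in `U` that avoids `x` provides the separating function.
    let V : C.Opens := U ⊓ complement x
    obtain ⟨s, hs, hys⟩ := hUa.exists_basicOpen_le (V := V)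
      ⟨y.1, hy, mem_complement (Ne.symm hxy)⟩ hy
    refine ⟨_, ⟨s, rfl⟩, fun h => ?_, (invMem_germ_iff hU hy s).mpr hys⟩
    exact (hs ((invMem_germ_iff hU hx s).mp h)).2 rfl
  exists_denominator x hx r hr := by
    obtain ⟨a, rfl⟩ := hr
    obtain ⟨s, b, hs, hab⟩ := exists_germ_mul_eq hUa hx a
    refine ⟨_, ⟨s, rfl⟩, (invMem_germ_iff hU hx s).mpr ((Scheme.mem_basicOpen C s _ hx).mpr hs),
      b, ?_⟩
    have := congrArg (algebraMap (C.presheaf.stalk x.1) C.functionField) hab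
    rw [map_mul, algebraMap_germ, algebraMap_germ] at this
    exact this.symm
  exists_denominator_generic r := by
    obtain ⟨s, b, hs, hab⟩ := exists_germ_mul_eq hUa hU r
    exact ⟨_, ⟨s, rfl⟩, hs.ne_zero, b, hab.symm⟩

theorem eventually_mem_localRing [IsNoetherian C] (hdim : topologicalKrullDim C = 1)
    (a : C.functionField) : ∀ᶠ x : closedPoints C in Filter.cofinite, a ∈ localRing k x.1 := by
  obtain ⟨U, hU, s, rfl⟩ := C.presheaf.exists_germ_eq a
  refine (finite_closedPoints_notMem hdim U hU).subset fun x hx hxU => hx ?_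
  exact coordinateRing_le_localRing (k := k) hU hxU ⟨s, rfl⟩

end LocalRings

/-! ### Stalks of a sheaf as lattices of rational sections. -/

section Lattices

variable {k : Type u} [Field k] {C : Scheme.{u}} [C.Over (Spec (.of k))] [IsIntegral C]

variable (k) in
/-- The image of `F_x` in the space of rational sections of `F`. -/
noncomputable def stalkLattice (F : C.Modules) (x : C) :
    Submodule (localRing k x) (GenericStalk F) where
  carrier := Set.range (toGenericStalk F x)
  zero_mem' := ⟨0, map_zero _⟩
  add_mem' := by
    rintro _ _ ⟨m, rfl⟩ ⟨n, rfl⟩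
    exact ⟨m + n, map_add _ _ _⟩
  smul_mem' := by
    rintro ⟨_, r, rfl⟩ _ ⟨m, rfl⟩
    exact ⟨r • m, map_smul _ _ _⟩

omit [IsIntegral C] in
-- The germ `m` extends to a basic open set `D(g)`, where quasi-coherence writes it as `b / g ^ n`.
theorem exists_germ_smul_eq (F : C.Modules) [F.IsQuasicoherent] {U : C.Opens} (hU : IsAffineOpen U)
    {x : C} (hx : x ∈ U) (m : F.presheaf.stalk x) :
    ∃ (s : Γ(C, U)) (b : Γ(F, U)), x ∈ C.basicOpen s ∧
      C.presheaf.germ U x hx s • m = F.presheaf.germ U x hx b := by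
  obtain ⟨V, hxV, t, rfl⟩ := F.presheaf.exists_germ_eq m
  obtain ⟨g, hgV, hxg⟩ := hU.exists_basicOpen_le ⟨x, hxV⟩ hx
  let j := hU.fromSpec
  have hjU : j ''ᵁ ⊤ = U := by
    rw [Scheme.Hom.image_top_eq_opensRange, hU.opensRange_fromSpec]
  have hjg : j ''ᵁ PrimeSpectrum.basicOpen g = C.basicOpen g := hU.fromSpec_image_basicOpen g
  have hxg' : x ∈ j ''ᵁ PrimeSpectrum.basicOpen g := hjg ▸ hxg
  have hx' : x ∈ j ''ᵁ ⊤ := hjU.ge hx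
  obtain ⟨n, b, h⟩ := exists_pow_smul_eq_germ F j g
    (F.presheaf.map (homOfLE (hjg.le.trans hgV)).op t)
  have h1 := h x hxg' hx'
  rw [F.presheaf.germ_res_apply (homOfLE (hjg.le.trans hgV)) x hxg' t] at h1
  refine ⟨C.presheaf.map (homOfLE hjU.ge).op
    ((j.appIso ⊤).inv ((Scheme.ΓSpecIso Γ(C, U)).inv (g ^ n))),
    F.presheaf.map (homOfLE hjU.ge).op b, ?_, ?_⟩
  · rw [Scheme.mem_basicOpen C _ x hx, C.presheaf.germ_res_apply, ← Scheme.mem_basicOpen C _ x hx',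
      ← Scheme.image_basicOpen, basicOpen_eq_of_affine]
    obtain ⟨y, hy, hyx⟩ := hxg'
    exact ⟨y, fun h0 => hy (y.2.mem_of_pow_mem n h0), hyx⟩
  · rw [C.presheaf.germ_res_apply]
    refine h1.trans ?_
    exact (F.presheaf.germ_res_apply (homOfLE hjU.ge) x hx b).symm

theorem isLocalizedOn_stalkLattice (F : C.Modules) [F.IsQuasicoherent] {U : C.Opens}
    (hU : genericPoint C ∈ U) (hUa : IsAffineOpen U) :
    IsLocalizedOn (fun x : closedPoints C => localRing k x.1) (fun x => stalkLattice k F x.1)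
      (coordinateRing k U hU) {x | x.1 ∈ U} where
  exists_smul x hx v hv := by
    obtain ⟨m, rfl⟩ := hv
    obtain ⟨s, b, hs, hb⟩ := exists_germ_smul_eq F hUa hx m
    refine ⟨_, ⟨s, rfl⟩, (invMem_germ_iff hU hx s).mpr hs, fun y hy => ?_⟩
    refine ⟨F.presheaf.germ U y hy b, ?_⟩
    have h1 := congrArg (toGenericStalk F x.1) hb
    rw [map_smul, toGenericStalk_germ F x.1 U hx hU] at h1
    rw [toGenericStalk_germ F y.1 U hy hU, ← h1, ← algebraMap_germ hx]
    rfl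
  exists_smul_generic v := by
    obtain ⟨s, b, hs, hb⟩ := exists_germ_smul_eq F hUa hU v
    rw [Scheme.mem_basicOpen C s _ hU] at hs
    refine ⟨_, ⟨s, rfl⟩, hs.ne_zero, fun y hy => ⟨F.presheaf.germ U y hy b, ?_⟩⟩
    rw [toGenericStalk_germ F y.1 U hy hU]
    exact hb.symm

theorem eventually_mem_stalkLattice [IsNoetherian C] (hdim : topologicalKrullDim C = 1)
    (F : C.Modules) (v : GenericStalk F) :
    ∀ᶠ x : closedPoints C in Filter.cofinite, v ∈ stalkLattice k F x.1 := by
  obtain ⟨U, hU, m, rfl⟩ := exists_genericGerm_eq F v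
  refine (finite_closedPoints_notMem hdim U hU).subset fun x hx hxU => hx ?_
  exact ⟨_, toGenericStalk_germ F x.1 U hxU hU m⟩

/-- `F_η` is a localization of `F_x`, so the kernel is torsion. -/
theorem toGenericStalk_injective (F : C.Modules) [F.IsQuasicoherent] (hF : IsTorsionFreeSheaf F)
    (x : C) : Function.Injective (toGenericStalk F x) := by
  have := hF x
  rw [injective_iff_map_eq_zero]
  intro m hm
  obtain ⟨s, hs⟩ := (IsLocalizedModule.eq_zero_iff (nonZeroDivisors (C.presheaf.stalk x))
    (toGenericStalk F x)).mp hm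
  exact (smul_eq_zero.mp hs).resolve_left (nonZeroDivisors.ne_zero s.2)

theorem genericGerm_injective (F : C.Modules) [F.IsQuasicoherent]
    (hF : IsTorsionFreeSheaf F) {U : C.Opens} (hU : genericPoint C ∈ U) :
    Function.Injective (genericGerm F U hU) := by
  intro s t hst
  refine TopCat.Presheaf.section_ext ⟨F.presheaf, F.isSheaf⟩ U s t fun x hx => ?_
  apply toGenericStalk_injective F hF x
  exact (toGenericStalk_germ F x U hx hU s).trans
    (hst.trans (toGenericStalk_germ F x U hx hU t).symm)

/-- Sections of a torsion free sheaf are the rational sections which are regular at each point. -/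
theorem exists_section_of_forall_mem (F : C.Modules) [F.IsQuasicoherent]
    (hF : IsTorsionFreeSheaf F) {U : C.Opens} (hU : genericPoint C ∈ U) (v : GenericStalk F)
    (hv : ∀ x ∈ U, ∃ m, toGenericStalk F x m = v) : ∃ s, genericGerm F U hU s = v := by
  have hloc : ∀ x : U, ∃ (W : C.Opens) (hx : x.1 ∈ W) (hWU : W ≤ U) (s : Γ(F, W)),
      genericGerm F W (genericPoint_mem W hx) s = v := by
    intro x
    obtain ⟨m, hm⟩ := hv x.1 x.2
    obtain ⟨W, hxW, s, rfl⟩ := F.presheaf.exists_germ_eq m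
    rw [toGenericStalk_germ F x.1 W hxW (genericPoint_mem W hxW)] at hm
    refine ⟨W ⊓ U, ⟨hxW, x.2⟩, inf_le_right, F.presheaf.map (homOfLE inf_le_left).op s, ?_⟩
    rw [← hm]
    exact F.presheaf.germ_res_apply (homOfLE inf_le_left) _ _ s
  choose W hxW hWU s hs using hloc
  have hcov : U = iSup W := by
    refine le_antisymm (fun x hx => ?_) (iSup_le hWU)
    exact Opens.mem_iSup.mpr ⟨⟨x, hx⟩, hxW ⟨x, hx⟩⟩
  have hη : ∀ x, genericPoint C ∈ W x := fun x => genericPoint_mem _ (hxW x)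
  -- The local sections agree on overlaps because they have the same generic germ `v`, and sections
  -- embed in `F_η`.
  obtain ⟨t, ht, -⟩ := TopCat.Sheaf.existsUnique_gluing'
    (⟨F.presheaf, F.isSheaf⟩ : TopCat.Sheaf Ab C) W U (fun x => homOfLE (hWU x)) hcov.le s fun x y => by
      have hxy : genericPoint C ∈ W x ⊓ W y := ⟨hη x, hη y⟩
      refine genericGerm_injective F hF hxy ?_
      have h1 := F.presheaf.germ_res_apply (Opens.infLELeft (W x) (W y)) _ hxy (s x)
      have h2 := F.presheaf.germ_res_apply (Opens.infLERight (W x) (W y)) _ hxy (s y)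
      exact h1.trans ((hs x).trans ((hs y).symm.trans h2.symm))
  let x₀ : U := ⟨genericPoint C, hU⟩
  refine ⟨t, ?_⟩
  rw [← hs x₀, ← ht x₀]
  exact (F.presheaf.germ_res_apply (homOfLE (hWU x₀)) _ (hη x₀) t).symm

end Lattices

/-! ### Finite generation of a quasi-coherent sheaf of finite type. -/

section FiniteType

open Scheme.Modules Limits

/-- Local generators are given for the sheaf over the site of a covering open. Generating families
survive functors that preserve colimits and the unit, so they pass through the equivalence with
modules on the open subscheme and then to a smaller affine open. -/
theorem exists_generatingSections_restrict {X : Scheme.{u}} (M : X.Modules) [M.IsFiniteType]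
    (x : X) : ∃ (U : X.Opens) (_ : IsAffineOpen U) (_ : x ∈ U) (σ : (M.restrict U.ι).GeneratingSections),
      σ.IsFiniteType := by
  obtain ⟨σ, hσ⟩ := SheafOfModules.IsFiniteType.exists_localGeneratorsData M
  have cov := σ.coversTop
  rw [Opens.coversTop_iff] at cov
  have hx : x ∈ iSup σ.X := cov ▸ trivial
  obtain ⟨i, hi⟩ := Opens.mem_iSup.mp hx
  obtain ⟨_, ⟨U, hU, rfl⟩, hxU, hUi⟩ :=
    X.isBasis_affineOpens.exists_subset_of_mem_open hi (σ.X i).isOpen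
  have hUi : U ≤ σ.X i := hUi
  let u := X.homOfLE hUi
  have : PreservesColimitsOfSize.{u, u} (restrictFunctor u) := inferInstance
  let F := (overEquiv (σ.X i)).functor ⋙ restrictFunctor u
  have hF : PreservesColimitsOfSize.{u, u} F :=
    comp_preservesColimits (overEquiv (σ.X i)).functor (restrictFunctor u)
  let iso : SheafOfModules.overFunctor X.ringCatSheaf _ ⋙ F ≅ restrictFunctor
      (Scheme.Opens.ι U) := (Functor.associator _ _ _).symm ≪≫
        Functor.isoWhiskerRight (Scheme.Modules.overFunctorEquiv _) _ ≪≫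
        (restrictFunctorComp _ _).symm ≪≫ (restrictFunctorCongr (by simp [u]))
  have h := (iso.app M).isIso_hom
  have h := @IsIso.epi_of_iso _ _ _ _ _ h
  have := hσ.isFiniteType i
  let G : SheafOfModules.GeneratingSections (F.obj (M.over (σ.X i))) :=
    @SheafOfModules.GeneratingSections.map _ _ _ _ _ _ _ _ _ _ _ _ _ (σ.generators i) F hF
      (Scheme.Modules.restrictUnitIso _).symm
  have hG : G.IsFiniteType := ⟨inferInstanceAs (Finite (σ.generators i).I)⟩
  refine ⟨U, hU, hxU,
    @SheafOfModules.GeneratingSections.ofEpi _ _ _ _ _ _ _ _ G (iso.app M).hom h, ?_⟩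
  exact ⟨hG.finite⟩

theorem finite_of_generatingSections {R : CommRingCat.{u}} (M : (Spec R).Modules)
    [M.IsQuasicoherent]
    (σ : M.GeneratingSections) (hσ : σ.IsFiniteType) :
    Module.Finite R ((modulesSpecToSheaf.obj M).presheaf.obj (.op ⊤)) := by
  let e := asIso M.fromTildeΓ
  have h1 := @IsIso.epi_of_iso _ _ _ _ _ e.isIso_inv
  have h2 := @IsIso.epi_of_iso _ _ _ _ _ (tildeFinsupp (R := R) σ.I).isIso_hom
  have h3 : Epi σ.π := σ.epi
  let f : (tilde.functor R).obj (ModuleCat.of R (σ.I →₀ R)) ⟶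
      (tilde.functor R).obj ((modulesSpecToSheaf.obj M).presheaf.obj (.op ⊤)) :=
    ((tildeFinsupp (R := R) σ.I).hom ≫ σ.π) ≫ e.inv
  have hf : Epi f := by
    have := @epi_comp _ _ _ _ _ _ h2 _ h3
    exact @epi_comp _ _ _ _ _ _ this _ h1
  -- The functor `~` is full, so the epimorphism from the free sheaf comes from a map of modules; it
  -- is faithful, so it reflects epimorphisms.
  have hg : Epi ((tilde.functor R).preimage f) := by
    apply (tilde.functor R).epi_of_epi_map
    rwa [(tilde.functor R).map_preimage]
  rw [ModuleCat.epi_iff_surjective] at hg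
  have := hσ.finite
  exact Module.Finite.of_surjective _ hg

theorem exists_affine_generatingSections {X : Scheme.{u}} (M : X.Modules) [M.IsFiniteType] (x : X) :
    ∃ (R : CommRingCat.{u}) (j : Spec R ⟶ X) (_ : IsOpenImmersion j) (_ : x ∈ j ''ᵁ ⊤)
      (σ : (M.restrict j).GeneratingSections), σ.IsFiniteType := by
  obtain ⟨U, hU, hxU, σ, hσ⟩ := exists_generatingSections_restrict M x
  let F := restrictFunctor hU.isoSpec.inv
  have hF : PreservesColimitsOfSize.{u, u} F := inferInstance
  let G : SheafOfModules.GeneratingSections (F.obj (M.restrict U.ι)) :=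
    @SheafOfModules.GeneratingSections.map _ _ _ _ _ _ _ _ _ _ _ _ _ σ F hF
      (Scheme.Modules.restrictUnitIso _).symm
  have h := ((restrictFunctorComp hU.isoSpec.inv U.ι).app M).isIso_inv
  have h := @IsIso.epi_of_iso _ _ _ _ _ h
  refine ⟨_, hU.isoSpec.inv ≫ U.ι, inferInstance, ?_,
    @SheafOfModules.GeneratingSections.ofEpi _ _ _ _ _ _ _ _ G _ h, ⟨hσ.finite⟩⟩
  rw [Scheme.Hom.image_top_eq_opensRange]
  refine ⟨hU.isoSpec.hom ⟨x, hxU⟩, ?_⟩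
  have : (hU.isoSpec.hom ≫ hU.isoSpec.inv ≫ U.ι) ⟨x, hxU⟩ = x := by
    rw [Iso.hom_inv_id_assoc]
    rfl
  exact this

/-- A quasi-coherent sheaf of finite type is, locally, generated by finitely many sections. -/
theorem exists_finite_generating_germs {X : Scheme.{u}} (F : X.Modules) [F.IsQuasicoherent]
    [F.IsFiniteType] (x : X) :
    ∃ (W : X.Opens) (_ : x ∈ W) (S : Set Γ(F, W)), S.Finite ∧ ∀ (y : X) (hy : y ∈ W),
      Submodule.span (X.presheaf.stalk y) (F.presheaf.germ W y hy '' S) = ⊤ := by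
  obtain ⟨R, j, hj, hx, σ, hσ⟩ := exists_affine_generatingSections F x
  obtain ⟨S, hS⟩ := (finite_of_generatingSections (F.restrict j) σ hσ).fg_top
  let S' : Set Γ(F, j ''ᵁ ⊤) := (S : Set ((modulesSpecToSheaf.obj (F.restrict j)).obj.obj (.op ⊤)))
  refine ⟨j ''ᵁ ⊤, hx, S', S.finite_toSet, fun y hy => ?_⟩
  have key : ∀ b : Γ(F, j ''ᵁ ⊤), F.presheaf.germ (j ''ᵁ ⊤) y hy b ∈
      Submodule.span (X.presheaf.stalk y) (F.presheaf.germ (j ''ᵁ ⊤) y hy '' S') := by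
    suffices h : ∀ b ∈ Submodule.span R
        (S : Set ((modulesSpecToSheaf.obj (F.restrict j)).obj.obj (.op ⊤))),
        F.presheaf.germ (j ''ᵁ ⊤) y hy (show Γ(F, j ''ᵁ ⊤) from b) ∈
          Submodule.span (X.presheaf.stalk y) (F.presheaf.germ (j ''ᵁ ⊤) y hy '' S') from
      fun b => h b (hS ▸ Submodule.mem_top)
    intro b hb
    induction hb using Submodule.span_induction with
    | mem z hz => exact Submodule.subset_span ⟨_, hz, rfl⟩
    | zero => exact (map_zero (F.presheaf.germ (j ''ᵁ ⊤) y hy).hom) ▸ zero_mem _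
    | add z w _ _ hz hw =>
      exact (map_add (F.presheaf.germ (j ''ᵁ ⊤) y hy).hom z w) ▸ add_mem hz hw
    | smul r z _ hz =>
      let s : Γ(X, j ''ᵁ ⊤) := (j.appIso ⊤).inv ((Spec R).presheaf.map (𝟙 (Opposite.op ⊤))
        ((Scheme.ΓSpecIso R).inv r))
      exact (germ_smul F hy s z) ▸ Submodule.smul_mem _ _ hz
  rw [eq_top_iff]
  rintro m -
  have hU : IsAffineOpen (j ''ᵁ ⊤) := (isAffineOpen_top (Spec R)).image_of_isOpenImmersion j
  obtain ⟨s, b, hs, hb⟩ := exists_germ_smul_eq F hU hy m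
  rw [Scheme.mem_basicOpen X s _ hy] at hs
  -- Each germ is a fraction `b / s` with `s` a unit at `y`, so generation of the global sections
  -- over the affine open suffices.
  exact (Submodule.smul_mem_iff_of_isUnit _ hs).mp (hb ▸ key b)

theorem exists_finite_span_rational (k : Type u) [Field k] {C : Scheme.{u}} [C.Over (Spec (.of k))]
    [IsIntegral C] (F : C.Modules) [F.IsQuasicoherent] [F.IsFiniteType] :
    ∃ (W : C.Opens) (_ : genericPoint C ∈ W) (E : Set (GenericStalk F)), E.Finite ∧
      Submodule.span C.functionField E = ⊤ ∧ ∀ x ∈ W, E ⊆ stalkLattice k F x ∧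
        stalkLattice k F x ≤ Submodule.span (localRing k x) E := by
  obtain ⟨W, hW, S, hS, h⟩ := exists_finite_generating_germs F (genericPoint C)
  refine ⟨W, hW, genericGerm F W hW '' S, hS.image _, h _ hW, fun x hx => ⟨?_, ?_⟩⟩
  · rintro _ ⟨b, -, rfl⟩
    exact ⟨_, toGenericStalk_germ F x W hx hW b⟩
  · rintro _ ⟨m, rfl⟩
    have hm : m ∈ Submodule.span (C.presheaf.stalk x) (F.presheaf.germ W x hx '' S) :=
      h x hx ▸ Submodule.mem_top
    induction hm using Submodule.span_induction with
    | mem z hz =>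
      obtain ⟨b, hb, rfl⟩ := hz
      exact Submodule.subset_span ⟨b, hb, (toGenericStalk_germ F x W hx hW b).symm⟩
    | zero => exact (map_zero (toGenericStalk F x)) ▸ zero_mem _
    | add z w _ _ hz hw => exact (map_add (toGenericStalk F x) z w) ▸ add_mem hz hw
    | smul r z _ hz =>
      exact (map_smul (toGenericStalk F x) r z) ▸
        Submodule.smul_mem _ (⟨_, r, rfl⟩ : localRing k x) hz

end FiniteType

/-! ### Degree zero fractions and prime avoidance on `Proj`. -/

section Proj

variable {σ : Type*} {A : Type u} [CommRing A] [SetLike σ A] [AddSubgroupClass σ A]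
  (𝒜 : ℕ → σ) [GradedRing 𝒜] {d : ℕ} {f g : A}

/-- The section `g / f` of the structure sheaf of `Proj 𝒜` over `D₊(f)`. -/
noncomputable def fracSection (hf : f ∈ 𝒜 d) (hg : g ∈ 𝒜 d) : Γ(Proj 𝒜, Proj.basicOpen 𝒜 f) :=
  Proj.awayToSection 𝒜 f (HomogeneousLocalization.mk ⟨d, ⟨g, hg⟩, ⟨f, hf⟩, Submonoid.mem_powers f⟩)

theorem isUnit_germ_fracSection_iff (hf : f ∈ 𝒜 d) (hg : g ∈ 𝒜 d) (x : Proj 𝒜)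
    (hx : x ∈ Proj.basicOpen 𝒜 f) :
    IsUnit ((Proj 𝒜).presheaf.germ _ x hx (fracSection 𝒜 hf hg)) ↔ x ∈ Proj.basicOpen 𝒜 g := by
  have h1 := Proj.stalkIso'_germ 𝒜 (Proj.basicOpen 𝒜 f) x hx (fracSection 𝒜 hf hg)
  have h2 : IsUnit ((Proj 𝒜).presheaf.germ _ x hx (fracSection 𝒜 hf hg)) ↔
      IsUnit (Proj.stalkIso' 𝒜 x ((Proj 𝒜).presheaf.germ _ x hx (fracSection 𝒜 hf hg))) :=
    (MulEquiv.isUnit_map (Proj.stalkIso' 𝒜 x)).symm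
  rw [h2]
  refine (iff_of_eq (congrArg IsUnit h1)).trans ?_
  rw [← HomogeneousLocalization.isUnit_iff_isUnit_val]
  change IsUnit (Localization.mk g ⟨f, hx⟩) ↔ _
  have : x.asHomogeneousIdeal.toIdeal.IsPrime := x.isPrime
  rw [Localization.mk_eq_mk']
  exact IsLocalization.AtPrime.isUnit_mk'_iff _ x.asHomogeneousIdeal.toIdeal g ⟨f, hx⟩

theorem fracSection_mul_fracSection (hf : f ∈ 𝒜 d) (hg : g ∈ 𝒜 d) :
    (Proj 𝒜).presheaf.map (homOfLE inf_le_left :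
        Proj.basicOpen 𝒜 f ⊓ Proj.basicOpen 𝒜 g ⟶ _).op (fracSection 𝒜 hf hg) *
      (Proj 𝒜).presheaf.map (homOfLE inf_le_right :
        Proj.basicOpen 𝒜 f ⊓ Proj.basicOpen 𝒜 g ⟶ _).op (fracSection 𝒜 hg hf) = 1 := by
  refine Subtype.ext (funext fun x => ?_)
  have : x.1.asHomogeneousIdeal.toIdeal.IsPrime := x.1.isPrime
  have hxf : f ∉ x.1.asHomogeneousIdeal.toIdeal := x.2.1
  have hxg : g ∉ x.1.asHomogeneousIdeal.toIdeal := x.2.2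
  change HomogeneousLocalization.mk (x := x.1.asHomogeneousIdeal.toIdeal.primeCompl)
      ⟨d, ⟨g, hg⟩, ⟨f, hf⟩, hxf⟩ * HomogeneousLocalization.mk ⟨d, ⟨f, hf⟩, ⟨g, hg⟩, hxg⟩ = 1
  apply HomogeneousLocalization.val_injective
  rw [HomogeneousLocalization.val_mul, HomogeneousLocalization.val_one]
  change (Localization.mk g ⟨f, hxf⟩ * Localization.mk f ⟨g, hxg⟩ :
    Localization.AtPrime x.1.asHomogeneousIdeal.toIdeal) = 1
  rw [Localization.mk_mul, ← Localization.mk_one, Localization.mk_eq_mk_iff,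
    Localization.r_iff_exists]
  exact ⟨1, by simp [mul_comm]⟩

variable {𝒜}

theorem exists_homogeneous_mem_notMem {I J : HomogeneousIdeal 𝒜} (h : ¬ I ≤ J) :
    ∃ (e : ℕ) (a : A), a ∈ 𝒜 e ∧ a ∈ I ∧ a ∉ J := by
  classical
  by_contra! hcon
  refine h fun a ha => ?_
  rw [← HomogeneousIdeal.mem_iff, ← DirectSum.sum_support_decompose 𝒜 a]
  exact sum_mem fun i _ => hcon i _ (SetLike.coe_mem _) (I.isHomogeneous i ha)

theorem exists_pos_homogeneous_notMem (x : Proj 𝒜) :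
    ∃ (e : ℕ) (a : A), 0 < e ∧ a ∈ 𝒜 e ∧ a ∉ x.asHomogeneousIdeal := by
  obtain ⟨e, a, hae, ha, hax⟩ := exists_homogeneous_mem_notMem x.not_irrelevant_le
  rcases Nat.eq_zero_or_pos e with rfl | he
  · refine absurd ?_ hax
    have h1 : a = 0 := by
      rw [HomogeneousIdeal.mem_irrelevant_iff, GradedRing.proj_apply,
        DirectSum.decompose_of_mem_same 𝒜 hae] at ha
      exact ha
    exact h1 ▸ zero_mem _
  · exact ⟨e, a, he, hae, hax⟩

/-- Homogeneous prime avoidance: finitely many points of `Proj 𝒜` lie in some `D₊(g)`. -/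
theorem exists_basicOpen_of_finset (T : Finset (Proj 𝒜)) :
    ∃ (d : ℕ) (g : A), 0 < d ∧ g ∈ 𝒜 d ∧ ∀ x ∈ T, x ∈ Proj.basicOpen 𝒜 g := by
  classical
  induction T using Finset.strongInduction with
  | H T ih =>
  rcases T.eq_empty_or_nonempty with rfl | hT
  · exact ⟨1, 0, one_pos, zero_mem _, by simp⟩
  -- Minimality of `p` ensures that no other prime of `T` is contained in it, so each has a
  -- homogeneous element outside `p`.
  obtain ⟨p, hpT, hp⟩ := T.exists_minimalFor (fun x : Proj 𝒜 => x.asHomogeneousIdeal) hT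
  obtain ⟨d, f, hd, hfd, hf⟩ := ih _ (Finset.erase_ssubset hpT)
  by_cases hfp : p ∈ Proj.basicOpen 𝒜 f
  · refine ⟨d, f, hd, hfd, fun x hx => ?_⟩
    by_cases hxp : x = p
    · exact hxp ▸ hfp
    · exact hf x (Finset.mem_erase.mpr ⟨hxp, hx⟩)
  have hsep : ∀ q ∈ T.erase p, ∃ (e : ℕ) (a : A), a ∈ 𝒜 e ∧ a ∈ q.asHomogeneousIdeal ∧
      a ∉ p.asHomogeneousIdeal := by
    intro q hq
    obtain ⟨hqp, hqT⟩ := Finset.mem_erase.mp hq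
    refine exists_homogeneous_mem_notMem fun hle => hqp ?_
    exact ProjectiveSpectrum.ext (le_antisymm hle (hp hqT hle))
  choose! e a hae haq hap using hsep
  obtain ⟨e₀, a₀, he₀, ha₀e, ha₀p⟩ := exists_pos_homogeneous_notMem p
  -- The product vanishes at all points of `T` except `p`, while `f` vanishes only at `p`. The
  -- factor `a₀` makes the degree `n` positive, and `f ^ n` and `h ^ d` have the common degree `n *
  -- d`, so their sum vanishes nowhere on `T`.
  let h := a₀ * ∏ q ∈ T.erase p, a q
  let n := e₀ + ∑ q ∈ T.erase p, e q
  have hn : 0 < n := Nat.add_pos_left he₀ _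
  have hh : h ∈ 𝒜 n := SetLike.mul_mem_graded ha₀e (SetLike.prod_mem_graded _ _ _ hae)
  have hhq : ∀ q ∈ T.erase p, h ∈ q.asHomogeneousIdeal.toIdeal := fun q hq =>
    Ideal.mul_mem_left _ _ (Ideal.mem_of_dvd _ (Finset.dvd_prod_of_mem a hq) (haq q hq))
  have hhp : h ∉ p.asHomogeneousIdeal.toIdeal := by
    intro hmem
    rcases p.isPrime.mem_or_mem hmem with h0 | h0
    · exact ha₀p h0
    · obtain ⟨q, hq, hqm⟩ := p.isPrime.prod_mem_iff.mp h0
      exact hap q hq hqm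
  refine ⟨n * d, f ^ n + h ^ d, Nat.mul_pos hn hd, add_mem ?_ ?_, fun x hx => ?_⟩
  · exact SetLike.pow_mem_graded n hfd
  · rw [mul_comm]
    exact SetLike.pow_mem_graded d hh
  · by_cases hxp : x = p
    · subst hxp
      intro hmem
      have hfx : f ∈ x.asHomogeneousIdeal.toIdeal := not_not.mp hfp
      have h1 : h ^ d ∈ x.asHomogeneousIdeal.toIdeal :=
        (Ideal.add_mem_iff_right _ (Ideal.pow_mem_of_mem _ hfx n hn)).mp hmem
      exact hhp (x.isPrime.mem_of_pow_mem d h1)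
    · have hxT := Finset.mem_erase.mpr ⟨hxp, hx⟩
      intro hmem
      have h1 : f ^ n ∈ x.asHomogeneousIdeal.toIdeal :=
        (Ideal.add_mem_iff_left _ (Ideal.pow_mem_of_mem _ (hhq x hxT) d hd)).mp hmem
      exact hf x hxT (x.isPrime.mem_of_pow_mem n h1)

/-- The sets `D₊(f)` with `f` homogeneous of positive degree are a basis of `Proj 𝒜`. -/
theorem exists_basicOpen_le_of_mem (x : Proj 𝒜) (U : (Proj 𝒜).Opens) (hx : x ∈ U) :
    ∃ (d : ℕ) (f : A), 0 < d ∧ f ∈ 𝒜 d ∧ x ∈ Proj.basicOpen 𝒜 f ∧ Proj.basicOpen 𝒜 f ≤ U := by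
  obtain ⟨_, ⟨_, ⟨f, rfl⟩, rfl⟩, hxf, hfU⟩ :=
    (Proj.isBasis_basicOpen 𝒜).exists_subset_of_mem_open hx U.isOpen
  rw [Proj.basicOpen_eq_iSup_proj] at hxf hfU
  obtain ⟨i, hi⟩ := Opens.mem_iSup.mp hxf
  obtain ⟨e, a, he, hae, hax⟩ := exists_pos_homogeneous_notMem x
  -- The component of `f` that is nonzero at `x` may have degree zero; the factor `a` raises the
  -- degree.
  refine ⟨i + e, GradedRing.proj 𝒜 i f * a, Nat.add_pos_right i he,
    SetLike.mul_mem_graded (SetLike.coe_mem _) hae, ?_, ?_⟩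
  · rw [Proj.basicOpen_mul]
    exact ⟨hi, hax⟩
  · rw [Proj.basicOpen_mul]
    refine inf_le_left.trans (le_trans ?_ (show _ ≤ U from hfU))
    exact le_iSup (fun i => Proj.basicOpen 𝒜 (GradedRing.proj 𝒜 i f)) i

end Proj

/-! ### Two affine charts covering a projective curve. -/

section Cover

variable {σ : Type*} {A : Type u} [CommRing A] [SetLike σ A] [AddSubgroupClass σ A]
  {𝒜 : ℕ → σ} [GradedRing 𝒜] {k : Type u} [Field k] {C : Scheme.{u}} [C.Over (Spec (.of k))]
  [IsIntegral C]

omit [IsIntegral C] [C.Over (Spec (.of k))] in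
theorem basicOpen_app_fracSection (i : C ⟶ Proj 𝒜) {d : ℕ} {f g : A} (hf : f ∈ 𝒜 d) (hg : g ∈ 𝒜 d)
    (x : C) (hx : x ∈ C.basicOpen (i.app _ (fracSection 𝒜 hf hg))) :
    x ∈ i ⁻¹ᵁ Proj.basicOpen 𝒜 g := by
  rw [← Scheme.preimage_basicOpen] at hx
  have hx' : i x ∈ (Proj 𝒜).basicOpen (fracSection 𝒜 hf hg) := hx
  have hxf := (Proj 𝒜).basicOpen_le _ hx'
  rw [Scheme.mem_basicOpen _ _ _ hxf, isUnit_germ_fracSection_iff] at hx'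
  exact hx'

omit [C.Over (Spec (.of k))] [IsIntegral C] in
theorem germ_app_fracSection_mul (i : C ⟶ Proj 𝒜) {d : ℕ} {f g : A} (hf : f ∈ 𝒜 d) (hg : g ∈ 𝒜 d)
    (x : C) (hxf : x ∈ i ⁻¹ᵁ Proj.basicOpen 𝒜 f) (hxg : x ∈ i ⁻¹ᵁ Proj.basicOpen 𝒜 g) :
    C.presheaf.germ _ x hxf (i.app _ (fracSection 𝒜 hf hg)) *
      C.presheaf.germ _ x hxg (i.app _ (fracSection 𝒜 hg hf)) = 1 := by
  have hx : i x ∈ Proj.basicOpen 𝒜 f ⊓ Proj.basicOpen 𝒜 g := ⟨hxf, hxg⟩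
  have h := congrArg ((Proj 𝒜).presheaf.germ _ (i x) hx)
    (fracSection_mul_fracSection 𝒜 hf hg)
  rw [map_mul, TopCat.Presheaf.germ_res_apply, TopCat.Presheaf.germ_res_apply, map_one] at h
  have h' := congrArg (i.stalkMap x) h
  rw [map_mul, map_one, Scheme.Hom.germ_stalkMap_apply, Scheme.Hom.germ_stalkMap_apply] at h'
  exact h'

/-- A projective curve is covered by two affine charts, the first of which is contained in a given
neighbourhood of the generic point, such that the complement of each chart in the other one is the
zero locus of a rational function, or of its inverse. -/
theorem exists_isTwoChartCover [IsNoetherian C] [LocallyOfFiniteType (C ↘ Spec (.of k))]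
    (hdim : topologicalKrullDim C = 1) (i : C ⟶ Proj 𝒜) [IsClosedImmersion i]
    (hcenter : ∀ v : ValuationSubring C.functionField,
      (∀ c : k, algebraMap k C.functionField c ∈ v) → v ≠ ⊤ → ∃ x : closedPoints C,
        (∀ a ∈ localRing k x.1, a ∈ v) ∧ ∀ a ∈ localRing k x.1, a⁻¹ ∈ v → a⁻¹ ∈ localRing k x.1)
    (W : C.Opens) (hW : genericPoint C ∈ W) :
    ∃ (U₁ U₂ : C.Opens) (h₁ : genericPoint C ∈ U₁) (h₂ : genericPoint C ∈ U₂)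
      (t : C.functionField), IsAffineOpen U₁ ∧ IsAffineOpen U₂ ∧ U₁ ≤ W ∧
      IsTwoChartCover (fun x : closedPoints C => localRing k x.1) (coordinateRing k U₁ h₁)
        (coordinateRing k U₂ h₂) {x | x.1 ∈ U₁} {x | x.1 ∈ U₂} t := by
  classical
  obtain ⟨W', hW'o, hW'⟩ := i.isEmbedding.isInducing.isOpen_iff.mp W.isOpen
  have hηW' : i (genericPoint C) ∈ (⟨W', hW'o⟩ : (Proj 𝒜).Opens) := by
    change genericPoint C ∈ i ⁻¹' W'
    rw [hW']
    exact hW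
  obtain ⟨d, f, hd, hfd, hηf, hfW⟩ := exists_basicOpen_le_of_mem _ _ hηW'
  have hfin := finite_closedPoints_notMem hdim (i ⁻¹ᵁ Proj.basicOpen 𝒜 f) hηf
  -- Only finitely many closed points lie outside `D₊(f)`. Choosing `g` nonzero at them gives a
  -- cover, and nonzero at the generic point makes the second chart nonempty.
  obtain ⟨e, g, he, hge, hg⟩ := exists_basicOpen_of_finset (𝒜 := 𝒜)
    (insert (i (genericPoint C)) (hfin.toFinset.image fun x => i x.1))
  have hηg := hg _ (Finset.mem_insert_self _ _)
  -- Positive powers keep the basic open sets and equalize the degrees, so that `t = g ^ d / f ^ e`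
  -- is a rational function.
  have hfd' : f ^ e ∈ 𝒜 (e * d) := SetLike.pow_mem_graded e hfd
  have hge' : g ^ d ∈ 𝒜 (e * d) := mul_comm e d ▸ SetLike.pow_mem_graded d hge
  have hfe := Proj.basicOpen_pow 𝒜 f e he
  have hgd := Proj.basicOpen_pow 𝒜 g d hd
  have hed : 0 < e * d := Nat.mul_pos he hd
  have h₁ : genericPoint C ∈ i ⁻¹ᵁ Proj.basicOpen 𝒜 (f ^ e) := hfe.symm ▸ hηf
  have h₂ : genericPoint C ∈ i ⁻¹ᵁ Proj.basicOpen 𝒜 (g ^ d) := hgd.symm ▸ hηg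
  have ha₁ := (Proj.isAffineOpen_basicOpen 𝒜 (f ^ e) hfd' hed).preimage i
  have ha₂ := (Proj.isAffineOpen_basicOpen 𝒜 (g ^ d) hge' hed).preimage i
  have hmul := germ_app_fracSection_mul i hfd' hge' _ h₁ h₂
  have hinv := eq_inv_of_mul_eq_one_right (α := C.functionField) hmul
  refine ⟨_, _, h₁, h₂, C.presheaf.germ _ _ h₁ (i.app _ (fracSection 𝒜 hfd' hge')), ha₁, ha₂, ?_,
    isAffineChart hdim h₁ ha₁, isAffineChart hdim h₂ ha₂, fun x => ?_,
    left_ne_zero_of_mul_eq_one hmul, ⟨_, rfl⟩, ⟨_, hinv⟩, fun x hx hxt => ?_, fun x hx hxt => ?_,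
    eventually_mem_localRing hdim, hcenter⟩
  · rw [hfe]
    intro x hx
    have : x ∈ i ⁻¹' W' := hfW hx
    rwa [hW'] at this
  · by_cases hx : x.1 ∈ i ⁻¹ᵁ Proj.basicOpen 𝒜 f
    · exact Or.inl (hfe.symm ▸ hx)
    · refine Or.inr (hgd.symm ▸ hg _ (Finset.mem_insert_of_mem ?_))
      exact Finset.mem_image_of_mem _ (hfin.mem_toFinset.mpr hx)
  · refine basicOpen_app_fracSection i hfd' hge' x.1 ?_
    exact (invMem_germ_iff (k := k) h₁ hx _).mp ⟨left_ne_zero_of_mul_eq_one hmul, hxt⟩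
  · refine basicOpen_app_fracSection i hge' hfd' x.1 ?_
    refine (invMem_germ_iff (k := k) h₂ hx _).mp ⟨right_ne_zero_of_mul_eq_one hmul, ?_⟩
    rw [eq_inv_of_mul_eq_one_right (α := C.functionField) hmul, inv_inv]
    exact hxt

end Cover

/-! ### Centres of valuation rings on a proper curve. -/

section Center

variable {k : Type u} [Field k] {C : Scheme.{u}} [C.Over (Spec (.of k))]

theorem fromSpecStalk_over (x : C) : C.fromSpecStalk x ≫ (C ↘ Spec (.of k)) =
    Spec.map (CommRingCat.ofHom (algebraMap k (C.presheaf.stalk x))) := by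
  refine ext_of_isAffine ?_
  have h1 : CommRingCat.ofHom (algebraMap k (C.presheaf.stalk x)) =
      (Scheme.ΓSpecIso (.of k)).inv ≫ (C ↘ Spec (.of k)).appTop ≫
        C.presheaf.germ ⊤ x trivial := by
    ext c
    exact C.presheaf.germ_res_apply (homOfLE le_top : (⊤ : C.Opens) ⟶ ⊤) x trivial _
  rw [Scheme.Hom.comp_appTop, Scheme.fromSpecStalk_appTop,
    ← cancel_mono (Scheme.ΓSpecIso (C.presheaf.stalk x)).hom, Scheme.ΓSpecIso_naturality, h1,
    Iso.hom_inv_id_assoc]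
  simp

variable [IsIntegral C]

theorem mem_localRing_genericPoint (a : C.functionField) : a ∈ localRing k (genericPoint C) :=
  ⟨a, congr($(TopCat.Presheaf.stalkSpecializes_refl C.presheaf (genericPoint C)) a)⟩

/-- Every valuation ring of the function field of a proper curve is centered at some point. -/
theorem exists_center [IsProper (C ↘ Spec (.of k))] (hdim : topologicalKrullDim C = 1)
    (v : ValuationSubring C.functionField)
    (hv : ∀ c : k, algebraMap k C.functionField c ∈ v) (hvt : v ≠ ⊤) :
    ∃ x : closedPoints C, (∀ a ∈ localRing k x.1, a ∈ v) ∧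
      ∀ a ∈ localRing k x.1, a⁻¹ ∈ v → a⁻¹ ∈ localRing k x.1 := by
  let φ : k →+* v := (algebraMap k C.functionField).codRestrict v.toSubring hv
  have hex : ValuativeCriterion.Existence (C ↘ Spec (.of k)) := by
    have : UniversallyClosed (C ↘ Spec (.of k)) := inferInstance
    rw [UniversallyClosed.eq_valuativeCriterion] at this
    exact this.1
  -- By the valuative criterion the generic point `Spec K ⟶ C` extends to `Spec v`. The centre is
  -- the image of the closed point, and the induced map `𝒪_x → v` is local, which is the asserted
  -- domination.
  let S : ValuativeCommSq (C ↘ Spec (.of k)) :=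
    { R := v
      K := C.functionField
      i₁ := C.fromSpecStalk (genericPoint C)
      i₂ := Spec.map (CommRingCat.ofHom φ)
      commSq := ⟨by
        rw [fromSpecStalk_over, ← Spec.map_comp]
        rfl⟩ }
  obtain ⟨⟨l, hl, -⟩⟩ := (hex S).exists_lift
  let l : Spec (.of v) ⟶ C := l
  have hl : Spec.map (CommRingCat.ofHom (algebraMap v C.functionField)) ≫ l =
    C.fromSpecStalk (genericPoint C) := hl
  let x := l (IsLocalRing.closedPoint v)
  let ψ : C.presheaf.stalk x ⟶ .of v := Scheme.stalkClosedPointTo l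
  have hψ : ψ ≫ CommRingCat.ofHom (algebraMap v C.functionField) =
      C.presheaf.stalkSpecializes (specializes_genericPoint x) := by
    apply Spec.map_injective
    rw [← cancel_mono (C.fromSpecStalk x), Scheme.SpecMap_stalkSpecializes_fromSpecStalk,
      Spec.map_comp, Category.assoc, Scheme.Spec_stalkClosedPointTo_fromSpecStalk, hl]
  have hψ' (r : C.presheaf.stalk x) : (ψ r : C.functionField) =
      algebraMap (C.presheaf.stalk x) C.functionField r := congr($hψ r)
  have hloc : IsLocalHom ψ.hom := inferInstanceAs (IsLocalHom (Scheme.stalkClosedPointTo l).hom)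
  have key1 : ∀ a ∈ localRing k x, a ∈ v := by
    rintro _ ⟨r, rfl⟩
    exact hψ' r ▸ (ψ r).2
  -- At the generic point the local ring is all of `K`, which would force `v = ⊤`.
  have hx : x ≠ genericPoint C := by
    intro hx
    refine hvt (eq_top_iff.mpr fun a _ => key1 a ?_)
    exact hx.symm ▸ mem_localRing_genericPoint a
  refine ⟨⟨x, isClosed_singleton_of_ne_genericPoint hdim hx⟩, key1, ?_⟩
  rintro _ ⟨r, rfl⟩ hr
  by_cases h0 : r = 0
  · subst h0
    simp
  have hu : IsUnit (ψ r) := by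
    refine IsUnit.of_mul_eq_one (⟨_, hr⟩ : v) (Subtype.ext ?_)
    change (ψ r : C.functionField) * (algebraMap _ _ r)⁻¹ = 1
    rw [hψ']
    exact mul_inv_cancel₀ (mt (map_eq_zero_iff _ (IsFractionRing.injective _ _)).mp h0)
  exact ((invMem_localRing_iff r).mpr (hloc.map_nonunit r hu)).2

end Center

/-! ### Strong approximation for rational sections. -/

section Approximation

attribute [local instance] MvPolynomial.gradedAlgebra

variable (k : Type u) [Field k] {C : Scheme.{u}} [C.Over (Spec (.of k))] [IsIntegral C]

instance (F : C.Modules) : IsScalarTower k C.functionField (GenericStalk F) :=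
  .of_algebraMap_smul fun _ _ => rfl

theorem IsProjectiveCurve.isProper (C : Scheme.{u}) [C.Over (Spec (.of k))]
    [h : IsProjectiveCurve k C] : IsProper (C ↘ Spec (.of k)) := by
  obtain ⟨n, i, hi, h⟩ := h.exists_isClosedImmersion
  have := isProper_projectiveSpaceHom k n
  rw [← h]
  infer_instance

/-- Strong approximation away from the closed point `P`. -/
theorem exists_rational_approximation [IsProjectiveCurve k C] (F : C.Modules) [F.IsQuasicoherent]
    [F.IsFiniteType] (P : closedPoints C) (b : closedPoints C → GenericStalk F)
    (hb : ∀ᶠ x in Filter.cofinite, b x ∈ stalkLattice k F x.1) :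
    ∃ a, ∀ x, x ≠ P → b x - a ∈ stalkLattice k F x.1 := by
  have := IsProjectiveCurve.isNoetherian k C
  have := IsProjectiveCurve.isProper k C
  have hdim := IsProjectiveCurve.krullDim_eq_one k (C := C)
  obtain ⟨n, i, hi, -⟩ := IsProjectiveCurve.exists_isClosedImmersion (k := k) (C := C)
  let i : C ⟶ Proj (MvPolynomial.homogeneousSubmodule (Fin (n + 1)) k) := i
  have : IsClosedImmersion i := hi
  obtain ⟨W, hW, E, hE, hEs, hEW⟩ := exists_finite_span_rational k F
  obtain ⟨U₁, U₂, h₁, h₂, t, ha₁, ha₂, hUW, h⟩ := exists_isTwoChartCover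
    hdim i (exists_center (k := k) hdim) W hW
  refine h.strong_approximation (eventually_mem_stalkLattice hdim F)
    (isLocalizedOn_stalkLattice F h₁ ha₁) (isLocalizedOn_stalkLattice F h₂ ha₂) hE hEs
    (fun x hx => (hEW x.1 (hUW hx)).2) (fun x hx => (hEW x.1 (hUW hx)).1) P ?_ b hb
  -- A nonzero element of the maximal ideal at `P` is a regular function whose inverse is not
  -- regular there.
  obtain ⟨c, hc, hc0⟩ := Submodule.exists_mem_ne_zero_of_ne_bot
    (maximalIdeal_stalk_ne_bot (ne_genericPoint hdim P.2).symm)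
  have hinj := IsFractionRing.injective (C.presheaf.stalk P.1) C.functionField
  refine ⟨_, ⟨c, rfl⟩, fun hinv => hc ?_⟩
  exact (invMem_localRing_iff (k := k) c).mp ⟨(map_ne_zero_iff _ hinj).mpr hc0, hinv⟩

end Approximation

/-! ### Quasi-isomorphisms of two-term complexes in terms of elements. -/

section QuasiIso

open HomologicalComplex

variable {k : Type u} [Field k]

/-- The refinement criteria for mono and epi on homology ask for an epimorphism onto a test object
`A`, not for elements. The submodule of all solutions over `A` serves as its source; the hypotheses
say that it surjects onto `A`. -/
theorem quasiIsoAt_of_elements {K L : CochainComplex (ModuleCat.{u} k) ℕ} (φ : K ⟶ L) (i j l : ℕ)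
    (hi : (ComplexShape.up ℕ).prev j = i) (hl : (ComplexShape.up ℕ).next j = l)
    (hinj : ∀ x : K.X j, K.d j l x = 0 → ∀ y : L.X i, φ.f j x = L.d i j y →
      ∃ x', x = K.d i j x')
    (hsurj : ∀ y : L.X j, L.d j l y = 0 → ∃ (x : K.X j) (y' : L.X i), K.d j l x = 0 ∧
      y = φ.f j x + L.d i j y') : QuasiIsoAt φ j := by
  rw [quasiIsoAt_iff_isIso_homologyMap]
  have h1 : Mono (homologyMap φ j) := by
    rw [mono_homologyMap_iff_up_to_refinements φ i j l hi hl]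
    intro A x hx y hxy
    let N : Submodule k (A × K.X i) := LinearMap.eqLocus
      (x.hom ∘ₗ LinearMap.fst k A (K.X i)) ((K.d i j).hom ∘ₗ LinearMap.snd k A (K.X i))
    refine ⟨.of k N, ModuleCat.ofHom (LinearMap.fst k A (K.X i) ∘ₗ N.subtype), ?_,
      ModuleCat.ofHom (LinearMap.snd k A (K.X i) ∘ₗ N.subtype), ?_⟩
    · rw [ModuleCat.epi_iff_surjective]
      intro a
      obtain ⟨b, hb⟩ := hinj (x a) congr($hx a) (y a) congr($hxy a)
      exact ⟨⟨(a, b), hb⟩, rfl⟩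
    · ext ⟨_, h⟩
      exact h
  have h2 : Epi (homologyMap φ j) := by
    rw [epi_homologyMap_iff_up_to_refinements φ i j l hi hl]
    intro A y hy
    let N₁ : Submodule k (A × K.X j × L.X i) := LinearMap.eqLocus
      (y.hom ∘ₗ LinearMap.fst k A (K.X j × L.X i))
      (((φ.f j).hom ∘ₗ LinearMap.fst k (K.X j) (L.X i) + (L.d i j).hom ∘ₗ
        LinearMap.snd k (K.X j) (L.X i)) ∘ₗ LinearMap.snd k A (K.X j × L.X i))
    let N₂ : Submodule k (A × K.X j × L.X i) := LinearMap.ker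
      ((K.d j l).hom ∘ₗ LinearMap.fst k (K.X j) (L.X i) ∘ₗ LinearMap.snd k A (K.X j × L.X i))
    refine ⟨.of k ↥(N₁ ⊓ N₂), ModuleCat.ofHom (LinearMap.fst k A _ ∘ₗ (N₁ ⊓ N₂).subtype), ?_,
      ModuleCat.ofHom (LinearMap.fst k (K.X j) (L.X i) ∘ₗ LinearMap.snd k A _ ∘ₗ
        (N₁ ⊓ N₂).subtype), ?_,
      ModuleCat.ofHom (LinearMap.snd k (K.X j) (L.X i) ∘ₗ LinearMap.snd k A _ ∘ₗ
        (N₁ ⊓ N₂).subtype), ?_⟩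
    · rw [ModuleCat.epi_iff_surjective]
      intro a
      obtain ⟨b, c, hb, hbc⟩ := hsurj (y a) congr($hy a)
      exact ⟨⟨(a, b, c), hbc, hb⟩, rfl⟩
    · ext ⟨_, h⟩
      exact h.2
    · ext ⟨_, h⟩
      exact h.1
  exact isIso_of_mono_of_epi _

/-- The four hypotheses are injectivity and surjectivity on `H⁰`, then injectivity and surjectivity
on `H¹`. -/
theorem quasiIso_twoTermMap {X₀ X₁ Y₀ Y₁ : ModuleCat.{u} k} {d : X₀ ⟶ X₁} {e : Y₀ ⟶ Y₁}
    (f₀ : X₀ ⟶ Y₀) (f₁ : X₁ ⟶ Y₁) (comm : f₀ ≫ e = d ≫ f₁)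
    (h₀ : ∀ x, d x = 0 → f₀ x = 0 → x = 0) (h₀' : ∀ y, e y = 0 → ∃ x, d x = 0 ∧ f₀ x = y)
    (h₁ : ∀ x y, f₁ x = e y → ∃ x', d x' = x) (h₁' : ∀ y, ∃ x y', y = f₁ x + e y') :
    QuasiIso (twoTermMap f₀ f₁ comm) := by
  let a := doubleXIso₀ d rel_zero_one
  let b := doubleXIso₁ d rel_zero_one zero_ne_one
  let a' := doubleXIso₀ e rel_zero_one
  let b' := doubleXIso₁ e rel_zero_one zero_ne_one
  have hf₀ : (twoTermMap f₀ f₁ comm).f 0 = a.hom ≫ f₀ ≫ a'.inv := mkHomFromDouble_f₀ ..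
  have hf₁ : (twoTermMap f₀ f₁ comm).f 1 = b.hom ≫ f₁ ≫ b'.inv := mkHomFromDouble_f₁ ..
  have hd : (twoTermComplex d).d 0 1 = a.hom ≫ d ≫ b.inv := double_d _ _ zero_ne_one
  have he : (twoTermComplex e).d 0 1 = a'.hom ≫ e ≫ b'.inv := double_d _ _ zero_ne_one
  have hd0 (x) : (twoTermComplex d).d 0 1 x = b.inv (d (a.hom x)) := congr($hd x)
  have he0 (y) : (twoTermComplex e).d 0 1 y = b'.inv (e (a'.hom y)) := congr($he y)
  have hg₀ (x) : (twoTermMap f₀ f₁ comm).f 0 x = a'.inv (f₀ (a.hom x)) := congr($hf₀ x)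
  have hg₁ (x) : (twoTermMap f₀ f₁ comm).f 1 x = b'.inv (f₁ (b.hom x)) := congr($hf₁ x)
  have inj {X Y : ModuleCat.{u} k} (f : X ⟶ Y) [IsIso f] : Function.Injective f :=
    (ConcreteCategory.bijective_of_isIso f).1
  have surj {X Y : ModuleCat.{u} k} (f : X ⟶ Y) [IsIso f] : Function.Surjective f :=
    (ConcreteCategory.bijective_of_isIso f).2
  have hb_inv (x) : b.inv (b.hom x) = x := congr($(b.hom_inv_id) x)
  have hb_inv' (x) : b'.inv (b'.hom x) = x := congr($(b'.hom_inv_id) x)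
  have hb_hom (x) : b.hom (b.inv x) = x := congr($(b.inv_hom_id) x)
  have ha_inv' (x) : a'.inv (a'.hom x) = x := congr($(a'.hom_inv_id) x)
  have z₁ (y) : (twoTermComplex e).d 0 0 y = 0 :=
    congr($(double_d_eq_zero₁ e rel_zero_one 0 0 zero_ne_one) y)
  have z₂ (x) : (twoTermComplex d).d 1 2 x = 0 :=
    congr($(double_d_eq_zero₀ d rel_zero_one 1 2 one_ne_zero) x)
  refine ⟨fun n => ?_⟩
  match n with
  | 0 =>
    -- The predecessor of `0` in `ComplexShape.up ℕ` is `0` by default; the differential from `0` to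
    -- itself is zero (`z₁`), so there are no boundaries.
    refine quasiIsoAt_of_elements _ 0 0 1 (by simp) (by simp) (fun x hx y hxy => ⟨0, ?_⟩)
      fun y hy => ?_
    · rw [hd0, ← map_zero b.inv.hom] at hx
      rw [z₁, hg₀, ← map_zero a'.inv.hom] at hxy
      have := h₀ _ (inj b.inv hx) (inj a'.inv hxy)
      rw [← map_zero a.hom.hom] at this
      rw [map_zero]
      exact inj a.hom this
    · rw [he0, ← map_zero b'.inv.hom] at hy
      obtain ⟨x, hx, hxy⟩ := h₀' _ (inj b'.inv hy)
      obtain ⟨x, rfl⟩ := surj a.hom x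
      refine ⟨x, 0, ?_, ?_⟩
      · rw [hd0, hx, map_zero]
      · rw [z₁, hg₀, hxy, add_zero, ha_inv']
  | 1 =>
    refine quasiIsoAt_of_elements _ 0 1 2 (by simp) (by simp) (fun x hx y hxy => ?_)
      fun y hy => ?_
    · rw [hg₁, he0] at hxy
      obtain ⟨x', hx'⟩ := h₁ _ _ (inj b'.inv hxy)
      obtain ⟨x', rfl⟩ := surj a.hom x'
      exact ⟨x', by rw [hd0, hx', hb_inv]⟩
    · obtain ⟨x, y', hy'⟩ := h₁' (b'.hom y)
      obtain ⟨y', rfl⟩ := surj a'.hom y'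
      refine ⟨b.inv x, y', z₂ _, ?_⟩
      rw [hg₁, he0, hb_hom, ← map_add, ← hy', hb_inv']
  | n + 2 =>
    have hK := isZero_double_X d rel_zero_one (n + 2) (by omega) (by omega)
    have hL := isZero_double_X e rel_zero_one (n + 2) (by omega) (by omega)
    refine quasiIsoAt_of_elements _ (n + 1) (n + 2) (n + 3) (by simp) (by simp)
      (fun x hx y hxy => ?_) fun y hy => ?_
    · have := ModuleCat.subsingleton_of_isZero hK
      exact ⟨0, Subsingleton.elim _ _⟩
    · have := ModuleCat.subsingleton_of_isZero hL
      exact ⟨0, 0, map_zero _, Subsingleton.elim _ _⟩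

end QuasiIso

/-! ### Rational sections inside the completed stalk. -/

section LocalGlobal

open IsLocalRing

variable {C : Scheme.{u}} [IsIntegral C] [IsLocallyNoetherian C] (F : C.Modules) {x : C}

omit [IsLocallyNoetherian C] in
theorem smul_genericStalk_injective {c : C.presheaf.stalk x} (hc : c ≠ 0) :
    Function.Injective fun v : GenericStalk F => c • v := by
  intro v w h
  have hinj := IsFractionRing.injective (C.presheaf.stalk x) C.functionField
  exact smul_right_injective (GenericStalk F) ((map_ne_zero_iff _ hinj).mpr hc) h

variable [Ring.DimensionLEOne (C.presheaf.stalk x)]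

theorem completedToRational_injective (hF : IsTorsionFreeSheaf F)
    (hm : maximalIdeal (C.presheaf.stalk x) ≠ ⊥) : Function.Injective (completedToRational F x) :=
  have := hF x
  completion_mk_injective hm

variable [F.IsQuasicoherent]

omit [Ring.DimensionLEOne (C.presheaf.stalk x)] in
theorem genericToLocalRational_toGenericStalk (m : F.presheaf.stalk x) :
    genericToLocalRational F x (toGenericStalk F x m) =
      completedToRational F x (toCompletedStalk F x m) :=
  IsLocalizedModule.lift_apply _ _ _ _ _

/-- A rational section which lies in the image of `F̂_x` is regular at `x`. -/
theorem exists_toGenericStalk_eq (hF : IsTorsionFreeSheaf F)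
    (hm : maximalIdeal (C.presheaf.stalk x) ≠ ⊥) {a : GenericStalk F} {y : CompletedStalk F x}
    (h : genericToLocalRational F x a = completedToRational F x y) :
    ∃ m, toGenericStalk F x m = a ∧ toCompletedStalk F x m = y := by
  have := hF x
  have hinj := completedToRational_injective F hF hm
  obtain ⟨⟨m, c⟩, hc⟩ := IsLocalizedModule.surj (nonZeroDivisors (C.presheaf.stalk x))
    (toGenericStalk F x) a
  have hc : (c : C.presheaf.stalk x) • a = toGenericStalk F x m := hc
  -- With `a = m / c`, integrality of `a` means that `m` is divisible by `c` in the completed stalk;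
  -- by faithful flatness it is then divisible by `c` in `F_x`.
  have h1 : toCompletedStalk F x m = (c : C.presheaf.stalk x) • y := by
    apply hinj
    rw [← genericToLocalRational_toGenericStalk, ← hc, map_smul, h]
    exact (((completedToRational F x).restrictScalars (C.presheaf.stalk x)).map_smul _ y).symm
  obtain ⟨n, rfl⟩ := exists_eq_smul_of_completion h1
  have h2 : toGenericStalk F x n = a := by
    apply smul_genericStalk_injective F (nonZeroDivisors.ne_zero c.2)
    exact (map_smul _ _ _).symm.trans hc.symm
  refine ⟨n, h2, hinj ?_⟩
  rw [← genericToLocalRational_toGenericStalk, h2, h]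

/-- Every element of `F̂_x ⊗ K_x` is the sum of a rational section and an integral element. -/
theorem exists_eq_genericToLocalRational_add (hm : maximalIdeal (C.presheaf.stalk x) ≠ ⊥)
    (w : LocalRationalStalk F x) : ∃ (v : GenericStalk F) (y : CompletedStalk F x),
      w = genericToLocalRational F x v + completedToRational F x y := by
  obtain ⟨c, m, y, hc, h⟩ := exists_smul_eq_mk hm w
  let y : CompletedStalk F x := y
  have h : c • w = completedToRational F x (toCompletedStalk F x m + c • y) := h
  have hinj := IsFractionRing.injective (C.presheaf.stalk x) C.functionField
  have hc' := (map_ne_zero_iff _ hinj).mpr hc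
  -- From `c w = m + c y` one gets `w = m / c + y`, as `c` acts invertibly on `F̂_x ⊗ K_x`.
  let v : GenericStalk F :=
    (algebraMap (C.presheaf.stalk x) C.functionField c)⁻¹ • toGenericStalk F x m
  have hv : c • v = toGenericStalk F x m := smul_inv_smul₀ hc' _
  refine ⟨v, y, ?_⟩
  have hu := (Module.End.isUnit_iff _).mp
    (isUnit_localRationalStalk F x ⟨c, mem_nonZeroDivisors_of_ne_zero hc⟩)
  apply hu.1
  change c • w = c • (_ + _)
  rw [h, smul_add, ← map_smul, hv, genericToLocalRational_toGenericStalk, map_add]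
  congr 1
  exact ((completedToRational F x).restrictScalars (C.presheaf.stalk x)).map_smul c y

end LocalGlobal

/-! ### The comparison morphism on cohomology. -/

section Comparison

open IsLocalRing

variable (k : Type u) [Field k] {C : Scheme.{u}} [C.Over (Spec (.of k))] [IsIntegral C]
  [IsProjectiveCurve k C] (F : C.Modules) [F.IsQuasicoherent]

theorem adelicDifferential_apply (a : GenericStalk F) (g : IntegralAdeles F) (x : closedPoints C) :
    (adelicDifferential k F (a, g)).1 x =
      rationalToLocal k F x.1 a - completedToRational F x.1 (g x) :=
  rfl

variable {k F} in
theorem sub_eq_of_adelicDifferential_eq {a : GenericStalk F} {g : IntegralAdeles F} {y : adeles k F}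
    (h : adelicDifferential k F (a, g) = y) (x : closedPoints C) :
    rationalToLocal k F x.1 a - completedToRational F x.1 (g x) = y.1 x := by
  rw [← h, adelicDifferential_apply]

variable {k F} in
theorem eq_of_adelicDifferential_eq {a : GenericStalk F} {g : IntegralAdeles F} {y : adeles k F}
    (h : adelicDifferential k F (a, g) = y) {x : closedPoints C} (hx : y.1 x = 0) :
    rationalToLocal k F x.1 a = completedToRational F x.1 (g x) := by
  rw [← sub_eq_zero, sub_eq_of_adelicDifferential_eq h, hx]

variable {k F} in
theorem eq_of_adelicDifferential_eq_zero {q : GenericStalk F × IntegralAdeles F}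
    (h : adelicDifferential k F q = 0) (x : closedPoints C) :
    rationalToLocal k F x.1 q.1 = completedToRational F x.1 (q.2 x) := by
  have h1 : (adelicDifferential k F (q.1, q.2)).1 x = 0 := by
    rw [Prod.mk.eta, h]
    rfl
  exact sub_eq_zero.mp h1

theorem localDifferential_apply (P : closedPoints C) (w : Γ(F, complement P))
    (f : CompletedStalk F P.1) : localDifferential k F P (w, f) = rationalToLocal k F P.1
      (toRationalSections F k _ (genericPoint_mem_complement k P) w) -
        completedToRational F P.1 f :=
  rfl

omit [IsIntegral C] [IsProjectiveCurve k C] [F.IsQuasicoherent] in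
theorem singleAdele_same (P : closedPoints C) (w : LocalRationalStalk F P.1) :
    (singleAdele k F P w).1 P = w := by
  classical exact Pi.single_eq_same _ _

omit [IsIntegral C] [IsProjectiveCurve k C] [F.IsQuasicoherent] in
theorem singleAdele_of_ne {P x : closedPoints C} (h : x ≠ P) (w : LocalRationalStalk F P.1) :
    (singleAdele k F P w).1 x = 0 := by
  classical exact Pi.single_eq_of_ne h _

omit [F.IsQuasicoherent] in
theorem comparisonZero_snd_same (P : closedPoints C) (w : Γ(F, complement P))
    (f : CompletedStalk F P.1) : (comparisonZero k F P (w, f)).2 P = f := by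
  classical
  have h1 : germsAwayFrom k F P w P = 0 := by simp [germsAwayFrom]
  have h2 : (comparisonZero k F P (w, f)).2 P = germsAwayFrom k F P w P +
    LinearMap.single k (fun x : closedPoints C => CompletedStalk F x.1) P f P := rfl
  rw [h2, LinearMap.single_apply, h1, zero_add, Pi.single_eq_same]

omit [F.IsQuasicoherent] in
theorem comparisonZero_snd_of_ne {P x : closedPoints C} (h : x ≠ P) (w : Γ(F, complement P))
    (f : CompletedStalk F P.1) : (comparisonZero k F P (w, f)).2 x =
      toCompletedStalk F x.1 (germLinear F x.1 k _ (mem_complement h) w) := by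
  classical
  have h1 : germsAwayFrom k F P w x =
      toCompletedStalk F x.1 (germLinear F x.1 k _ (mem_complement h) w) := by
    simp [germsAwayFrom, h]
  have h2 : (comparisonZero k F P (w, f)).2 x = germsAwayFrom k F P w x +
    LinearMap.single k (fun x : closedPoints C => CompletedStalk F x.1) P f x := rfl
  rw [h2, LinearMap.single_apply, h1, Pi.single_eq_of_ne h, add_zero]

variable {F}

include k in
omit [F.IsQuasicoherent] in
theorem completedToRational_injective_of_closedPoint (hF : IsTorsionFreeSheaf F)
    (x : closedPoints C) : Function.Injective (completedToRational F x.1) := by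
  have := IsProjectiveCurve.isNoetherian k C
  have hdim := IsProjectiveCurve.krullDim_eq_one k (C := C)
  have := dimensionLEOne_stalk hdim x.1
  exact completedToRational_injective F hF
    (maximalIdeal_stalk_ne_bot (ne_genericPoint hdim x.2).symm)

/-- A rational section which is integral at each closed point `x ≠ P` is regular away from `P`. -/
theorem exists_section_of_integral (hF : IsTorsionFreeSheaf F) (P : closedPoints C)
    (a : GenericStalk F) (g : IntegralAdeles F)
    (h : ∀ x, x ≠ P → rationalToLocal k F x.1 a = completedToRational F x.1 (g x)) :
    ∃ w, toRationalSections F k _ (genericPoint_mem_complement k P) w = a := by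
  have := IsProjectiveCurve.isNoetherian k C
  have hdim := IsProjectiveCurve.krullDim_eq_one k (C := C)
  refine exists_section_of_forall_mem F hF (genericPoint_mem_complement k P) a fun x hx => ?_
  by_cases hη : x = genericPoint C
  · subst hη
    exact ⟨a, congr($(TopCat.Presheaf.stalkSpecializes_refl F.presheaf (genericPoint C)) a)⟩
  · have := dimensionLEOne_stalk hdim x
    let y : closedPoints C := ⟨x, isClosed_singleton_of_ne_genericPoint hdim hη⟩
    have hy : y ≠ P := fun h' => hx (congrArg Subtype.val h')
    obtain ⟨m, hm, -⟩ := exists_toGenericStalk_eq F hF (maximalIdeal_stalk_ne_bot hη) (h y hy)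
    exact ⟨m, hm⟩

/-- This is surjectivity on `H¹`. Modulo integral adeles `y` is a family of rational sections `v x`,
chosen zero wherever `y` is integral so that strong approximation applies. The resulting `a` removes
it away from `P`, and what is left is supported at `P`. -/
theorem exists_eq_singleAdele_add [F.IsFiniteType] (P : closedPoints C) (y : adeles k F) :
    ∃ (w : LocalRationalStalk F P.1) (q : GenericStalk F × IntegralAdeles F),
      y = singleAdele k F P w + adelicDifferential k F q := by
  classical
  have := IsProjectiveCurve.isNoetherian k C
  have hdim := IsProjectiveCurve.krullDim_eq_one k (C := C)
  have hloc : ∀ x : closedPoints C, ∃ (v : GenericStalk F) (z : CompletedStalk F x.1),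
      y.1 x = rationalToLocal k F x.1 v + completedToRational F x.1 z ∧
        (y.1 x ∈ integralSubmodule k F x.1 → v = 0) := by
    intro x
    by_cases hx : y.1 x ∈ integralSubmodule k F x.1
    · obtain ⟨z, hz⟩ := hx
      exact ⟨0, z, by rw [map_zero, zero_add]; exact hz.symm, fun _ => rfl⟩
    · have := dimensionLEOne_stalk hdim x.1
      obtain ⟨v, z, h⟩ := exists_eq_genericToLocalRational_add F
        (maximalIdeal_stalk_ne_bot (ne_genericPoint hdim x.2).symm) (y.1 x)
      exact ⟨v, z, h, fun h' => absurd h' hx⟩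
  choose v z hvz hv using hloc
  obtain ⟨a, ha⟩ := exists_rational_approximation k F P v
    (((mem_adeles k).mp y.2).mono fun x hx => hv x hx ▸ zero_mem _)
  -- Nothing is known about `v x - a` at `P`. There `m` is arbitrary, and its contribution is
  -- compensated in the component at `P` below.
  have hm : ∀ x, ∃ m, x ≠ P → toGenericStalk F x.1 m = v x - a := by
    intro x
    by_cases hx : x = P
    · exact ⟨0, fun h => absurd hx h⟩
    · obtain ⟨m, hm⟩ := ha x hx
      exact ⟨m, fun _ => hm⟩
  choose m hm using hm
  refine ⟨y.1 P - rationalToLocal k F P.1 a +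
      completedToRational F P.1 (-(toCompletedStalk F P.1 (m P) + z P)),
    (a, fun x => -(toCompletedStalk F x.1 (m x) + z x)), Subtype.ext (funext fun x => ?_)⟩
  change y.1 x = (singleAdele k F P _).1 x + (adelicDifferential k F _).1 x
  rw [adelicDifferential_apply]
  by_cases hx : x = P
  · subst hx
    rw [singleAdele_same]
    abel
  · have h1 : rationalToLocal k F x.1 (v x - a) =
        completedToRational F x.1 (toCompletedStalk F x.1 (m x)) := by
      rw [← hm x hx]
      exact genericToLocalRational_toGenericStalk F (m x)
    rw [map_sub, sub_eq_iff_eq_add] at h1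
    rw [singleAdele_of_ne k F hx, hvz x, h1, map_neg, map_add]
    abel

theorem comparisonZero_eq_zero (hF : IsTorsionFreeSheaf F) (P : closedPoints C)
    (q : Γ(F, complement P) × CompletedStalk F P.1) (h : comparisonZero k F P q = 0) : q = 0 := by
  obtain ⟨w, f⟩ := q
  have h1 : toRationalSections F k _ (genericPoint_mem_complement k P) w = 0 := congrArg Prod.fst h
  have h2 : f = 0 := (comparisonZero_snd_same k F P w f).symm.trans
    (congrArg (fun q : GenericStalk F × IntegralAdeles F => q.2 P) h)
  have h3 : w = 0 := genericGerm_injective F hF (genericPoint_mem_complement k P)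
    (h1.trans (map_zero (genericGerm F _ (genericPoint_mem_complement k P))).symm)
  rw [h2, h3, Prod.mk_zero_zero]

/-- A cocycle of the adelic complex is a rational section integral at all closed points; away from
`P` its integral components are forced to be its germs, since `F̂_x` embeds in `F̂_x ⊗ K_x`. -/
theorem exists_comparisonZero_eq (hF : IsTorsionFreeSheaf F) (P : closedPoints C)
    (q : GenericStalk F × IntegralAdeles F) (h : adelicDifferential k F q = 0) :
    ∃ p, localDifferential k F P p = 0 ∧ comparisonZero k F P p = q := by
  have h1 := eq_of_adelicDifferential_eq_zero h
  obtain ⟨w, hw⟩ := exists_section_of_integral k hF P q.1 q.2 fun x _ => h1 x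
  refine ⟨(w, q.2 P), ?_, Prod.ext hw (funext fun x => ?_)⟩
  · rw [localDifferential_apply, hw, h1, sub_self]
  by_cases hx : x = P
  · subst hx
    exact comparisonZero_snd_same k F x w (q.2 x)
  · rw [comparisonZero_snd_of_ne k F hx]
    apply completedToRational_injective_of_closedPoint k hF x
    rw [← h1 x, ← hw]
    exact (rationalToLocal_genericGerm k F x.1 _ _ _ w).symm

/-- If an adele supported at `P` is a coboundary of `(a, g)`, then `a` is integral away from `P`,
hence a section over `C - P`, and the component at `P` is a coboundary of the second complex. -/
theorem exists_localDifferential_eq (hF : IsTorsionFreeSheaf F) (P : closedPoints C)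
    (w : LocalRationalStalk F P.1) (q : GenericStalk F × IntegralAdeles F)
    (h : singleAdele k F P w = adelicDifferential k F q) : ∃ p, localDifferential k F P p = w := by
  obtain ⟨a, g⟩ := q
  have h1 : ∀ x, x ≠ P → rationalToLocal k F x.1 a = completedToRational F x.1 (g x) :=
    fun x hx => eq_of_adelicDifferential_eq h.symm (singleAdele_of_ne k F hx w)
  obtain ⟨s, rfl⟩ := exists_section_of_integral k hF P a g h1
  refine ⟨(s, g P), ?_⟩
  exact (sub_eq_of_adelicDifferential_eq h.symm P).trans (singleAdele_same k F P w)

/-- The comparison morphism is a quasi-isomorphism; smoothness at `P` is not needed. -/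
theorem quasiIso_comparison [F.IsFiniteType] (hF : IsTorsionFreeSheaf F) (P : closedPoints C) :
    QuasiIso (comparison k F P) :=
  quasiIso_twoTermMap _ _ _ (fun q _ h => comparisonZero_eq_zero k hF P q h)
    (fun q h => exists_comparisonZero_eq k hF P q h)
    (fun w q h => exists_localDifferential_eq k hF P w q h)
    (fun y => exists_eq_singleAdele_add k P y)

end Comparison

end AdelicCurve

theorem proposition3 (k : Type u) [Field k] (C : Scheme.{u}) [C.Over (Spec (.of k))]
    [AlgebraicGeometry.IsIntegral C] [AdelicCurve.IsProjectiveCurve k C]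
    (P : closedPoints C) (hP : AdelicCurve.IsSmoothPoint k P.1)
    (F : C.Modules) [F.IsQuasicoherent] [F.IsFiniteType] (hF : AdelicCurve.IsTorsionFreeSheaf F) :
    QuasiIso (AdelicCurve.comparison k F P) :=
  AdelicCurve.quasiIso_comparison k hF P
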